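/- Let $b\in\mathbb{R}$, $b\neq 0$, let $0\le\mu\in L^1(\mathbb{R})$ and $\nu=\int_{\mathbb{R}}\mu$. Let $$F(b,g)=\pi g^2+\frac{b^2}{4\pi}\Big\{\frac{2\pi g}{b}\Big\}\Big(1-\Big\{\frac{2\pi g}{b}\Big\}\Big),\qquad g\in\mathbb{R},$$ where $\{x\}$ is the fractional part of $x$. For a nonnegative bounded operator $G$ on $L^2(\mathbb{R})=L^2(\mathbb{R};\mathbb{C})$ with $\mathrm{Tr}(G)=\nu$ and density $\rho_G(x)=G(x,x)$, set $$\mathcal{E}(G)=\tfrac12\mathrm{Tr}(-\Delta_1G)+\mathrm{Tr}\,F(b,G)+\tfrac12\mathcal{D}_1(\rho_G-\mu)\in[0,\infty],\qquad \mathcal{D}_1(f)=4\pi\int_{\mathbb{R}}|W_f|^2,\quad W_f(x)=\int_{-\infty}^xf,$$ where $\Delta_1$ is the one-dimensional Laplacian, $\mathrm{Tr}(-\Delta_1G)=\sum_jg_j\|\psi_j'\|_{L^2}^2$ if $G=\sum_jg_j|\psi_j\rangle\langle\psi_j|$ with $(\psi_j)$ orthonormal and $g_j>0$ (it is $+\infty$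 if some $\psi_j\notin H^1(\mathbb{R})$), and $\mathcal{D}_1(f)=+\infty$ if $W_f\notin L^2(\mathbb{R})$. Let $f_b(g)=\{a\in\mathbb{R}:\ F(b,g')-F(b,g)\ge a(g'-g)\text{ for all }g'\in\mathbb{R}\}$ be the subdifferential of $F(b,\cdot)$. Set $h_b(y)=\{g\in\mathbb{R}:\ y\in f_b(g)\}$ for $y\ge0$ and $h_b(y)=\{0\}$ for $y<0$. These sets are compact intervals; write $h_b(y)=[h_b^-(y),h_b^+(y)]$. Let $G_*$ be a minimizer of $\mathcal{E}$ over $\{G\ge0,\ \mathrm{Tr}(G)=\nu\}$, and let $\rho_*=\rho_{G_*}$. Then there is a unique function $\Phi_*:\mathbb{R}\to\mathbb{R}$ which is differentiable with locally absolutely continuous derivative and satisfies $$-\Phi_*''=4\pi(\rho_*-\mu)\ \text{ a.e.},\qquad \Phi_*'(x)\to0\ \text{ as }x\to\pm\infty,\qquad \Phi_*(0)=0.$$ The operator $H_*=-\frac12\Delta_1+\Phi_*$, with domain the set of all $\psi\in L^2(\mathbb{R})$ such that $-\frac12\psi''+\Phi_*\psi\in L^2(\mathbb{R})$ in the sense of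 distributions, is self-adjoint, and there is $\lambda\in\mathbb{R}$ such that the operators $h_b^\pm(\lambda-H_*)$ (Borel functional calculus) are bounded and $$h_b^-(\lambda-H_*)\ \le\ G_*\ \le\ h_b^+(\lambda-H_*)$$ in the sense of quadratic forms on $L^2(\mathbb{R})$. Moreover $G_*$ commutes with $H_*$: for every $\psi$ in the domain of $H_*$, $G_*\psi$ is in the domain of $H_*$ and $H_*G_*\psi=G_*H_*\psi$. -/

import Mathlib

open MeasureTheory Filter Topology
open scoped ENNReal ContDiff InnerProductSpace

noncomputable section

namespace RHF

/-- The complex Hilbert space `L²(ℝ)`. -/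
abbrev L2R : Type := Lp ℂ 2 (volume : Measure ℝ)

/-- The continuous functional calculus of Mathlib for self-adjoint operators on `L²(ℝ)`. -/
instance : ContinuousFunctionalCalculus ℝ (L2R →L[ℂ] L2R) IsSelfAdjoint :=
  IsSelfAdjoint.instContinuousFunctionalCalculus

/-- Real-valued test functions on the line, `C_c^∞(ℝ)`. -/
def IsTestFunction (φ : ℝ → ℝ) : Prop :=
  ContDiff ℝ ∞ φ ∧ HasCompactSupport φ

/-! ### Traces of positive operators, density and kinetic energy -/

/-- The index set of a fixed orthonormal basis of `L²(ℝ)`. -/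
def onbIndex : Set L2R := (exists_hilbertBasis ℂ L2R).choose

/-- A fixed orthonormal basis of `L²(ℝ)`. All the quantities below that are computed in this
basis are independent of it. -/
def onb : HilbertBasis onbIndex ℂ L2R := (exists_hilbertBasis ℂ L2R).choose_spec.choose

/-- The trace `∑ᵢ ⟨eᵢ, A eᵢ⟩ ∈ [0, ∞]` of a nonnegative bounded operator; the operator is trace
class if and only if it is finite. -/
def trace (A : L2R →L[ℂ] L2R) : ℝ≥0∞ :=
  ∑' i, ENNReal.ofReal (⟪onb i, A (onb i)⟫_ℂ).re

/-- The density `ρ_G(x) = G(x, x)` of a nonnegative trace class operator `G`. Since `G = √G √G`, its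
integral kernel is `G(x, y) = ∑ᵢ (√G eᵢ)(x) conj ((√G eᵢ)(y))`. If `G = ∑ⱼ gⱼ |ψⱼ⟩⟨ψⱼ|`,
this is `∑ⱼ gⱼ |ψⱼ|²` almost everywhere. -/
def density (G : L2R →L[ℂ] L2R) (x : ℝ) : ℝ :=
  ∑' i, ‖(CFC.sqrt G (onb i) : ℝ → ℂ) x‖ ^ 2

/-- `v` is the weak derivative of `u`. -/
def IsWeakDeriv (u v : L2R) : Prop :=
  ∀ φ : ℝ → ℝ, IsTestFunction φ → ∫ x, deriv φ x • u x = - ∫ x, φ x • v x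

/-- The Dirichlet form `⟨u, -Δ₁ u⟩ = ‖u'‖²` on `H¹(ℝ)`, extended by `∞` outside `H¹(ℝ)`. -/
def dirichlet (u : L2R) : ℝ≥0∞ :=
  ⨅ (v : L2R) (_ : IsWeakDeriv u v), ‖v‖ₑ ^ 2

/-- `Tr(-Δ₁ G) = Tr(√G (-Δ₁) √G) ∈ [0, ∞]` for a nonnegative bounded operator `G`.
If `G = ∑ⱼ gⱼ |ψⱼ⟩⟨ψⱼ|`, this is `∑ⱼ gⱼ ‖ψⱼ'‖²`. -/
def traceNegLaplacian (G : L2R →L[ℂ] L2R) : ℝ≥0∞ :=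
  ∑' i, dirichlet (CFC.sqrt G (onb i))

/-! ### The energy -/

/-- `F(b, g) = π g² + b²/(4π) {2πg/b} (1 - {2πg/b})`, with `{·}` the fractional part. -/
def F (b g : ℝ) : ℝ :=
  Real.pi * g ^ 2 + b ^ 2 / (4 * Real.pi) *
    (Int.fract (2 * Real.pi * g / b) * (1 - Int.fract (2 * Real.pi * g / b)))

/-- The primitive `W_f(x) = ∫_{-∞}^x f`. -/
def primitive (f : ℝ → ℝ) (x : ℝ) : ℝ := ∫ t in Set.Iic x, f t

open Classical in
/-- The one-dimensional Hartree energy `𝒟₁(f) = 4π ∫ |W_f|²`; it is `∞` unless `f ∈ L¹` and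
`W_f ∈ L²`. -/
def hartree (f : ℝ → ℝ) : ℝ≥0∞ :=
  if Integrable f then ENNReal.ofReal (4 * Real.pi) * ∫⁻ x, ‖primitive f x‖ₑ ^ 2 else ⊤

/-- The energy `½ Tr(-Δ₁ G) + Tr(F(b, G)) + ½ 𝒟₁(ρ_G - μ) ∈ [0, ∞]`, where `F(b, G)` is given by the
functional calculus. -/
def energy (b : ℝ) (μ : ℝ → ℝ) (G : L2R →L[ℂ] L2R) : ℝ≥0∞ :=
  2⁻¹ * traceNegLaplacian G + trace (cfc (F b) G)
    + 2⁻¹ * hartree (fun x => density G x - μ x)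

/-- The admissible states: `G ≥ 0` with `Tr(G) = ν`. -/
def admissible (ν : ℝ) : Set (L2R →L[ℂ] L2R) :=
  {G | G.IsPositive ∧ trace G = ENNReal.ofReal ν}

/-- `G` minimizes the energy among the admissible states with `ν = ∫ μ`. -/
def IsMinimizer (b : ℝ) (μ : ℝ → ℝ) (G : L2R →L[ℂ] L2R) : Prop :=
  G ∈ admissible (∫ x, μ x) ∧
    ∀ G' ∈ admissible (∫ x, μ x), energy b μ G ≤ energy b μ G'

/-! ### The set-valued maps `f_b` and `h_b` -/

/-- The subdifferential `f_b(g)` of `F(b, ·)` at `g`. -/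
def subdiffF (b g : ℝ) : Set ℝ :=
  {a | ∀ g' : ℝ, a * (g' - g) ≤ F b g' - F b g}

open Classical in
/-- The inverse `h_b` of the set-valued map `f_b` on `[0, ∞)`, extended by `h_b(y) = {0}` for
`y < 0`. -/
def h (b y : ℝ) : Set ℝ :=
  if y < 0 then {0} else {x | y ∈ subdiffF b x}

/-- The lower end point of the compact interval `h_b(y)`. -/
def hMinus (b y : ℝ) : ℝ := sInf (h b y)

/-- The upper end point of the compact interval `h_b(y)`. -/
def hPlus (b y : ℝ) : ℝ := sSup (h b y)

/-! ### The mean-field potential and the mean-field Hamiltonian -/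

/-- `Φ` solves `-Φ'' = 4π f`, `Φ'(x) → 0` as `x → ±∞`, `Φ(0) = 0`. For `f` in `L¹` the equation
means that `Φ` is differentiable, that `Φ'` is locally absolutely continuous and that the equation
holds almost everywhere. -/
structure IsMeanFieldPotential (f Φ : ℝ → ℝ) : Prop where
  differentiable : Differentiable ℝ Φ
  absolutelyContinuous : ∀ x y : ℝ, AbsolutelyContinuousOnInterval (deriv Φ) x y
  equation : ∀ᵐ x, - deriv (deriv Φ) x = 4 * Real.pi * f x
  deriv_atTop : Tendsto (deriv Φ) atTop (𝓝 0)
  deriv_atBot : Tendsto (deriv Φ) atBot (𝓝 0)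
  zero : Φ 0 = 0

/-- `ψ, w ∈ L²(ℝ)`, `Φ ψ` is locally integrable and `-½ ψ'' + Φ ψ = w` in the sense of
distributions. -/
def IsSchrodingerPair (Φ : ℝ → ℝ) (ψ w : L2R) : Prop :=
  LocallyIntegrable (fun x => Φ x • ψ x) ∧
    ∀ φ : ℝ → ℝ, IsTestFunction φ →
      -(1 / 2 : ℂ) * (∫ x, iteratedDeriv 2 φ x • ψ x) + ∫ x, φ x • (Φ x • ψ x)
        = ∫ x, φ x • w x

theorem integrable_test_smul {φ : ℝ → ℝ} (hφ : Continuous φ) (hc : HasCompactSupport φ)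
    {u : ℝ → ℂ} (hu : LocallyIntegrable u) : Integrable (fun x => φ x • u x) :=
  hu.integrable_smul_left_of_hasCompactSupport hφ hc

theorem locallyIntegrable_L2R (u : L2R) : LocallyIntegrable (u : ℝ → ℂ) :=
  (Lp.memLp u).locallyIntegrable (by norm_num)

theorem integrable_iteratedDeriv_smul {φ : ℝ → ℝ} (hφ : IsTestFunction φ) (u : L2R) :
    Integrable (fun x => iteratedDeriv 2 φ x • u x) :=
  integrable_test_smul (hφ.1.continuous_iteratedDeriv 2 (WithTop.coe_le_coe.2 (le_top : (2 : ℕ∞) ≤ ⊤)))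
    (by rw [iteratedDeriv_succ, iteratedDeriv_one]; exact hφ.2.deriv.deriv)
    (locallyIntegrable_L2R u)

theorem IsSchrodingerPair.add {Φ : ℝ → ℝ} {ψ₁ w₁ ψ₂ w₂ : L2R} (h₁ : IsSchrodingerPair Φ ψ₁ w₁)
    (h₂ : IsSchrodingerPair Φ ψ₂ w₂) : IsSchrodingerPair Φ (ψ₁ + ψ₂) (w₁ + w₂) := by
  have e : (fun x => Φ x • (ψ₁ + ψ₂ : L2R) x) =ᵐ[volume]
      (fun x => Φ x • ψ₁ x) + (fun x => Φ x • ψ₂ x) := by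
    filter_upwards [Lp.coeFn_add ψ₁ ψ₂] with x hx
    simp only [hx, Pi.add_apply, smul_add]
  refine ⟨(h₁.1.add h₂.1).congr e.symm, fun φ hφ => ?_⟩
  have a₁ : ∫ x, iteratedDeriv 2 φ x • (ψ₁ + ψ₂ : L2R) x
      = (∫ x, iteratedDeriv 2 φ x • ψ₁ x) + ∫ x, iteratedDeriv 2 φ x • ψ₂ x := by
    rw [← integral_add (integrable_iteratedDeriv_smul hφ ψ₁) (integrable_iteratedDeriv_smul hφ ψ₂)]
    refine integral_congr_ae ?_
    filter_upwards [Lp.coeFn_add ψ₁ ψ₂] with x hx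
    simp only [hx, Pi.add_apply, smul_add]
  have a₂ : ∫ x, φ x • (Φ x • (ψ₁ + ψ₂ : L2R) x)
      = (∫ x, φ x • (Φ x • ψ₁ x)) + ∫ x, φ x • (Φ x • ψ₂ x) := by
    rw [← integral_add (integrable_test_smul hφ.1.continuous hφ.2 h₁.1)
      (integrable_test_smul hφ.1.continuous hφ.2 h₂.1)]
    refine integral_congr_ae ?_
    filter_upwards [Lp.coeFn_add ψ₁ ψ₂] with x hx
    simp only [hx, Pi.add_apply, smul_add]
  have a₃ : ∫ x, φ x • (w₁ + w₂ : L2R) x = (∫ x, φ x • w₁ x) + ∫ x, φ x • w₂ x := by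
    rw [← integral_add (integrable_test_smul hφ.1.continuous hφ.2 (locallyIntegrable_L2R w₁))
      (integrable_test_smul hφ.1.continuous hφ.2 (locallyIntegrable_L2R w₂))]
    refine integral_congr_ae ?_
    filter_upwards [Lp.coeFn_add w₁ w₂] with x hx
    simp only [hx, Pi.add_apply, smul_add]
  rw [a₁, a₂, a₃, ← h₁.2 φ hφ, ← h₂.2 φ hφ]
  ring

theorem IsSchrodingerPair.smul {Φ : ℝ → ℝ} {ψ w : L2R} (c : ℂ) (h : IsSchrodingerPair Φ ψ w) :
    IsSchrodingerPair Φ (c • ψ) (c • w) := by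
  have e : (fun x => Φ x • (c • ψ : L2R) x) =ᵐ[volume] c • (fun x => Φ x • ψ x) := by
    filter_upwards [Lp.coeFn_smul c ψ] with x hx
    simp only [hx, Pi.smul_apply, smul_comm c]
  refine ⟨(h.1.smul c).congr e.symm, fun φ hφ => ?_⟩
  have a₁ : ∫ x, iteratedDeriv 2 φ x • (c • ψ : L2R) x
      = c * ∫ x, iteratedDeriv 2 φ x • ψ x := by
    rw [← integral_const_mul]
    refine integral_congr_ae ?_
    filter_upwards [Lp.coeFn_smul c ψ] with x hx
    simp only [hx, Pi.smul_apply, smul_eq_mul, Complex.real_smul]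
    ring
  have a₂ : ∫ x, φ x • (Φ x • (c • ψ : L2R) x) = c * ∫ x, φ x • (Φ x • ψ x) := by
    rw [← integral_const_mul]
    refine integral_congr_ae ?_
    filter_upwards [Lp.coeFn_smul c ψ] with x hx
    simp only [hx, Pi.smul_apply, smul_eq_mul, Complex.real_smul]
    ring
  have a₃ : ∫ x, φ x • (c • w : L2R) x = c * ∫ x, φ x • w x := by
    rw [← integral_const_mul]
    refine integral_congr_ae ?_
    filter_upwards [Lp.coeFn_smul c w] with x hx
    simp only [hx, Pi.smul_apply, smul_eq_mul, Complex.real_smul]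
    ring
  rw [a₁, a₂, a₃, ← h.2 φ hφ]
  ring

theorem IsSchrodingerPair.zero (Φ : ℝ → ℝ) : IsSchrodingerPair Φ 0 0 := by
  have e : (fun x => Φ x • (0 : L2R) x) =ᵐ[volume] (fun _ => (0 : ℂ)) := by
    filter_upwards [Lp.coeFn_zero ℂ 2 (volume : Measure ℝ)] with x hx
    simp only [hx, Pi.zero_apply, smul_zero]
  refine ⟨(locallyIntegrable_const (0 : ℂ)).congr e.symm, fun φ _ => ?_⟩
  have a (η : ℝ → ℝ) : ∫ x, η x • (0 : L2R) x = 0 := by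
    rw [integral_eq_zero_of_ae]
    filter_upwards [Lp.coeFn_zero ℂ 2 (volume : Measure ℝ)] with x hx
    simp only [hx, Pi.zero_apply, smul_zero]
  have a' : ∫ x, φ x • (Φ x • (0 : L2R) x) = 0 := by
    rw [integral_eq_zero_of_ae]
    filter_upwards [e] with x hx
    simp only [Pi.zero_apply]
    rw [hx, smul_zero]
  rw [a, a', a]
  simp

/-- The graph of `-½ Δ₁ + Φ` on its maximal domain. -/
def schrodingerGraph (Φ : ℝ → ℝ) : Submodule ℂ (L2R × L2R) where
  carrier := {p | IsSchrodingerPair Φ p.1 p.2}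
  add_mem' h₁ h₂ := IsSchrodingerPair.add h₁ h₂
  zero_mem' := IsSchrodingerPair.zero Φ
  smul_mem' c _ h := IsSchrodingerPair.smul c h

theorem schrodingerGraph_single_valued (Φ : ℝ → ℝ) :
    ∀ p ∈ schrodingerGraph Φ, p.1 = 0 → p.2 = 0 := by
  rintro ⟨ψ, w⟩ h (rfl : ψ = 0)
  have h' : IsSchrodingerPair Φ 0 w := h
  change w = 0
  rw [Lp.eq_zero_iff_ae_eq_zero]
  refine ae_eq_zero_of_integral_contDiff_smul_eq_zero (locallyIntegrable_L2R w) fun φ h₁ h₂ => ?_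
  rw [← h'.2 φ ⟨h₁, h₂⟩, (IsSchrodingerPair.zero Φ).2 φ ⟨h₁, h₂⟩]
  rw [integral_eq_zero_of_ae]
  filter_upwards [Lp.coeFn_zero ℂ 2 (volume : Measure ℝ)] with x hx
  simp only [hx, Pi.zero_apply, smul_zero]

/-- The operator `H = -½ Δ₁ + Φ` on `L²(ℝ)`, with its maximal domain: the set of all `ψ ∈ L²(ℝ)`
such that `Φ ψ` is locally integrable and `-½ ψ'' + Φ ψ ∈ L²(ℝ)`. -/
def schrodinger (Φ : ℝ → ℝ) : L2R →ₗ.[ℂ] L2R := (schrodingerGraph Φ).toLinearPMap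

theorem schrodinger_graph (Φ : ℝ → ℝ) : (schrodinger Φ).graph = schrodingerGraph Φ :=
  Submodule.toLinearPMap_graph_eq _ (schrodingerGraph_single_valued Φ)

/-! ### Borel functional calculus of an unbounded self-adjoint operator -/

/-- A projection-valued measure on the Borel sets of `ℝ`. -/
structure ProjectionMeasure where
  proj : Set ℝ → (L2R →L[ℂ] L2R)
  isStarProjection : ∀ B, MeasurableSet B → IsStarProjection (proj B)
  proj_univ : proj Set.univ = 1
  hasSum_iUnion : ∀ B : ℕ → Set ℝ, (∀ n, MeasurableSet (B n)) →
    Pairwise (Function.onFun Disjoint B) → ∀ ψ, HasSum (fun n => proj (B n) ψ) (proj (⋃ n, B n) ψ)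

theorem ProjectionMeasure.proj_empty (P : ProjectionMeasure) (ψ : L2R) : P.proj ∅ ψ = 0 := by
  have h := P.hasSum_iUnion (fun _ => ∅) (fun _ => MeasurableSet.empty)
    (fun _ _ _ => by simp [Function.onFun]) ψ
  exact tendsto_nhds_unique tendsto_const_nhds h.summable.tendsto_atTop_zero

theorem ProjectionMeasure.re_inner_nonneg (P : ProjectionMeasure) {B : Set ℝ}
    (hB : MeasurableSet B) (ψ : L2R) : 0 ≤ (⟪ψ, P.proj B ψ⟫_ℂ).re := by
  have h : (P.proj B).IsPositive :=
    ContinuousLinearMap.nonneg_iff_isPositive _ |>.1 (P.isStarProjection B hB).nonneg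
  exact h.re_inner_nonneg_right ψ

/-- The spectral measure `B ↦ ⟨ψ, P(B) ψ⟩` of a vector `ψ`. -/
def ProjectionMeasure.measure (P : ProjectionMeasure) (ψ : L2R) : Measure ℝ :=
  Measure.ofMeasurable (fun B _ => ENNReal.ofReal (⟪ψ, P.proj B ψ⟫_ℂ).re)
    (by simp [P.proj_empty])
    (by
      intro B hB hd
      have h := P.hasSum_iUnion B hB hd ψ
      have h' : HasSum (fun n => (⟪ψ, P.proj (B n) ψ⟫_ℂ).re) (⟪ψ, P.proj (⋃ n, B n) ψ⟫_ℂ).re :=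
        Complex.hasSum_re (h.mapL (innerSL ℂ ψ))
      rw [← h'.tsum_eq, ENNReal.ofReal_tsum_of_nonneg
        (fun n => P.re_inner_nonneg (hB n) ψ) h'.summable])

/-- `P` is the spectral resolution of the operator `H`, that is `H = ∫ x dP(x)`: the domain of `H`
is the set of all `ψ` with `∫ x² d⟨ψ, P ψ⟩ < ∞`, and `⟨ψ, H ψ⟩ = ∫ x d⟨ψ, P ψ⟩` on it. -/
def IsSpectralResolution (P : ProjectionMeasure) (H : L2R →ₗ.[ℂ] L2R) : Prop :=
  (∀ ψ : L2R, ψ ∈ H.domain ↔ Integrable (fun x : ℝ => x ^ 2) (P.measure ψ)) ∧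
    ∀ ψ : H.domain, ⟪(ψ : L2R), H ψ⟫_ℂ = ((∫ x, x ∂(P.measure (ψ : L2R)) : ℝ) : ℂ)

/-- `H` is self-adjoint, the Borel function `f` of `H` is a bounded operator, and `A = f(H)`, that
is `A = ∫ f(x) dP(x)` with `P` the spectral resolution of `H`. -/
def IsFunctionOf (H : L2R →ₗ.[ℂ] L2R) (f : ℝ → ℝ) (A : L2R →L[ℂ] L2R) : Prop :=
  Measurable f ∧ ∃ P : ProjectionMeasure, IsSpectralResolution P H ∧
    ∀ ψ : L2R, Integrable f (P.measure ψ) ∧ ⟪ψ, A ψ⟫_ℂ = ((∫ x, f x ∂(P.measure ψ) : ℝ) : ℂ)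

/-- The bounded operator `A` commutes with the unbounded operator `H`: `A` maps the domain of `H`
into itself and `H A ψ = A H ψ` on it. -/
def Commutes (A : L2R →L[ℂ] L2R) (H : L2R →ₗ.[ℂ] L2R) : Prop :=
  ∀ ψ : H.domain, ∃ hψ : A ψ ∈ H.domain, H ⟨A ψ, hψ⟩ = A (H ψ)

end RHF

end

/-!
# The Euler-Lagrange equation of the reduced Hartree-Fock model

Let `G` minimise the energy, and let `Φ` be the mean-field potential of its density.

*Regularity.* A rank one state with a mollified background as its density has finite energy
(`exists_admissible_energy_ne_top`). Hence the minimizer has a finite Hartree energy, the primitive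
`W` of `ρ_G - μ` tends to `0` at both ends, and `Φ(x) = -4π ∫₀ˣ W` is the potential
(`isMeanFieldPotential_meanField`); it is Lipschitz continuous.

*Variations.* The minimality is tested against `(1 + z |u⟩⟨u|) G (1 + z̄ |u⟩⟨u|) + s |φ⟩⟨φ|` with
test functions `u` and `φ` and with `s` restoring the trace (`IsMinimizer.exists_deform_bound`). The
change of the density has compact support and total mass `0`, so its Hartree self-energy is of second
order in `z`, even though the Hartree energy of the difference of two eigenfunctions may be infinite.
If `1 + z` is a phase, the deformation is a unitary conjugation and leaves `Tr F(b, G)` unchanged;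
stationarity gives that `⟨H u, G u⟩` is real, that is, `G` commutes with `H = -½ Δ₁ + Φ` on test
functions (`IsMinimizer.isSchrodingerPair_apply`). For `z = -t` particles are moved from `u` to `φ`
(`IsMinimizer.first_variation`). For a fixed `u` this bounds `H` from below on test functions, and,
as `Φ` is Lipschitz continuous, `Φ` itself is bounded below (`IsMinimizer.exists_le_statePot`).

*The Hamiltonian.* Let `Φ + M ≥ 1`. A square integrable solution of `-½ ψ'' + (Φ + M) ψ = 0`
vanishes because the squares of its real and imaginary parts are convex. So `-½ Δ₁ + Φ + M` maps the
test functions onto a dense subspace, and its inverse extends to a bounded self-adjoint injective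
operator `R` (`exists_isResolvent`), by which the maximal domain, the core property of the test
functions and the commutation with `G` are expressed. The spectral measures of `R` come from the
Riesz-Markov-Kakutani theorem. For each `ψ` the map `f ↦ f(R) ψ` extends to an isometry on `L²` of
the spectral measure of `ψ`, which defines the Borel functional calculus of `R` and, by the
substitution `x = 1 / r - M`, the spectral resolution of `H` (`IsResolvent.isSpectralResolution`).

*The multiplier.* `G` is trace class and commutes with `R`, so that there is an orthonormal basis of
eigenvectors `e_j` of `G`, which for `g_j ≠ 0` are eigenvectors of `H` with eigenvalues `ε_j`. If the
test functions approximate `e_j` and a second such vector, or a vector in `ker G`, in the graph norm,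
then the change of `Tr F(b, ·)` is that of the reference deformation up to a small error, by the
monotonicity and the Lipschitz continuity of `Tr F(b, ·)` (`trace_cfc_F_le`). In the limit the slopes
of the energy for removing particles lie below those for adding particles
(`IsMinimizer.slope_le`). Any `l` in between satisfies `g_j ∈ h_b(l - ε_j)` and `H ≥ l - |b| / 2` on
`ker G` (`IsMinimizer.exists_multiplier`). Since `h_b⁻` vanishes on `(-∞, |b| / 2]`, the operator
`h_b⁻(l - H)` is diagonal in the basis `e_j` with entries at most `g_j`; and `G` is diagonal with
entries at most those of `h_b⁺(l - H)` outside `ker G`, which proves the two bounds.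
-/

noncomputable section

namespace RHF

/-! ### The convex function `F(b, ·)` and the monotone map `h_b` -/

section ConvexFunction

/-- The slope `(b/2)(2n + 1)`, `n = ⌊2πx/b⌋`, of a supporting line of `F(b, ·)` at `x`. -/
def slopeF (b x : ℝ) : ℝ := b / 2 * (2 * ⌊2 * Real.pi * x / b⌋ + 1)

theorem F_zero (b : ℝ) : F b 0 = 0 := by simp [F]

theorem pi_mul_sq_le_F (b x : ℝ) : Real.pi * x ^ 2 ≤ F b x := by
  have h0 := Int.fract_nonneg (2 * Real.pi * x / b)
  have h1 := (Int.fract_lt_one (2 * Real.pi * x / b)).le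
  have : 0 ≤ b ^ 2 / (4 * Real.pi) *
      (Int.fract (2 * Real.pi * x / b) * (1 - Int.fract (2 * Real.pi * x / b))) :=
    mul_nonneg (by positivity) (mul_nonneg h0 (by linarith))
  unfold F
  linarith

theorem F_nonneg (b x : ℝ) : 0 ≤ F b x :=
  le_trans (by positivity) (pi_mul_sq_le_F b x)

variable {b : ℝ}

/-- In the variable `t = 2πx/b = n + s`, `n = ⌊t⌋`, the function `F(b, ·)` is
`b²/(4π) (n² + (2n + 1) s)`, the piecewise linear interpolation of the squares. -/
theorem F_eq_floor (hb : b ≠ 0) (x : ℝ) :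
    F b x = b ^ 2 / (4 * Real.pi) * ((⌊2 * Real.pi * x / b⌋ : ℝ) ^ 2 +
      (2 * ⌊2 * Real.pi * x / b⌋ + 1) * Int.fract (2 * Real.pi * x / b)) := by
  have hpi := Real.pi_ne_zero
  have hx : x = b / (2 * Real.pi) *
      ((⌊2 * Real.pi * x / b⌋ : ℝ) + Int.fract (2 * Real.pi * x / b)) := by
    rw [Int.floor_add_fract]; field_simp
  unfold F
  generalize Int.fract (2 * Real.pi * x / b) = s at *
  generalize (⌊2 * Real.pi * x / b⌋ : ℝ) = n at *
  subst hx
  field_simp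
  ring

theorem F_add_slope_le (hb : b ≠ 0) (x y : ℝ) : F b x + slopeF b x * (y - x) ≤ F b y := by
  have hpi := Real.pi_pos
  have hx : x = b / (2 * Real.pi) *
      ((⌊2 * Real.pi * x / b⌋ : ℝ) + Int.fract (2 * Real.pi * x / b)) := by
    rw [Int.floor_add_fract]; field_simp
  have hy : y = b / (2 * Real.pi) *
      ((⌊2 * Real.pi * y / b⌋ : ℝ) + Int.fract (2 * Real.pi * y / b)) := by
    rw [Int.floor_add_fract]; field_simp
  rw [F_eq_floor hb x, F_eq_floor hb y, slopeF]
  have h0 := Int.fract_nonneg (2 * Real.pi * y / b)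
  have h1 := (Int.fract_lt_one (2 * Real.pi * y / b)).le
  set m := ⌊2 * Real.pi * x / b⌋
  set n := ⌊2 * Real.pi * y / b⌋
  generalize Int.fract (2 * Real.pi * x / b) = s at *
  generalize Int.fract (2 * Real.pi * y / b) = r at *
  have key : 0 ≤ ((n : ℝ) - m) * ((n : ℝ) - m - 1 + 2 * r) := by
    rcases lt_trichotomy n m with h | h | h
    · have : (n : ℝ) + 1 ≤ m := by exact_mod_cast h
      exact mul_nonneg_of_nonpos_of_nonpos (by linarith) (by linarith)
    · simp [h]
    · have : (m : ℝ) + 1 ≤ n := by exact_mod_cast h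
      exact mul_nonneg (by linarith) (by linarith)
  have e : b ^ 2 / (4 * Real.pi) * ((n : ℝ) ^ 2 + (2 * n + 1) * r) -
      (b ^ 2 / (4 * Real.pi) * ((m : ℝ) ^ 2 + (2 * m + 1) * s) + b / 2 * (2 * m + 1) *
        (b / (2 * Real.pi) * (n + r) - b / (2 * Real.pi) * (m + s)))
      = b ^ 2 / (4 * Real.pi) * (((n : ℝ) - m) * ((n : ℝ) - m - 1 + 2 * r)) := by
    field_simp
    ring
  have e' : 0 ≤ b ^ 2 / (4 * Real.pi) * (((n : ℝ) - m) * ((n : ℝ) - m - 1 + 2 * r)) :=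
    mul_nonneg (by positivity) key
  rw [← e, ← hx, ← hy] at e'
  linarith

theorem slopeF_nonneg (hb : b ≠ 0) {x : ℝ} (hx : 0 ≤ x) (hx' : x ≠ 0) : 0 ≤ slopeF b x := by
  have h := F_add_slope_le hb x 0
  have h' := F_nonneg b x
  rw [F_zero] at h
  have hx0 : 0 < x := lt_of_le_of_ne hx (Ne.symm hx')
  by_contra hc
  push Not at hc
  nlinarith

theorem slopeF_le (hb : b ≠ 0) (x : ℝ) : slopeF b x ≤ 2 * Real.pi * x + |b| := by
  have hx : x = b / (2 * Real.pi) *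
      ((⌊2 * Real.pi * x / b⌋ : ℝ) + Int.fract (2 * Real.pi * x / b)) := by
    rw [Int.floor_add_fract]; field_simp
  have h0 := Int.fract_nonneg (2 * Real.pi * x / b)
  have h1 := (Int.fract_lt_one (2 * Real.pi * x / b)).le
  unfold slopeF
  generalize Int.fract (2 * Real.pi * x / b) = s at *
  generalize (⌊2 * Real.pi * x / b⌋ : ℝ) = m at *
  have hx2 : 2 * Real.pi * x = b * (m + s) := by rw [hx]; field_simp
  rw [hx2]
  rcases abs_cases b with ⟨h, _⟩ | ⟨h, _⟩ <;> rw [h] <;> nlinarith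

/-- The chord through the origin and the first kink supports `F(b, ·)` from below. -/
theorem abs_mul_le_F (hb : b ≠ 0) (x : ℝ) : |b| / 2 * |x| ≤ F b x := by
  have hpi := Real.pi_pos
  have hx : x = b / (2 * Real.pi) *
      ((⌊2 * Real.pi * x / b⌋ : ℝ) + Int.fract (2 * Real.pi * x / b)) := by
    rw [Int.floor_add_fract]; field_simp
  have h0 := Int.fract_nonneg (2 * Real.pi * x / b)
  have h1 := (Int.fract_lt_one (2 * Real.pi * x / b)).le
  have e : |b| / 2 * |x| = b ^ 2 / (4 * Real.pi) * |2 * Real.pi * x / b| := by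
    rw [abs_div, abs_mul, abs_of_pos (show 0 < 2 * Real.pi by positivity), ← sq_abs b]
    have : |b| ≠ 0 := abs_ne_zero.2 hb
    field_simp
    ring
  rw [e, F_eq_floor hb]
  refine mul_le_mul_of_nonneg_left ?_ (by positivity)
  have ht : 2 * Real.pi * x / b = ⌊2 * Real.pi * x / b⌋ + Int.fract (2 * Real.pi * x / b) :=
    (Int.floor_add_fract _).symm
  set n := ⌊2 * Real.pi * x / b⌋
  generalize Int.fract (2 * Real.pi * x / b) = s at *
  rw [ht, abs_le]
  rcases lt_trichotomy n 0 with h | h | h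
  · have h2 : (n : ℝ) + 1 ≤ 0 := by exact_mod_cast h
    refine ⟨?_, by nlinarith⟩
    have h3 : 0 ≤ ((n : ℝ) + 1) * (n + 2 * s) := by
      rcases eq_or_lt_of_le (show n + 1 ≤ 0 from h) with h4 | h4
      · have : (n : ℝ) + 1 = 0 := by exact_mod_cast h4
        simp [this]
      · have : (n : ℝ) + 1 + 1 ≤ 0 := by exact_mod_cast h4
        exact mul_nonneg_of_nonpos_of_nonpos h2 (by linarith)
    nlinarith
  · rw [h]; constructor <;> push_cast <;> linarith
  · have : (1 : ℝ) ≤ n := by exact_mod_cast h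
    constructor <;> nlinarith

/-- At its first kink `|b| / (2π)` the function `F(b, ·)` has the slope `|b| / 2` as seen from `0`. -/
theorem F_kink (hb : b ≠ 0) : F b (|b| / (2 * Real.pi)) = |b| / 2 * (|b| / (2 * Real.pi)) := by
  have hpi := Real.pi_ne_zero
  have e : Int.fract (2 * Real.pi * (|b| / (2 * Real.pi)) / b) = 0 := by
    rcases abs_cases b with ⟨h, _⟩ | ⟨h, _⟩ <;> rw [h]
    · rw [show 2 * Real.pi * (b / (2 * Real.pi)) / b = ((1 : ℤ) : ℝ) by
        push_cast; field_simp]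
      exact Int.fract_intCast 1
    · rw [show 2 * Real.pi * (-b / (2 * Real.pi)) / b = ((-1 : ℤ) : ℝ) by
        push_cast; field_simp]
      exact Int.fract_intCast (-1)
  unfold F
  rw [e]
  field_simp
  ring

theorem convexOn_F (hb : b ≠ 0) : ConvexOn ℝ Set.univ (F b) := by
  refine ⟨convex_univ, fun x _ y _ α β hα hβ hαβ => ?_⟩
  have h1 := F_add_slope_le hb (α • x + β • y) x
  have h2 := F_add_slope_le hb (α • x + β • y) y
  simp only [smul_eq_mul] at *
  have e : α * (x - (α * x + β * y)) + β * (y - (α * x + β * y)) = 0 := by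
    have : α = 1 - β := by linarith
    subst this; ring
  have h3 := mul_le_mul_of_nonneg_left h1 hα
  have h4 := mul_le_mul_of_nonneg_left h2 hβ
  have e2 : α * F b (α * x + β * y) + β * F b (α * x + β * y) = F b (α * x + β * y) := by
    rw [← add_mul, hαβ, one_mul]
  have e3 : α * (slopeF b (α * x + β * y) * (x - (α * x + β * y))) +
      β * (slopeF b (α * x + β * y) * (y - (α * x + β * y))) = 0 := by
    rw [← mul_zero (slopeF b (α * x + β * y)), ← e]; ring
  rw [mul_add] at h3 h4
  linarith

theorem continuous_F (hb : b ≠ 0) : Continuous (F b) := by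
  have h := (convexOn_F hb).continuousOn_interior
  rwa [interior_univ, continuousOn_univ] at h

theorem F_mono (hb : b ≠ 0) {x y : ℝ} (hx : 0 ≤ x) (hxy : x ≤ y) : F b x ≤ F b y := by
  rcases eq_or_ne x 0 with rfl | h
  · rw [F_zero]; exact F_nonneg b y
  · have := F_add_slope_le hb x y
    have h2 := mul_nonneg (slopeF_nonneg hb hx h) (sub_nonneg.2 hxy)
    linarith

theorem F_sub_le (hb : b ≠ 0) {x y m : ℝ} (hxy : x ≤ y) (hy : y ≤ m) :
    F b y - F b x ≤ (2 * Real.pi * m + |b|) * (y - x) := by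
  have h1 := F_add_slope_le hb y x
  have h2 := slopeF_le hb y
  have h3 : slopeF b y ≤ 2 * Real.pi * m + |b| := by
    have := mul_le_mul_of_nonneg_left hy (show 0 ≤ 2 * Real.pi by positivity)
    linarith
  have := mul_le_mul_of_nonneg_right h3 (sub_nonneg.2 hxy)
  linarith

theorem mem_h_iff {b x y : ℝ} (hy : 0 ≤ y) : x ∈ h b y ↔ ∀ g, y * (g - x) ≤ F b g - F b x := by
  rw [h, if_neg (not_lt.2 hy)]; rfl

theorem h_of_neg {b y : ℝ} (hy : y < 0) : h b y = {0} := by rw [h, if_pos hy]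

theorem nonneg_of_mem_h {x y : ℝ} (hx : x ∈ h b y) : 0 ≤ x := by
  rcases lt_or_ge y 0 with hy | hy
  · rw [h_of_neg hy] at hx; exact hx.symm.le
  · rw [mem_h_iff hy] at hx
    have h1 := hx 0
    rw [F_zero] at h1
    by_contra hc
    push Not at hc
    have h2 := pi_mul_sq_le_F b x
    have h3 : 0 < Real.pi * x ^ 2 := mul_pos Real.pi_pos (by nlinarith)
    nlinarith

theorem le_of_mem_h {x y : ℝ} (hx : x ∈ h b y) : x ≤ max y 0 / Real.pi := by
  have hpi := Real.pi_pos
  have hx0 := nonneg_of_mem_h hx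
  rcases lt_or_ge y 0 with hy | hy
  · rw [h_of_neg hy] at hx
    rw [show x = 0 from hx]; positivity
  · rw [mem_h_iff hy] at hx
    have h1 := hx 0
    rw [F_zero] at h1
    have h2 := pi_mul_sq_le_F b x
    rw [max_eq_left hy, le_div_iff₀ hpi]
    rcases eq_or_lt_of_le hx0 with h0 | h0
    · rw [← h0]; simpa using hy
    · nlinarith

theorem bddBelow_h (b y : ℝ) : BddBelow (h b y) := ⟨0, fun _ hx => nonneg_of_mem_h hx⟩

theorem bddAbove_h (b y : ℝ) : BddAbove (h b y) := ⟨_, fun _ hx => le_of_mem_h hx⟩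

theorem h_nonempty (hb : b ≠ 0) (y : ℝ) : (h b y).Nonempty := by
  rcases lt_or_ge y 0 with hy | hy
  · rw [h_of_neg hy]; exact Set.singleton_nonempty 0
  · have hpi := Real.pi_pos
    have hc : Continuous fun x => F b x - y * x := by
      have := continuous_F hb; fun_prop
    obtain ⟨x, hx, hmin⟩ := (isCompact_Icc (a := (-(y + 1) / Real.pi : ℝ))
      (b := (y + 1) / Real.pi)).exists_isMinOn
      ⟨0, by constructor
             · apply div_nonpos_of_nonpos_of_nonneg <;> linarith
             · positivity⟩ hc.continuousOn
    refine ⟨x, (mem_h_iff hy).2 fun g => ?_⟩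
    have h0 : F b x - y * x ≤ 0 := by
      have := hmin (show (0 : ℝ) ∈ Set.Icc (-(y + 1) / Real.pi) ((y + 1) / Real.pi) from
        ⟨by apply div_nonpos_of_nonpos_of_nonneg <;> linarith, by positivity⟩)
      simpa [F_zero] using this
    by_cases hg : g ∈ Set.Icc (-(y + 1) / Real.pi) ((y + 1) / Real.pi)
    · have h1 := hmin hg
      simp only [Set.mem_ofPred_eq] at h1
      linarith
    · have h1 := pi_mul_sq_le_F b g
      have h2 : 0 ≤ Real.pi * g ^ 2 - y * g := by
        rw [Set.mem_Icc, not_and_or, not_le, not_le] at hg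
        rcases hg with hg | hg
        · have : g ≤ 0 := hg.le.trans (div_nonpos_of_nonpos_of_nonneg (by linarith) hpi.le)
          nlinarith [mul_nonneg hpi.le (sq_nonneg g), mul_nonneg hy (neg_nonneg.2 this)]
        · rw [div_lt_iff₀ hpi] at hg
          have : 0 ≤ g := by
            by_contra hc
            push Not at hc
            nlinarith
          nlinarith
      linarith

theorem h_monotone {x₁ x₂ y₁ y₂ : ℝ} (hy : y₁ < y₂) (h₁ : x₁ ∈ h b y₁) (h₂ : x₂ ∈ h b y₂) :
    x₁ ≤ x₂ := by
  rcases lt_or_ge y₁ 0 with hy1 | hy1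
  · rw [h_of_neg hy1] at h₁
    rw [show x₁ = 0 from h₁]
    exact nonneg_of_mem_h h₂
  · rw [mem_h_iff hy1] at h₁
    rw [mem_h_iff (hy1.trans hy.le)] at h₂
    have e1 := h₁ x₂
    have e2 := h₂ x₁
    by_contra hc
    push Not at hc
    nlinarith

theorem monotone_hMinus (hb : b ≠ 0) : Monotone (hMinus b) := by
  intro y₁ y₂ hy
  rcases eq_or_lt_of_le hy with rfl | hy
  · exact le_rfl
  · obtain ⟨x, hx⟩ := h_nonempty hb y₁
    exact le_csInf (h_nonempty hb y₂) fun z hz => (csInf_le (bddBelow_h b y₁) hx).trans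
      (h_monotone hy hx hz)

theorem monotone_hPlus (hb : b ≠ 0) : Monotone (hPlus b) := by
  intro y₁ y₂ hy
  rcases eq_or_lt_of_le hy with rfl | hy
  · exact le_rfl
  · obtain ⟨x, hx⟩ := h_nonempty hb y₂
    exact csSup_le (h_nonempty hb y₁) fun z hz => (h_monotone hy hz hx).trans
      (le_csSup (bddAbove_h b y₂) hx)

theorem hMinus_le {x y : ℝ} (hx : x ∈ h b y) : hMinus b y ≤ x := csInf_le (bddBelow_h b y) hx

theorem le_hPlus {x y : ℝ} (hx : x ∈ h b y) : x ≤ hPlus b y := le_csSup (bddAbove_h b y) hx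

theorem hMinus_nonneg (b y : ℝ) : 0 ≤ hMinus b y :=
  Real.sInf_nonneg fun _ hx => nonneg_of_mem_h hx

theorem hPlus_nonneg (b y : ℝ) : 0 ≤ hPlus b y :=
  Real.sSup_nonneg fun _ hx => nonneg_of_mem_h hx

/-- Below the threshold `|b|/2`, the slope of `F(b, ·)` at `0+`, the lower end of `h_b` vanishes. -/
theorem hMinus_eq_zero (hb : b ≠ 0) {y : ℝ} (hy : y ≤ |b| / 2) : hMinus b y = 0 := by
  refine le_antisymm (hMinus_le ?_) (hMinus_nonneg b y)
  rcases lt_or_ge y 0 with hy0 | hy0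
  · rw [h_of_neg hy0]; rfl
  · rw [mem_h_iff hy0]
    intro g
    rw [F_zero, sub_zero, sub_zero]
    refine le_trans ?_ (abs_mul_le_F hb g)
    exact (mul_le_mul_of_nonneg_left (le_abs_self g) hy0).trans
      (mul_le_mul_of_nonneg_right hy (abs_nonneg g))

/-- One-sided difference quotients suffice to recognise a positive element of `h_b(y)`; the
inequality for negative arguments follows from convexity. -/
theorem mem_h_of_slopes {x y : ℝ} (hx : 0 < x)
    (hr : ∀ s, 0 < s → s * y ≤ F b (x + s) - F b x)
    (hl : ∀ s, 0 < s → s ≤ x → F b x - F b (x - s) ≤ s * y) : x ∈ h b y := by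
  have hxx := hl x hx le_rfl
  rw [sub_self, F_zero, sub_zero] at hxx
  have hy : 0 ≤ y := by
    have := F_nonneg b x
    by_contra hc
    push Not at hc
    nlinarith
  rw [mem_h_iff hy]
  intro g
  rcases lt_trichotomy g x with hg | rfl | hg
  · rcases le_or_gt 0 g with hg0 | hg0
    · have := hl (x - g) (by linarith) (by linarith)
      rw [sub_sub_cancel] at this
      linarith
    · have := F_nonneg b g
      nlinarith
  · simp
  · have := hr (g - x) (by linarith)
    rw [add_sub_cancel] at this
    linarith

end ConvexFunction

end RHF

end

noncomputable section

namespace RHF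

/-! ### Complex test functions and weak derivatives -/

section TestFunctions

/-- The space `C_c^∞(ℝ; ℂ)` of complex test functions. -/
def testSpace : Submodule ℂ (ℝ → ℂ) where
  carrier := {u | ContDiff ℝ ∞ u ∧ HasCompactSupport u}
  add_mem' hu hv := ⟨hu.1.add hv.1, hu.2.add hv.2⟩
  zero_mem' := ⟨contDiff_const, HasCompactSupport.zero⟩
  smul_mem' c _ hu := ⟨contDiff_const.smul hu.1, hu.2.smul_left (f := fun _ => c)⟩

theorem test_continuous (u : testSpace) : Continuous (u : ℝ → ℂ) := u.2.1.continuous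

theorem test_differentiable (u : testSpace) : Differentiable ℝ (u : ℝ → ℂ) :=
  u.2.1.differentiable (by simp)

theorem test_hasCompactSupport (u : testSpace) : HasCompactSupport (u : ℝ → ℂ) := u.2.2

theorem test_memLp (u : testSpace) : MemLp (u : ℝ → ℂ) 2 :=
  (test_continuous u).memLp_of_hasCompactSupport (test_hasCompactSupport u)

/-- The inclusion of the test functions in `L²(ℝ)`. -/
def toL2 : testSpace →ₗ[ℂ] L2R where
  toFun u := (test_memLp u).toLp
  map_add' u v := MemLp.toLp_add (test_memLp u) (test_memLp v)
  map_smul' c u := MemLp.toLp_const_smul c (test_memLp u)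

theorem coeFn_toL2 (u : testSpace) : (toL2 u : ℝ → ℂ) =ᵐ[volume] u := (test_memLp u).coeFn_toLp

/-- Differentiation of test functions. -/
def derivT : testSpace →ₗ[ℂ] testSpace where
  toFun u := ⟨deriv u, (contDiff_infty_iff_deriv.1 u.2.1).2, u.2.2.deriv⟩
  map_add' u v := Subtype.ext (funext fun x => deriv_add ((test_differentiable u x)) ((test_differentiable v x)))
  map_smul' c u := Subtype.ext (funext fun x => deriv_const_smul c ((test_differentiable u x)))

theorem test_hasDerivAt (u : testSpace) (x : ℝ) :
    HasDerivAt (u : ℝ → ℂ) ((derivT u : ℝ → ℂ) x) x := ((test_differentiable u x)).hasDerivAt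

/-- A real test function, as a complex one. -/
def ofRealT (φ : ℝ → ℝ) (hφ : IsTestFunction φ) : testSpace :=
  ⟨fun x => (φ x : ℂ), Complex.ofRealCLM.contDiff.comp hφ.1,
    hφ.2.comp_left (g := ((↑) : ℝ → ℂ)) Complex.ofReal_zero⟩

@[simp] theorem ofRealT_apply (φ : ℝ → ℝ) (hφ : IsTestFunction φ) (x : ℝ) :
    (ofRealT φ hφ : ℝ → ℂ) x = φ x := rfl

theorem IsTestFunction.deriv {φ : ℝ → ℝ} (hφ : IsTestFunction φ) : IsTestFunction (deriv φ) :=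
  ⟨(contDiff_infty_iff_deriv.1 hφ.1).2, hφ.2.deriv⟩

theorem derivT_ofRealT (φ : ℝ → ℝ) (hφ : IsTestFunction φ) :
    derivT (ofRealT φ hφ) = ofRealT (deriv φ) hφ.deriv := by
  refine Subtype.ext (funext fun x => ?_)
  exact ((hφ.1.differentiable (by simp) x).hasDerivAt.ofReal_comp).deriv

theorem exists_ofRealT_add (u : testSpace) : ∃ (a b : ℝ → ℝ) (ha : IsTestFunction a)
    (hb : IsTestFunction b), u = ofRealT a ha + Complex.I • ofRealT b hb := by
  refine ⟨fun x => ((u : ℝ → ℂ) x).re, fun x => ((u : ℝ → ℂ) x).im,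
    ⟨Complex.reCLM.contDiff.comp u.2.1, u.2.2.comp_left (g := Complex.re) Complex.zero_re⟩,
    ⟨Complex.imCLM.contDiff.comp u.2.1, u.2.2.comp_left (g := Complex.im) Complex.zero_im⟩, ?_⟩
  refine Subtype.ext (funext fun x => ?_)
  change (u : ℝ → ℂ) x = _ + Complex.I * _
  rw [mul_comm]
  exact (Complex.re_add_im _).symm

theorem inner_toL2 (u : testSpace) (f : L2R) :
    ⟪toL2 u, f⟫_ℂ = ∫ x, starRingEnd ℂ ((u : ℝ → ℂ) x) * f x := by
  rw [L2.inner_def]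
  refine integral_congr_ae ?_
  filter_upwards [coeFn_toL2 u] with x hx
  rw [hx, RCLike.inner_apply, mul_comm]

theorem inner_ofRealT (φ : ℝ → ℝ) (hφ : IsTestFunction φ) (f : L2R) :
    ⟪toL2 (ofRealT φ hφ), f⟫_ℂ = ∫ x, φ x • f x := by
  rw [inner_toL2]
  simp [Complex.real_smul]

theorem dense_toL2 : DenseRange toL2 := by
  have h := Lp.dense_hasCompactSupport_contDiff (F := ℂ) (μ := (volume : Measure ℝ))
    (p := 2) (by norm_num)
  refine h.mono ?_
  rintro f ⟨g, hfg, hg, hg'⟩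
  refine ⟨⟨g, hg', hg⟩, Lp.ext ?_⟩
  exact (coeFn_toL2 _).trans hfg.symm

/-- Two conjugate-linear functionals on the test functions that agree on real test functions are
equal; here they are given by pairings with elements of `L²`. -/
theorem forall_real_iff_forall (S T : testSpace →ₗ[ℂ] L2R) (f g : L2R) :
    (∀ φ (hφ : IsTestFunction φ), ⟪S (ofRealT φ hφ), f⟫_ℂ = ⟪T (ofRealT φ hφ), g⟫_ℂ) ↔
      ∀ u, ⟪S u, f⟫_ℂ = ⟪T u, g⟫_ℂ := by
  refine ⟨fun h u => ?_, fun h φ hφ => h _⟩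
  obtain ⟨a, b, ha, hb, rfl⟩ := exists_ofRealT_add u
  simp only [map_add, map_smul, inner_add_left, inner_smul_left, h a ha, h b hb]

theorem isWeakDeriv_iff (f g : L2R) : IsWeakDeriv f g ↔
    ∀ u : testSpace, ⟪toL2 (derivT u), f⟫_ℂ = - ⟪toL2 u, g⟫_ℂ := by
  have h := forall_real_iff_forall (toL2 ∘ₗ derivT) toL2 f (-g)
  simp only [LinearMap.comp_apply, inner_neg_right] at h
  rw [← h]
  refine forall_congr' fun φ => forall_congr' fun hφ => ?_
  rw [derivT_ofRealT, inner_ofRealT, inner_ofRealT]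

theorem isWeakDeriv_unique {f g₁ g₂ : L2R} (h₁ : IsWeakDeriv f g₁) (h₂ : IsWeakDeriv f g₂) :
    g₁ = g₂ := by
  rw [isWeakDeriv_iff] at h₁ h₂
  refine dense_toL2.eq_of_inner_right ℂ fun u => ?_
  have := (h₁ u).symm.trans (h₂ u)
  simpa using this

theorem dirichlet_eq {f g : L2R} (h : IsWeakDeriv f g) : dirichlet f = ‖g‖ₑ ^ 2 := by
  refine le_antisymm (iInf₂_le g h) (le_iInf₂ fun v hv => ?_)
  rw [isWeakDeriv_unique h hv]

theorem exists_weakDeriv {f : L2R} (h : dirichlet f ≠ ⊤) : ∃ g, IsWeakDeriv f g := by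
  by_contra hc
  push Not at hc
  exact h (by simp [dirichlet, hc])

theorem IsWeakDeriv.add {f₁ f₂ g₁ g₂ : L2R} (h₁ : IsWeakDeriv f₁ g₁) (h₂ : IsWeakDeriv f₂ g₂) :
    IsWeakDeriv (f₁ + f₂) (g₁ + g₂) := by
  rw [isWeakDeriv_iff] at *
  intro u
  rw [inner_add_right, inner_add_right, h₁, h₂]
  ring

theorem IsWeakDeriv.smul {f g : L2R} (c : ℂ) (h : IsWeakDeriv f g) :
    IsWeakDeriv (c • f) (c • g) := by
  rw [isWeakDeriv_iff] at *
  intro u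
  rw [inner_smul_right, inner_smul_right, h]
  ring

theorem IsWeakDeriv.sub {f₁ f₂ g₁ g₂ : L2R} (h₁ : IsWeakDeriv f₁ g₁) (h₂ : IsWeakDeriv f₂ g₂) :
    IsWeakDeriv (f₁ - f₂) (g₁ - g₂) := by
  simpa [sub_eq_add_neg] using h₁.add (h₂.smul (-1))

theorem isWeakDeriv_toL2 (u : testSpace) : IsWeakDeriv (toL2 u) (toL2 (derivT u)) := by
  rw [isWeakDeriv_iff]
  intro v
  rw [inner_toL2, inner_toL2]
  have e1 : ∫ x, starRingEnd ℂ ((derivT v : ℝ → ℂ) x) * (toL2 u) x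
      = ∫ x, (starRingEnd ℂ ((derivT v : ℝ → ℂ) x)) * (u : ℝ → ℂ) x := by
    refine integral_congr_ae ?_
    filter_upwards [coeFn_toL2 u] with x hx
    rw [hx]
  have e2 : ∫ x, starRingEnd ℂ ((v : ℝ → ℂ) x) * (toL2 (derivT u)) x
      = ∫ x, (starRingEnd ℂ ((v : ℝ → ℂ) x)) * (derivT u : ℝ → ℂ) x := by
    refine integral_congr_ae ?_
    filter_upwards [coeFn_toL2 (derivT u)] with x hx
    rw [hx]
  rw [e1, e2]
  have hc : Continuous fun x => starRingEnd ℂ ((v : ℝ → ℂ) x) :=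
    Complex.continuous_conj.comp (test_continuous v)
  have hc' : Continuous fun x => starRingEnd ℂ ((derivT v : ℝ → ℂ) x) :=
    Complex.continuous_conj.comp (test_continuous (derivT v))
  have hs : HasCompactSupport fun x => starRingEnd ℂ ((v : ℝ → ℂ) x) :=
    v.2.2.comp_left (g := starRingEnd ℂ) (map_zero _)
  have hs' : HasCompactSupport fun x => starRingEnd ℂ ((derivT v : ℝ → ℂ) x) :=
    (derivT v).2.2.comp_left (g := starRingEnd ℂ) (map_zero _)
  have := integral_mul_deriv_eq_deriv_mul_of_integrable (u := fun x => starRingEnd ℂ ((v : ℝ → ℂ) x))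
    (v := (u : ℝ → ℂ)) (u' := fun x => starRingEnd ℂ ((derivT v : ℝ → ℂ) x))
    (v' := (derivT u : ℝ → ℂ)) (fun x _ => (test_hasDerivAt v x).star) (fun x _ => test_hasDerivAt u x)
    ((hc.mul (test_continuous (derivT u))).integrable_of_hasCompactSupport hs.mul_right)
    ((hc'.mul (test_continuous u)).integrable_of_hasCompactSupport hs'.mul_right)
    ((hc.mul (test_continuous u)).integrable_of_hasCompactSupport hs.mul_right)
  rw [this, neg_neg]

/-- By the Riesz representation theorem, `f ∈ H¹(ℝ)` as soon as `φ ↦ ⟨φ', f⟩` is bounded in the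
norm of `L²(ℝ)`. -/
theorem exists_weakDeriv_of_bound (f : L2R) (C : ℝ)
    (hC : ∀ u : testSpace, ‖⟪f, toL2 (derivT u)⟫_ℂ‖ ≤ C * ‖toL2 u‖) : ∃ g, IsWeakDeriv f g := by
  let ℓ : testSpace →ₗ[ℂ] ℂ := (innerSL ℂ f : L2R →L[ℂ] ℂ).toLinearMap ∘ₗ toL2 ∘ₗ derivT
  let L : L2R →L[ℂ] ℂ := ℓ.extendOfNorm toL2
  have hL : ∀ u, L (toL2 u) = ⟪f, toL2 (derivT u)⟫_ℂ := fun u =>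
    LinearMap.extendOfNorm_eq (f := ℓ) (e := toL2) dense_toL2 ⟨C, hC⟩ u
  refine ⟨-(InnerProductSpace.toDual ℂ L2R).symm L, (isWeakDeriv_iff _ _).2 fun u => ?_⟩
  have h1 : ⟪(InnerProductSpace.toDual ℂ L2R).symm L, toL2 u⟫_ℂ = ⟪f, toL2 (derivT u)⟫_ℂ := by
    rw [InnerProductSpace.toDual_symm_apply, hL]
  rw [inner_neg_right, neg_neg, ← inner_conj_symm, ← h1, inner_conj_symm]

end TestFunctions

end RHF

end

noncomputable section

namespace RHF

/-! ### Rank one decompositions of positive operators -/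

section Families

instance : Fact ((2 : ℝ≥0∞) ≠ ⊤) := ⟨by norm_num⟩

/-- The rank one operator `|v⟩⟨v|`. -/
abbrev ketbra (v : L2R) : L2R →L[ℂ] L2R := InnerProductSpace.rankOne ℂ v v

/-- The family `v` decomposes `A`, that is `A = ∑ₖ |vₖ⟩⟨vₖ|` in the sense of quadratic forms. -/
def Decomposes {κ : Type*} (v : κ → L2R) (A : L2R →L[ℂ] L2R) : Prop :=
  ∀ ξ, ∑' k, ‖⟪v k, ξ⟫_ℂ‖ₑ ^ 2 = ENNReal.ofReal (⟪ξ, A ξ⟫_ℂ).re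

theorem enorm_sq_eq_ofReal {E : Type*} [NormedAddCommGroup E] (x : E) :
    ‖x‖ₑ ^ 2 = ENNReal.ofReal (‖x‖ ^ 2) := by
  rw [ENNReal.ofReal_pow (norm_nonneg x), ofReal_norm]

theorem parseval {ι : Type*} (e : HilbertBasis ι ℂ L2R) (x : L2R) :
    ∑' i, ‖⟪e i, x⟫_ℂ‖ₑ ^ 2 = ‖x‖ₑ ^ 2 := by
  have h := e.hasSum_inner_mul_inner x x
  have h' : HasSum (fun i => ‖⟪e i, x⟫_ℂ‖ ^ 2) (‖x‖ ^ 2) := by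
    have h2 := Complex.hasSum_re h
    convert h2 using 1
    · funext i
      rw [← inner_conj_symm x, ← Complex.normSq_eq_conj_mul_self, Complex.ofReal_re,
        Complex.normSq_eq_norm_sq]
    · exact norm_sq_eq_re_inner (𝕜 := ℂ) x
  simp_rw [enorm_sq_eq_ofReal]
  rw [← ENNReal.ofReal_tsum_of_nonneg (fun i => by positivity) h'.summable, h'.tsum_eq]

theorem enorm_inner_symm (x y : L2R) : ‖⟪x, y⟫_ℂ‖ₑ = ‖⟪y, x⟫_ℂ‖ₑ := by
  rw [← ofReal_norm, ← ofReal_norm, norm_inner_symm]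

theorem sqrt_isSelfAdjoint (A : L2R →L[ℂ] L2R) : IsSelfAdjoint (CFC.sqrt A) :=
  (CFC.sqrt_nonneg A).isSelfAdjoint

theorem inner_sqrt_left (A : L2R →L[ℂ] L2R) (x y : L2R) :
    ⟪CFC.sqrt A x, y⟫_ℂ = ⟪x, CFC.sqrt A y⟫_ℂ :=
  (sqrt_isSelfAdjoint A).isSymmetric x y

theorem sqrt_sqrt_apply {A : L2R →L[ℂ] L2R} (hA : A.IsPositive) (x : L2R) :
    CFC.sqrt A (CFC.sqrt A x) = A x := by
  have := CFC.sqrt_mul_sqrt_self A ((ContinuousLinearMap.nonneg_iff_isPositive A).2 hA)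
  exact congrArg (fun T : L2R →L[ℂ] L2R => T x) this

theorem re_inner_eq_norm_sqrt {A : L2R →L[ℂ] L2R} (hA : A.IsPositive) (x : L2R) :
    (⟪x, A x⟫_ℂ).re = ‖CFC.sqrt A x‖ ^ 2 := by
  rw [← sqrt_sqrt_apply hA, ← inner_sqrt_left]
  exact (norm_sq_eq_re_inner (𝕜 := ℂ) _).symm

theorem decomposes_sqrt {A : L2R →L[ℂ] L2R} (hA : A.IsPositive) {ι : Type*}
    (e : HilbertBasis ι ℂ L2R) : Decomposes (fun i => CFC.sqrt A (e i)) A := by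
  intro ξ
  simp_rw [inner_sqrt_left]
  rw [parseval e, re_inner_eq_norm_sqrt hA, enorm_sq_eq_ofReal]

theorem decomposes_ketbra (v : L2R) : Decomposes (fun _ : Unit => v) (ketbra v) := by
  intro ξ
  simp only [tsum_fintype, Finset.univ_unique, Finset.sum_singleton,
    InnerProductSpace.rankOne_apply, inner_smul_right]
  rw [enorm_sq_eq_ofReal, ← inner_conj_symm ξ v, Complex.mul_conj, Complex.ofReal_re,
    Complex.normSq_eq_norm_sq]

theorem Decomposes.add {κ κ' : Type*} {v : κ → L2R} {w : κ' → L2R} {A B : L2R →L[ℂ] L2R}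
    (hA : A.IsPositive) (hB : B.IsPositive) (hv : Decomposes v A) (hw : Decomposes w B) :
    Decomposes (Sum.elim v w) (A + B) := by
  intro ξ
  rw [ENNReal.summable.tsum_sum ENNReal.summable]
  simp only [Sum.elim_inl, Sum.elim_inr, hv ξ, hw ξ]
  rw [add_apply, inner_add_right, Complex.add_re]
  exact (ENNReal.ofReal_add (hA.re_inner_nonneg_right ξ) (hB.re_inner_nonneg_right ξ)).symm

theorem sum_norm_eq_of_decomposes {κ ι : Type*} {v : κ → L2R} {A : L2R →L[ℂ] L2R}
    (hv : Decomposes v A) (e : HilbertBasis ι ℂ L2R) :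
    ∑' i, ENNReal.ofReal (⟪e i, A (e i)⟫_ℂ).re = ∑' k, ‖v k‖ₑ ^ 2 := by
  simp_rw [← hv _]
  rw [ENNReal.tsum_comm]
  refine tsum_congr fun k => ?_
  rw [← parseval e]
  exact tsum_congr fun i => by rw [enorm_inner_symm]

theorem trace_of_decomposes {κ : Type*} {v : κ → L2R} {A : L2R →L[ℂ] L2R}
    (hv : Decomposes v A) : trace A = ∑' k, ‖v k‖ₑ ^ 2 := sum_norm_eq_of_decomposes hv onb

/-- The trace may be computed in any orthonormal basis. -/
theorem trace_eq_tsum {ι : Type*} {A : L2R →L[ℂ] L2R} (hA : A.IsPositive)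
    (e : HilbertBasis ι ℂ L2R) : trace A = ∑' i, ENNReal.ofReal (⟪e i, A (e i)⟫_ℂ).re := by
  rw [sum_norm_eq_of_decomposes (decomposes_sqrt hA onb) e,
    trace_of_decomposes (decomposes_sqrt hA onb)]

theorem enorm_inner_le' (x y : L2R) : ‖⟪x, y⟫_ℂ‖ₑ ≤ ‖x‖ₑ * ‖y‖ₑ := by
  rw [← ofReal_norm, ← ofReal_norm, ← ofReal_norm, ← ENNReal.ofReal_mul (norm_nonneg _)]
  exact ENNReal.ofReal_le_ofReal (norm_inner_le_norm x y)

/-- The total Dirichlet energy of a decomposition depends only on the operator: the bound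
`∑ᵢ |⟨wᵢ, φ'⟩|² = ∑ₖ |⟨vₖ, φ'⟩|² = ∑ₖ |⟨vₖ', φ⟩|²` shows that all `wᵢ` are in `H¹`, and then
the quadratic forms of the two families of derivatives agree. -/
theorem tsum_dirichlet_le {κ κ' : Type*} {v : κ → L2R} {w : κ' → L2R} {A : L2R →L[ℂ] L2R}
    (hv : Decomposes v A) (hw : Decomposes w A) :
    ∑' i, dirichlet (w i) ≤ ∑' k, dirichlet (v k) := by
  by_cases hfin : ∑' k, dirichlet (v k) = ⊤
  · rw [hfin]; exact le_top
  have hk : ∀ k, dirichlet (v k) ≠ ⊤ := ENNReal.ne_top_of_tsum_ne_top hfin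
  choose v' hv' using fun k => exists_weakDeriv (hk k)
  have hsum : ∑' k, ‖v' k‖ₑ ^ 2 = ∑' k, dirichlet (v k) :=
    tsum_congr fun k => (dirichlet_eq (hv' k)).symm
  have hform : ∀ u : testSpace, ∑' i, ‖⟪w i, toL2 (derivT u)⟫_ℂ‖ₑ ^ 2
      = ∑' k, ‖⟪v' k, toL2 u⟫_ℂ‖ₑ ^ 2 := by
    intro u
    rw [hw, ← hv]
    refine tsum_congr fun k => ?_
    rw [enorm_inner_symm, (isWeakDeriv_iff _ _).1 (hv' k) u, enorm_neg, enorm_inner_symm]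
  set S := ∑' k, ‖v' k‖ₑ ^ 2 with hS
  have hStop : S ≠ ⊤ := by rw [hsum]; exact hfin
  have hbound : ∀ x : L2R, ∑' k, ‖⟪v' k, x⟫_ℂ‖ₑ ^ 2 ≤ S * ‖x‖ₑ ^ 2 := by
    intro x
    rw [hS, ← ENNReal.tsum_mul_right]
    refine ENNReal.tsum_le_tsum fun k => ?_
    rw [← mul_pow]
    exact pow_le_pow_left₀ zero_le (enorm_inner_le' (v' k) x) 2
  have hw1 : ∀ i, ∃ g, IsWeakDeriv (w i) g := by
    intro i
    refine exists_weakDeriv_of_bound _ (Real.sqrt S.toReal) fun u => ?_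
    have h1 : ‖⟪w i, toL2 (derivT u)⟫_ℂ‖ₑ ^ 2 ≤ S * ‖toL2 u‖ₑ ^ 2 :=
      (ENNReal.le_tsum (f := fun i => ‖⟪w i, toL2 (derivT u)⟫_ℂ‖ₑ ^ 2) i).trans
        ((hform u).le.trans (hbound _))
    have h2 : ‖⟪w i, toL2 (derivT u)⟫_ℂ‖ ^ 2 ≤ S.toReal * ‖toL2 u‖ ^ 2 := by
      have h3 := ENNReal.toReal_mono (ENNReal.mul_ne_top hStop (by simp)) h1
      simpa using h3
    have h4 := Real.abs_le_sqrt h2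
    rw [Real.sqrt_mul ENNReal.toReal_nonneg, Real.sqrt_sq (norm_nonneg _)] at h4
    exact (le_abs_self _).trans h4
  choose w' hw' using hw1
  have hform' : ∀ u : testSpace, ∑' i, ‖⟪w' i, toL2 u⟫_ℂ‖ₑ ^ 2
      = ∑' k, ‖⟪v' k, toL2 u⟫_ℂ‖ₑ ^ 2 := by
    intro u
    rw [← hform u]
    refine tsum_congr fun i => ?_
    rw [enorm_inner_symm (w i), (isWeakDeriv_iff _ _).1 (hw' i) u, enorm_neg, enorm_inner_symm]
  -- the right-hand side is the square of the norm of a bounded operator, hence continuous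
  have hsummable : Summable fun k => ‖v' k‖ ^ 2 := by
    have : Summable fun k => (‖v' k‖ₑ ^ 2).toReal := ENNReal.summable_toReal hStop
    simpa using this
  have hform2 : ∀ (s : Finset κ') (x : L2R),
      ∑ i ∈ s, ‖⟪w' i, x⟫_ℂ‖ₑ ^ 2 ≤ ∑' k, ‖⟪v' k, x⟫_ℂ‖ₑ ^ 2 := by
    intro s x
    have hcont : Continuous fun x : L2R => ∑' k, ‖⟪v' k, x⟫_ℂ‖ₑ ^ 2 := by
      have e : (fun x : L2R => ∑' k, ‖⟪v' k, x⟫_ℂ‖ₑ ^ 2)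
          = fun x : L2R => ENNReal.ofReal (∑' k, ‖⟪v' k, x⟫_ℂ‖ ^ 2) := by
        funext x
        have hx : Summable fun k => ‖⟪v' k, x⟫_ℂ‖ ^ 2 := by
          refine Summable.of_nonneg_of_le (fun k => by positivity) (fun k => ?_)
            (hsummable.mul_right (‖x‖ ^ 2))
          rw [← mul_pow]
          exact pow_le_pow_left₀ (norm_nonneg _) (norm_inner_le_norm (v' k) x) 2
        rw [ENNReal.ofReal_tsum_of_nonneg (fun k => by positivity) hx]
        exact tsum_congr fun k => enorm_sq_eq_ofReal _
      rw [e]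
      refine ENNReal.continuous_ofReal.comp (continuous_iff_continuousAt.2 fun x₀ => ?_)
      have hon : ContinuousOn (fun x : L2R => ∑' k, ‖⟪v' k, x⟫_ℂ‖ ^ 2)
          (Metric.ball 0 (‖x₀‖ + 1)) := by
        refine continuousOn_tsum (u := fun k => ‖v' k‖ ^ 2 * (‖x₀‖ + 1) ^ 2)
          (fun k => by fun_prop) (hsummable.mul_right _) fun k x hx => ?_
        rw [Real.norm_of_nonneg (by positivity), ← mul_pow]
        refine pow_le_pow_left₀ (norm_nonneg _) ((norm_inner_le_norm (v' k) x).trans ?_) 2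
        gcongr
        exact (mem_ball_zero_iff.1 hx).le
      exact hon.continuousAt (Metric.isOpen_ball.mem_nhds (by simp))
    have hcl : IsClosed {x : L2R | ∑ i ∈ s, ‖⟪w' i, x⟫_ℂ‖ₑ ^ 2 ≤ ∑' k, ‖⟪v' k, x⟫_ℂ‖ₑ ^ 2} := by
      refine isClosed_le ?_ hcont
      refine continuous_finsetSum _ fun i _ => ?_
      exact (ENNReal.continuous_pow 2).comp (by fun_prop)
    refine dense_toL2.induction_on (p := fun x => ∑ i ∈ s, ‖⟪w' i, x⟫_ℂ‖ₑ ^ 2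
      ≤ ∑' k, ‖⟪v' k, x⟫_ℂ‖ₑ ^ 2) x hcl fun u => ?_
    exact (ENNReal.sum_le_tsum s).trans (hform' u).le
  have hform3 : ∀ x : L2R, ∑' i, ‖⟪w' i, x⟫_ℂ‖ₑ ^ 2 ≤ ∑' k, ‖⟪v' k, x⟫_ℂ‖ₑ ^ 2 := fun x =>
    ENNReal.tsum_eq_iSup_sum.trans_le (iSup_le fun s => hform2 s x)
  have parseval' : ∀ y : L2R, ‖y‖ₑ ^ 2 = ∑' m, ‖⟪y, onb m⟫_ℂ‖ₑ ^ 2 := fun y => by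
    rw [← parseval onb]
    exact tsum_congr fun m => by rw [enorm_inner_symm]
  calc ∑' i, dirichlet (w i) = ∑' i, ∑' m, ‖⟪w' i, onb m⟫_ℂ‖ₑ ^ 2 :=
        tsum_congr fun i => by rw [dirichlet_eq (hw' i), parseval']
    _ = ∑' m, ∑' i, ‖⟪w' i, onb m⟫_ℂ‖ₑ ^ 2 := ENNReal.tsum_comm
    _ ≤ ∑' m, ∑' k, ‖⟪v' k, onb m⟫_ℂ‖ₑ ^ 2 := ENNReal.tsum_le_tsum fun m => hform3 _
    _ = ∑' k, ∑' m, ‖⟪v' k, onb m⟫_ℂ‖ₑ ^ 2 := ENNReal.tsum_comm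
    _ = ∑' k, dirichlet (v k) := by
        rw [← hsum]
        exact tsum_congr fun k => (parseval' _).symm

theorem traceNegLaplacian_of_decomposes {κ : Type*} {v : κ → L2R} {A : L2R →L[ℂ] L2R}
    (hA : A.IsPositive) (hv : Decomposes v A) :
    traceNegLaplacian A = ∑' k, dirichlet (v k) :=
  le_antisymm (tsum_dirichlet_le hv (decomposes_sqrt hA onb))
    (tsum_dirichlet_le (decomposes_sqrt hA onb) hv)

instance : Countable onbIndex := by
  have ho := onb.orthonormal
  have : Set.Countable (Set.univ : Set onbIndex) := by
    refine Set.PairwiseDisjoint.countable_of_isOpen (s := fun i => Metric.ball (onb i) (1 / 2))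
      ?_ (fun i _ => Metric.isOpen_ball) (fun i _ => ⟨onb i, Metric.mem_ball_self (by norm_num)⟩)
    intro i _ j _ hij
    refine Metric.ball_disjoint_ball ?_
    have h1 : ‖onb i - onb j‖ ^ 2 = 2 := by
      rw [@norm_sub_sq ℂ, ho.2 hij, ho.1 i, ho.1 j]
      norm_num
    rw [dist_eq_norm]
    have h2 := norm_nonneg (onb i - onb j)
    nlinarith
  exact Set.countable_univ_iff.1 this

theorem lintegral_enorm_sq (f : L2R) : ∫⁻ x, ‖f x‖ₑ ^ 2 = ‖f‖ₑ ^ 2 := by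
  rw [Lp.enorm_def, eLpNorm_eq_lintegral_rpow_enorm_toReal (by norm_num) (by norm_num)]
  simp only [ENNReal.toReal_ofNat, ENNReal.rpow_ofNat]
  rw [← ENNReal.rpow_natCast, ← ENNReal.rpow_mul]
  norm_num

/-- Multiplication by the indicator function of `B`. -/
def indL2 {B : Set ℝ} (hB : MeasurableSet B) (f : L2R) : L2R :=
  ((Lp.memLp f).indicator hB).toLp

theorem coeFn_indL2 {B : Set ℝ} (hB : MeasurableSet B) (f : L2R) :
    (indL2 hB f : ℝ → ℂ) =ᵐ[volume] B.indicator f := MemLp.coeFn_toLp _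

theorem enorm_indL2_sq {B : Set ℝ} (hB : MeasurableSet B) (f : L2R) :
    ‖indL2 hB f‖ₑ ^ 2 = ∫⁻ x in B, ‖f x‖ₑ ^ 2 := by
  rw [← lintegral_enorm_sq, ← lintegral_indicator hB]
  refine lintegral_congr_ae ?_
  filter_upwards [coeFn_indL2 hB f] with x hx
  rw [hx]
  by_cases h : x ∈ B <;> simp [h]

theorem inner_indL2 {B : Set ℝ} (hB : MeasurableSet B) (f g : L2R) :
    ⟪indL2 hB f, g⟫_ℂ = ⟪f, indL2 hB g⟫_ℂ := by
  rw [L2.inner_def, L2.inner_def]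
  refine integral_congr_ae ?_
  filter_upwards [coeFn_indL2 hB f, coeFn_indL2 hB g] with x hx hy
  rw [hx, hy]
  by_cases h : x ∈ B <;> simp [h]

theorem aemeasurable_tsum_enorm_sq {κ : Type*} [Countable κ] (v : κ → L2R) :
    AEMeasurable (fun x => ∑' k, ‖v k x‖ₑ ^ 2) :=
  AEMeasurable.tsum fun k => ((Lp.aestronglyMeasurable (v k)).enorm).pow_const 2

theorem setLIntegral_tsum_of_decomposes {κ : Type*} [Countable κ] {v : κ → L2R}
    {A : L2R →L[ℂ] L2R} (hv : Decomposes v A) {B : Set ℝ} (hB : MeasurableSet B) :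
    ∫⁻ x in B, ∑' k, ‖v k x‖ₑ ^ 2
      = ∑' m, ENNReal.ofReal (⟪indL2 hB (onb m), A (indL2 hB (onb m))⟫_ℂ).re := by
  rw [lintegral_tsum fun k => (((Lp.aestronglyMeasurable (v k)).enorm).pow_const 2).restrict]
  simp_rw [← hv _]
  rw [ENNReal.tsum_comm]
  refine tsum_congr fun k => ?_
  rw [← enorm_indL2_sq hB, ← parseval onb]
  exact tsum_congr fun m => by rw [enorm_inner_symm, inner_indL2]

/-- The density of a decomposition depends only on the operator: both densities have the integral
`Tr(1_B A 1_B)` over every Borel set `B`. -/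
theorem ae_tsum_eq_of_decomposes {κ κ' : Type*} [Countable κ] [Countable κ'] {v : κ → L2R}
    {w : κ' → L2R} {A : L2R →L[ℂ] L2R} (hv : Decomposes v A) (hw : Decomposes w A) :
    (fun x => ∑' k, ‖v k x‖ₑ ^ 2) =ᵐ[volume] fun x => ∑' i, ‖w i x‖ₑ ^ 2 := by
  refine ae_eq_of_forall_setLIntegral_eq_of_sigmaFinite₀ (aemeasurable_tsum_enorm_sq v)
    (aemeasurable_tsum_enorm_sq w) fun B hB _ => ?_
  rw [setLIntegral_tsum_of_decomposes hv hB, setLIntegral_tsum_of_decomposes hw hB]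

theorem lintegral_tsum_of_decomposes {κ : Type*} [Countable κ] {v : κ → L2R}
    {A : L2R →L[ℂ] L2R} (hv : Decomposes v A) : ∫⁻ x, ∑' k, ‖v k x‖ₑ ^ 2 = trace A := by
  rw [lintegral_tsum fun k => ((Lp.aestronglyMeasurable (v k)).enorm).pow_const 2,
    trace_of_decomposes hv]
  exact tsum_congr fun k => lintegral_enorm_sq _

theorem density_nonneg (A : L2R →L[ℂ] L2R) (x : ℝ) : 0 ≤ density A x :=
  tsum_nonneg fun _ => by positivity

theorem ofReal_density {κ : Type*} [Countable κ] {v : κ → L2R} {A : L2R →L[ℂ] L2R}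
    (hA : A.IsPositive) (ht : trace A ≠ ⊤) (hv : Decomposes v A) :
    ∀ᵐ x, ENNReal.ofReal (density A x) = ∑' k, ‖v k x‖ₑ ^ 2 := by
  have hs := decomposes_sqrt hA onb
  have hfin : ∀ᵐ x, ∑' i, ‖(CFC.sqrt A (onb i) : ℝ → ℂ) x‖ₑ ^ 2 < ⊤ :=
    ae_lt_top' (aemeasurable_tsum_enorm_sq _) (by rwa [lintegral_tsum_of_decomposes hs])
  filter_upwards [hfin, ae_tsum_eq_of_decomposes hs hv] with x hx hx'
  rw [← hx', density]
  have hsm : Summable fun i => ‖(CFC.sqrt A (onb i) : ℝ → ℂ) x‖ ^ 2 := by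
    have := ENNReal.summable_toReal hx.ne
    simpa using this
  rw [ENNReal.ofReal_tsum_of_nonneg (fun i => by positivity) hsm]
  exact tsum_congr fun i => (enorm_sq_eq_ofReal _).symm

theorem lintegral_density {A : L2R →L[ℂ] L2R} (hA : A.IsPositive) (ht : trace A ≠ ⊤) :
    ∫⁻ x, ENNReal.ofReal (density A x) = trace A := by
  have hs := decomposes_sqrt hA onb
  rw [lintegral_congr_ae (ofReal_density hA ht hs), lintegral_tsum_of_decomposes hs]

theorem aemeasurable_density {A : L2R →L[ℂ] L2R} (hA : A.IsPositive) (ht : trace A ≠ ⊤) :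
    AEMeasurable (density A) := by
  have hs := decomposes_sqrt hA onb
  refine ((aemeasurable_tsum_enorm_sq _).ennreal_toReal).congr
    (f := fun x => (∑' i, ‖(CFC.sqrt A (onb i) : ℝ → ℂ) x‖ₑ ^ 2).toReal) ?_
  filter_upwards [ofReal_density hA ht hs] with x hx
  rw [← hx, ENNReal.toReal_ofReal (density_nonneg A x)]

theorem integrable_density {A : L2R →L[ℂ] L2R} (hA : A.IsPositive) (ht : trace A ≠ ⊤) :
    Integrable (density A) := by
  refine ⟨(aemeasurable_density hA ht).aestronglyMeasurable, ?_⟩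
  rw [hasFiniteIntegral_iff_ofReal (ae_of_all _ (density_nonneg A)), lintegral_density hA ht]
  exact ht.lt_top

theorem integral_density {A : L2R →L[ℂ] L2R} (hA : A.IsPositive) (ht : trace A ≠ ⊤) :
    ∫ x, density A x = (trace A).toReal := by
  rw [integral_eq_lintegral_of_nonneg_ae (ae_of_all _ (density_nonneg A))
    (aemeasurable_density hA ht).aestronglyMeasurable, lintegral_density hA ht]

/-! ### Additivity of trace, kinetic energy and density -/

theorem trace_add {A B : L2R →L[ℂ] L2R} (hA : A.IsPositive) (hB : B.IsPositive) :
    trace (A + B) = trace A + trace B := by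
  have h1 := decomposes_sqrt hA onb
  have h2 := decomposes_sqrt hB onb
  rw [trace_of_decomposes (h1.add hA hB h2), ENNReal.summable.tsum_sum ENNReal.summable,
    trace_of_decomposes h1, trace_of_decomposes h2]
  rfl

theorem traceNegLaplacian_add {A B : L2R →L[ℂ] L2R} (hA : A.IsPositive) (hB : B.IsPositive) :
    traceNegLaplacian (A + B) = traceNegLaplacian A + traceNegLaplacian B := by
  have h1 := decomposes_sqrt hA onb
  have h2 := decomposes_sqrt hB onb
  rw [traceNegLaplacian_of_decomposes (hA.add hB) (h1.add hA hB h2),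
    ENNReal.summable.tsum_sum ENNReal.summable,
    traceNegLaplacian_of_decomposes hA h1, traceNegLaplacian_of_decomposes hB h2]
  rfl

theorem density_add {A B : L2R →L[ℂ] L2R} (hA : A.IsPositive) (hB : B.IsPositive)
    (hA' : trace A ≠ ⊤) (hB' : trace B ≠ ⊤) :
    ∀ᵐ x, density (A + B) x = density A x + density B x := by
  have h1 := decomposes_sqrt hA onb
  have h2 := decomposes_sqrt hB onb
  filter_upwards [ofReal_density hA hA' h1, ofReal_density hB hB' h2,
    ofReal_density (hA.add hB) (by rw [trace_add hA hB]; exact ENNReal.add_ne_top.2 ⟨hA', hB'⟩)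
      (h1.add hA hB h2)] with x hx1 hx2 hx3
  rw [ENNReal.summable.tsum_sum ENNReal.summable] at hx3
  simp only [Sum.elim_inl, Sum.elim_inr] at hx3
  rw [← hx1, ← hx2, ← ENNReal.ofReal_add (density_nonneg _ _) (density_nonneg _ _),
    ENNReal.ofReal_eq_ofReal_iff (density_nonneg _ _)
      (add_nonneg (density_nonneg _ _) (density_nonneg _ _))] at hx3
  exact hx3

theorem ketbra_isPositive (v : L2R) : (ketbra v).IsPositive :=
  InnerProductSpace.isPositive_rankOne_self v

theorem trace_ketbra (v : L2R) : trace (ketbra v) = ‖v‖ₑ ^ 2 := by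
  rw [trace_of_decomposes (decomposes_ketbra v)]
  simp

theorem traceNegLaplacian_ketbra (v : L2R) : traceNegLaplacian (ketbra v) = dirichlet v := by
  rw [traceNegLaplacian_of_decomposes (ketbra_isPositive v) (decomposes_ketbra v)]
  simp

theorem density_ketbra (v : L2R) : ∀ᵐ x, density (ketbra v) x = ‖v x‖ ^ 2 := by
  filter_upwards [ofReal_density (ketbra_isPositive v) (by rw [trace_ketbra]; simp)
    (decomposes_ketbra v)] with x hx
  simp only [tsum_fintype, Finset.univ_unique, Finset.sum_const, Finset.card_singleton,
    one_smul] at hx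
  rw [enorm_sq_eq_ofReal, ENNReal.ofReal_eq_ofReal_iff (density_nonneg _ _) (by positivity)] at hx
  exact hx

theorem traceNegLaplacian_mono {A B : L2R →L[ℂ] L2R} (hA : A.IsPositive) (hAB : A ≤ B) :
    traceNegLaplacian A ≤ traceNegLaplacian B := by
  have : B = A + (B - A) := by abel
  rw [this, traceNegLaplacian_add hA hAB]
  exact le_self_add

theorem isPositive_of_re_inner {T : L2R →L[ℂ] L2R} (hT : IsSelfAdjoint T)
    (h : ∀ y, 0 ≤ (⟪y, T y⟫_ℂ).re) : T.IsPositive :=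
  ContinuousLinearMap.isPositive_def'.2 ⟨hT, fun y => by
    rw [ContinuousLinearMap.reApplyInnerSelf_apply, inner_re_symm]
    exact h y⟩

theorem le_of_re_inner {A B : L2R →L[ℂ] L2R} (hA : IsSelfAdjoint A) (hB : IsSelfAdjoint B)
    (h : ∀ y, (⟪y, A y⟫_ℂ).re ≤ (⟪y, B y⟫_ℂ).re) : A ≤ B :=
  isPositive_of_re_inner (hB.sub hA) fun y => by
    rw [sub_apply, inner_sub_right, Complex.sub_re]
    exact sub_nonneg.2 (h y)

theorem re_inner_le_of_le {A B : L2R →L[ℂ] L2R} (h : A ≤ B) (y : L2R) :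
    (⟪y, A y⟫_ℂ).re ≤ (⟪y, B y⟫_ℂ).re := by
  have := ContinuousLinearMap.IsPositive.re_inner_nonneg_right h y
  rw [sub_apply, inner_sub_right] at this
  exact sub_nonneg.1 ((Complex.sub_re _ _).symm.trans_ge this)

theorem re_inner_ketbra (v y : L2R) : (⟪y, ketbra v y⟫_ℂ).re = ‖⟪v, y⟫_ℂ‖ ^ 2 := by
  rw [InnerProductSpace.rankOne_apply, inner_smul_right, ← inner_conj_symm y v, Complex.mul_conj,
    Complex.ofReal_re, Complex.normSq_eq_norm_sq]

/-- The range of `√A` is contained in `H¹(ℝ)` if `A` has finite kinetic energy. -/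
theorem exists_weakDeriv_sqrt {A : L2R →L[ℂ] L2R} (hA : A.IsPositive)
    (ht : traceNegLaplacian A ≠ ⊤) (x : L2R) : ∃ g, IsWeakDeriv (CFC.sqrt A x) g := by
  have h1 : ∀ x : L2R, ‖x‖ ≤ 1 → ∃ g, IsWeakDeriv (CFC.sqrt A x) g := by
    intro x hx
    refine exists_weakDeriv (ne_top_of_le_ne_top ht ?_)
    rw [← traceNegLaplacian_ketbra]
    refine traceNegLaplacian_mono (ketbra_isPositive _) (le_of_re_inner
      (ketbra_isPositive _).isSelfAdjoint hA.isSelfAdjoint fun y => ?_)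
    rw [re_inner_ketbra, re_inner_eq_norm_sqrt hA, inner_sqrt_left]
    refine pow_le_pow_left₀ (norm_nonneg _) ((norm_inner_le_norm _ _).trans ?_) 2
    exact mul_le_of_le_one_left (norm_nonneg _) hx
  obtain ⟨g, hg⟩ := h1 (((‖x‖⁻¹ : ℝ) : ℂ) • x) (by
    rw [norm_smul, Complex.norm_real, norm_inv, norm_norm]
    exact inv_mul_le_one)
  rcases eq_or_ne x 0 with rfl | hx
  · simp only [smul_zero] at hg
    exact ⟨g, hg⟩
  · have h2 := hg.smul ((‖x‖ : ℝ) : ℂ)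
    rw [map_smul, smul_smul, ← Complex.ofReal_mul, mul_inv_cancel₀ (norm_ne_zero_iff.2 hx),
      Complex.ofReal_one, one_smul] at h2
    exact ⟨_, h2⟩

theorem exists_weakDeriv_apply {A : L2R →L[ℂ] L2R} (hA : A.IsPositive)
    (ht : traceNegLaplacian A ≠ ⊤) (x : L2R) : ∃ g, IsWeakDeriv (A x) g := by
  obtain ⟨g, hg⟩ := exists_weakDeriv_sqrt hA ht (CFC.sqrt A x)
  rw [sqrt_sqrt_apply hA] at hg
  exact ⟨g, hg⟩

end Families

end RHF

end

noncomputable section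

namespace RHF

/-! ### Compact operators and the continuous functional calculus -/

section Operators

open InnerProductSpace

variable {E : Type} [NormedAddCommGroup E] [InnerProductSpace ℂ E] [CompleteSpace E]

theorem isCompactOperator_rankOne (x y : E) : IsCompactOperator (rankOne ℂ x y) := by
  rw [rankOne_def']
  exact IsCompactOperator.comp_clm (isCompactOperator_of_locallyCompactSpace_rng
    (ContinuousLinearMap.toSpanSingleton ℂ x)) _

/-- A self-adjoint Hilbert–Schmidt operator is compact: it is the norm limit of its compressions
to finite sets of basis vectors. -/
theorem isCompactOperator_of_summable {ι : Type*} (e : HilbertBasis ι ℂ E) {S : E →L[ℂ] E}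
    (hS : IsSelfAdjoint S) (hs : Summable fun i => ‖S (e i)‖ ^ 2) : IsCompactOperator S := by
  classical
  let T : Finset ι → E →L[ℂ] E := fun s => ∑ i ∈ s, rankOne ℂ (e i) (S (e i))
  have hT : ∀ s, IsCompactOperator (T s) := by
    intro s
    have : T s ∈ compactOperator (RingHom.id ℂ) E E :=
      Submodule.sum_mem _ fun i _ => isCompactOperator_rankOne _ _
    exact this
  have hsum : ∀ x : E, HasSum (fun i => ‖⟪e i, x⟫_ℂ‖ ^ 2) (‖x‖ ^ 2) := by
    intro x
    have h2 := Complex.hasSum_re (e.hasSum_inner_mul_inner x x)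
    convert h2 using 1
    · funext i
      rw [← inner_conj_symm x, ← Complex.normSq_eq_conj_mul_self, Complex.ofReal_re,
        Complex.normSq_eq_norm_sq]
    · exact norm_sq_eq_re_inner (𝕜 := ℂ) x
  have hbound : ∀ s x, ‖(S - T s) x‖ ^ 2 ≤ (∑' i : { i // i ∉ s }, ‖S (e i)‖ ^ 2) * ‖x‖ ^ 2 := by
    intro s x
    have hi : ∀ j, ‖⟪e j, (S - T s) x⟫_ℂ‖ ^ 2
        ≤ ({i | i ∉ s} : Set ι).indicator (fun i => ‖S (e i)‖ ^ 2) j * ‖x‖ ^ 2 := by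
      intro j
      have h1 : ⟪e j, (S - T s) x⟫_ℂ = if j ∈ s then 0 else ⟪S (e j), x⟫_ℂ := by
        have h2 : ⟪e j, S x⟫_ℂ = ⟪S (e j), x⟫_ℂ := (hS.isSymmetric (e j) x).symm
        simp only [T, sub_apply, sum_apply, rankOne_apply, inner_sub_right,
          inner_sum, inner_smul_right, orthonormal_iff_ite.1 e.orthonormal, h2]
        by_cases hj : j ∈ s <;> simp [hj]
      rw [h1]
      by_cases hj : j ∈ s
      · simp [hj]
      · simp only [hj, if_false, Set.indicator, Set.mem_ofPred_eq, not_false_eq_true, if_true,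
          ← mul_pow]
        exact pow_le_pow_left₀ (norm_nonneg _) (norm_inner_le_norm _ _) 2
    have hs' : Summable (({i | i ∉ s} : Set ι).indicator fun i => ‖S (e i)‖ ^ 2) :=
      hs.indicator _
    have h3 := hasSum_le hi (hsum ((S - T s) x)) (hs'.hasSum.mul_right (‖x‖ ^ 2))
    rwa [← tsum_subtype ({i | i ∉ s} : Set ι) (fun i => ‖S (e i)‖ ^ 2)] at h3
  refine isCompactOperator_of_tendsto (l := atTop) (F := T) ?_ (Eventually.of_forall hT)
  have htend : Tendsto (fun s : Finset ι => Real.sqrt (∑' i : { i // i ∉ s }, ‖S (e i)‖ ^ 2))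
      atTop (𝓝 0) := by
    have := (tendsto_tsum_compl_atTop_zero fun i => ‖S (e i)‖ ^ 2).sqrt
    rwa [Real.sqrt_zero] at this
  rw [tendsto_iff_norm_sub_tendsto_zero]
  refine squeeze_zero (fun _ => norm_nonneg _) (fun s => ?_) htend
  rw [norm_sub_rev]
  refine ContinuousLinearMap.opNorm_le_bound _ (Real.sqrt_nonneg _) fun x => ?_
  have h4 := Real.sqrt_le_sqrt (hbound s x)
  rwa [Real.sqrt_sq (norm_nonneg _), Real.sqrt_mul (tsum_nonneg fun _ => by positivity),
    Real.sqrt_sq (norm_nonneg _)] at h4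

/-- Simultaneous diagonalisation: if `A` is compact and self-adjoint and `R` is a bounded
self-adjoint operator commuting with `A`, there is an orthonormal basis of eigenvectors of `A`
such that those with nonzero eigenvalue are also eigenvectors of `R`. -/
theorem exists_joint_eigenbasis {A R : E →L[ℂ] E} (hA : IsSelfAdjoint A)
    (hAc : IsCompactOperator A) (hR : IsSelfAdjoint R) (hAR : Commute A R) :
    ∃ (ι : Type) (e : HilbertBasis ι ℂ E) (g r : ι → ℝ), (∀ i, A (e i) = (g i : ℂ) • e i) ∧
      ∀ i, g i ≠ 0 → R (e i) = (r i : ℂ) • e i := by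
  have hAs : A.toLinearMap.IsSymmetric := hA.isSymmetric
  have hinv : ∀ μ : ℂ, ∀ x ∈ Module.End.eigenspace A.toLinearMap μ,
      R x ∈ Module.End.eigenspace A.toLinearMap μ := by
    intro μ x hx
    rw [Module.End.mem_eigenspace_iff] at hx ⊢
    have h1 : A (R x) = R (A x) := congrArg (fun T : E →L[ℂ] E => T x) hAR.eq
    change A (R x) = μ • R x
    rw [h1, show A x = μ • x from hx, map_smul]
  have hb : ∀ μ : ℂ, ∃ (κ : Type) (b : HilbertBasis κ ℂ (Module.End.eigenspace A.toLinearMap μ)),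
      μ ≠ 0 → ∀ i, ∃ r : ℝ, R (b i : E) = (r : ℂ) • (b i : E) := by
    intro μ
    by_cases hμ : μ = 0
    · have hcl : IsClosed (Module.End.eigenspace A.toLinearMap μ : Set E) := by
        have : (Module.End.eigenspace A.toLinearMap μ : Set E) = {x | A x = μ • x} := by
          ext x
          simp
        rw [this]
        exact isClosed_eq A.continuous (continuous_const_smul μ)
      have := hcl.completeSpace_coe
      obtain ⟨w, b, -⟩ := exists_hilbertBasis ℂ (Module.End.eigenspace A.toLinearMap μ)
      exact ⟨w, b, fun h => absurd hμ h⟩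
    · have : FiniteDimensional ℂ (Module.End.eigenspace A.toLinearMap μ) :=
        A.finite_dimensional_eigenspace hAc μ hμ
      have hRs : (R.toLinearMap.restrict (hinv μ)).IsSymmetric :=
        LinearMap.IsSymmetric.restrict_invariant hR.isSymmetric (hinv μ)
      refine ⟨_, (hRs.eigenvectorBasis rfl).toHilbertBasis, fun _ i => ?_⟩
      refine ⟨hRs.eigenvalues rfl i, ?_⟩
      rw [OrthonormalBasis.coe_toHilbertBasis]
      exact congrArg Subtype.val (hRs.apply_eigenvectorBasis rfl i)
  choose κ b hbR using hb
  let v : (Σ μ, κ μ) → E := fun p => (b p.1 p.2 : E)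
  have hv : Orthonormal ℂ v :=
    hAs.orthogonalFamily_eigenspaces.orthonormal_sigma_orthonormal fun μ => (b μ).orthonormal
  have hsp : (Submodule.span ℂ (Set.range v))ᗮ = ⊥ := by
    rw [Submodule.eq_bot_iff]
    intro x hx
    have h1 : x ∈ (⨆ μ, Module.End.eigenspace A.toLinearMap μ)ᗮ := by
      rw [Submodule.mem_orthogonal']
      intro y hy
      have : (⨆ μ, Module.End.eigenspace A.toLinearMap μ) ≤ (innerSL ℂ x).toLinearMap.ker := by
        refine iSup_le fun μ y hy => ?_
        have h2 := (b μ).hasSum_repr ⟨y, hy⟩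
        have h3 := h2.mapL ((innerSL ℂ x).comp (Submodule.subtypeL _))
        have h4 : ∀ i, ((innerSL ℂ x).comp (Submodule.subtypeL _))
            ((b μ).repr ⟨y, hy⟩ i • b μ i) = 0 := by
          intro i
          rw [map_smul]
          have h5 : ⟪x, v ⟨μ, i⟩⟫_ℂ = 0 := by
            rw [Submodule.mem_orthogonal'] at hx
            exact hx _ (Submodule.subset_span ⟨⟨μ, i⟩, rfl⟩)
          have h6 : ((innerSL ℂ x).comp (Submodule.subtypeL _)) (b μ i) = 0 := h5
          rw [h6, smul_zero]
        simp only [h4] at h3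
        exact h3.unique hasSum_zero
      exact this hy
    rwa [A.orthogonalComplement_iSup_eigenspaces_eq_bot hAc hAs, Submodule.mem_bot] at h1
  have hAe : ∀ p : (Σ μ, κ μ), A (v p) = p.1 • v p := fun p =>
    Module.End.mem_eigenspace_iff.1 (b p.1 p.2).2
  have hreal : ∀ p : (Σ μ, κ μ), ((p.1.re : ℝ) : ℂ) = p.1 := by
    intro p
    refine Complex.conj_eq_iff_re.1 (hAs.conj_eigenvalue_eq_self (μ := p.1) ?_)
    exact Module.End.hasEigenvalue_of_hasEigenvector
      ⟨Module.End.mem_eigenspace_iff.2 (hAe p), hv.ne_zero p⟩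
  choose! r hr using fun (p : Σ μ, κ μ) (hp : p.1 ≠ 0) => hbR p.1 hp p.2
  refine ⟨_, HilbertBasis.mkOfOrthogonalEqBot hv hsp, fun p => p.1.re, r, fun p => ?_,
    fun p hp => ?_⟩
  · rw [HilbertBasis.coe_mkOfOrthogonalEqBot, hAe, hreal]
  · rw [HilbertBasis.coe_mkOfOrthogonalEqBot]
    refine hr p fun h => hp ?_
    simp [h]

/-! #### Intertwining relations and rank one perturbations -/

/-- Proved for polynomials first, and then for continuous functions by the Weierstrass theorem. -/
theorem cfc_intertwine {B T V : E →L[ℂ] E} (hB : IsSelfAdjoint B) (hT : IsSelfAdjoint T)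
    (h : B * V = V * T) {f : ℝ → ℝ} (hf : Continuous f) : cfc f B * V = V * cfc f T := by
  have hpoly : ∀ p : Polynomial ℝ, Polynomial.aeval B p * V = V * Polynomial.aeval T p := by
    intro p
    induction p using Polynomial.induction_on' with
    | add p q hp hq => rw [map_add, map_add, add_mul, mul_add, hp, hq]
    | monomial n a =>
      have hn : B ^ n * V = V * T ^ n := by
        induction n with
        | zero => simp
        | succ n ih => rw [pow_succ, mul_assoc, h, ← mul_assoc, ih, mul_assoc, ← pow_succ]
      rw [Polynomial.aeval_monomial, Polynomial.aeval_monomial, mul_assoc, hn,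
        ← mul_assoc, ← mul_assoc, (Algebra.commutes a V)]
  set m := max ‖B‖ ‖T‖
  have hsp : ∀ {S : E →L[ℂ] E}, ‖S‖ ≤ m → spectrum ℝ S ⊆ Set.Icc (-m) m := by
    intro S hS x hx
    have hx' : ((x : ℝ) : ℂ) ∈ spectrum ℂ S := (spectrum.algebraMap_mem_iff ℂ).2 hx
    have : ‖(x : ℂ)‖ ≤ m := by
      rcases subsingleton_or_nontrivial E with hE | hE
      · exfalso
        have : Subsingleton (E →L[ℂ] E) := inferInstance
        rw [spectrum.of_subsingleton] at hx'
        exact hx'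
      · exact (spectrum.norm_le_norm_of_mem hx').trans hS
    rw [Complex.norm_real, Real.norm_eq_abs] at this
    exact abs_le.1 this
  rw [← sub_eq_zero, ← norm_le_zero_iff]
  refine le_of_forall_pos_le_add fun ε hε => ?_
  have hVp : 0 < 2 * ‖V‖ + 1 := by positivity
  obtain ⟨p, hp⟩ := exists_polynomial_near_of_continuousOn (-m) m f hf.continuousOn
    (ε / (2 * ‖V‖ + 1)) (by positivity)
  have hnear : ∀ {S : E →L[ℂ] E}, IsSelfAdjoint S → ‖S‖ ≤ m →
      ‖cfc f S - Polynomial.aeval S p‖ ≤ ε / (2 * ‖V‖ + 1) := by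
    intro S hS hSm
    rw [← cfc_polynomial p S, ← cfc_sub f (fun x => p.eval x) S]
    refine norm_cfc_le (by positivity) fun x hx => ?_
    rw [norm_sub_rev]
    exact (hp x (hsp hSm hx)).le
  have e : cfc f B * V - V * cfc f T = (cfc f B - Polynomial.aeval B p) * V
      - V * (cfc f T - Polynomial.aeval T p) := by
    rw [sub_mul, mul_sub, hpoly p]
    abel
  rw [e, zero_add]
  calc _ ≤ ‖(cfc f B - Polynomial.aeval B p) * V‖ + ‖V * (cfc f T - Polynomial.aeval T p)‖ :=
        norm_sub_le _ _
    _ ≤ ε / (2 * ‖V‖ + 1) * ‖V‖ + ‖V‖ * (ε / (2 * ‖V‖ + 1)) := by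
        refine add_le_add ((norm_mul_le _ _).trans ?_) ((norm_mul_le _ _).trans ?_)
        · exact mul_le_mul_of_nonneg_right (hnear hB (le_max_left _ _)) (norm_nonneg _)
        · exact mul_le_mul_of_nonneg_left (hnear hT (le_max_right _ _)) (norm_nonneg _)
    _ = ε * (2 * ‖V‖ / (2 * ‖V‖ + 1)) := by ring
    _ ≤ ε := by
        refine mul_le_of_le_one_right hε.le ?_
        rw [div_le_one hVp]
        linarith

theorem cfc_mul_rankOne {A : E →L[ℂ] E} (hA : IsSelfAdjoint A) {v : E} {a : ℝ}
    (hv : A v = (a : ℂ) • v) {f : ℝ → ℝ} (hf : Continuous f) (w : E) :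
    cfc f A * rankOne ℂ v w = (f a) • rankOne ℂ v w := by
  have h : A * rankOne ℂ v w = rankOne ℂ v w * algebraMap ℝ (E →L[ℂ] E) a := by
    ext x
    simp only [ContinuousLinearMap.mul_def, ContinuousLinearMap.comp_apply, rankOne_apply,
      Algebra.algebraMap_eq_smul_one, smul_apply, map_smul, hv]
    rw [show (1 : E →L[ℂ] E) x = x from rfl, smul_smul, ← Complex.coe_smul a x, inner_smul_right,
      mul_comm]
  rw [cfc_intertwine hA (IsSelfAdjoint.algebraMap _ (IsSelfAdjoint.all a)) h hf, cfc_algebraMap,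
    Algebra.algebraMap_eq_smul_one, mul_smul_comm, mul_one]

theorem cfc_apply_eigenvector {A : E →L[ℂ] E} (hA : IsSelfAdjoint A) {v : E} {a : ℝ}
    (hv : A v = (a : ℂ) • v) {f : ℝ → ℝ} (hf : Continuous f) : cfc f A v = (f a : ℂ) • v := by
  rcases eq_or_ne v 0 with rfl | hv0
  · simp
  have h := congrArg (fun T : E →L[ℂ] E => T v) (cfc_mul_rankOne hA hv hf v)
  simp only [ContinuousLinearMap.mul_def, ContinuousLinearMap.comp_apply, rankOne_apply,
    map_smul, smul_apply] at h
  rw [smul_comm] at h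
  have hne : ⟪v, v⟫_ℂ ≠ 0 := inner_self_ne_zero.2 hv0
  have := smul_right_injective E hne h
  rw [this, Complex.coe_smul]

theorem isSelfAdjoint_rankOne_self (e : E) : IsSelfAdjoint (rankOne ℂ e e) :=
  (isPositive_rankOne_self e).isSelfAdjoint

/-- The functional calculus of a rank one perturbation `A + s |e⟩⟨e|` along a normalised
eigenvector `e` of `A`. -/
theorem cfc_add_smul_rankOne {A : E →L[ℂ] E} (hA : IsSelfAdjoint A) {e : E} (he : ‖e‖ = 1)
    {a : ℝ} (hAe : A e = (a : ℂ) • e) (s : ℝ) {f : ℝ → ℝ} (hf : Continuous f) :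
    cfc f (A + s • rankOne ℂ e e) = cfc f A + (f (a + s) - f a) • rankOne ℂ e e := by
  set P := rankOne ℂ e e with hP
  have hPs : IsSelfAdjoint P := isSelfAdjoint_rankOne_self e
  have hA' : IsSelfAdjoint (A + s • P) := hA.add ((IsSelfAdjoint.all s).smul hPs)
  have hA'e : (A + s • P) e = ((a + s : ℝ) : ℂ) • e := by
    rw [add_apply, smul_apply, hAe, hP, rankOne_apply, inner_self_eq_norm_sq_to_K, he]
    push_cast
    rw [add_smul]
    simp
  have hPP : P * P = P := (isIdempotentElem_rankOne_self he).eq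
  have hAP : A * P = a • P := by
    have := cfc_mul_rankOne hA hAe continuous_id e
    rwa [cfc_id ℝ A] at this
  have hPA : P * A = a • P := by
    have := congrArg star hAP
    rwa [star_mul, star_smul, hA.star_eq, hPs.star_eq, star_trivial] at this
  have h1 : cfc f (A + s • P) * (1 - P) = (1 - P) * cfc f A := by
    refine cfc_intertwine hA' hA ?_ hf
    rw [mul_sub, mul_one, sub_mul, one_mul, add_mul, smul_mul_assoc, hPP, hAP, hPA]
    abel
  have h2 : cfc f (A + s • P) * P = f (a + s) • P := cfc_mul_rankOne hA' hA'e hf e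
  have h3 : cfc f A * P = f a • P := cfc_mul_rankOne hA hAe hf e
  have h4 : P * cfc f A = f a • P := by
    have := congrArg star h3
    rwa [star_mul, star_smul, (cfc_predicate f A : IsSelfAdjoint _).star_eq, hPs.star_eq,
      star_trivial] at this
  rw [mul_sub, mul_one, sub_mul, one_mul, h2, h4] at h1
  rw [sub_smul, ← add_sub_assoc, add_sub_right_comm, ← h1]
  abel

/-- Jensen's inequality `f(⟨e, A e⟩) ≤ ⟨e, f(A) e⟩`, for a function with a supporting line. -/
theorem le_re_inner_cfc {A : E →L[ℂ] E} (hA : IsSelfAdjoint A) {e : E} (he : ‖e‖ = 1)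
    {f : ℝ → ℝ} (hf : Continuous f) {c : ℝ}
    (hc : ∀ y, f (⟪e, A e⟫_ℂ).re + c * (y - (⟪e, A e⟫_ℂ).re) ≤ f y) :
    f (⟪e, A e⟫_ℂ).re ≤ (⟪e, cfc f A e⟫_ℂ).re := by
  set m := (⟪e, A e⟫_ℂ).re with hm
  have h1 : cfc (fun y => (f m - c * m) + c * y) A ≤ cfc f A :=
    cfc_mono fun y _ => by
      have := hc y
      linarith
  rw [cfc_const_add (f m - c * m) (fun y => c * y) A, cfc_const_mul_id c A,
    Algebra.algebraMap_eq_smul_one] at h1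
  have h2 := ContinuousLinearMap.IsPositive.re_inner_nonneg_right h1 e
  rw [sub_apply, inner_sub_right, add_apply, smul_apply, smul_apply, inner_add_right] at h2
  rw [← Complex.coe_smul, ← Complex.coe_smul, inner_smul_right, inner_smul_right,
    show (1 : E →L[ℂ] E) e = e from rfl, inner_self_eq_norm_sq_to_K, he] at h2
  simp only [map_sub, map_add, RCLike.re_to_complex, Complex.re_ofReal_mul, ← hm] at h2
  norm_num at h2
  linarith

theorem cfc_conj_unitary {A U : E →L[ℂ] E} (hA : IsSelfAdjoint A) (hU : star U * U = 1)
    (hU' : U * star U = 1) {f : ℝ → ℝ} (hf : Continuous f) :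
    cfc f (U * A * star U) = U * cfc f A * star U := by
  have h := cfc_intertwine (V := U) (hA.conjugate U) hA
    (by rw [mul_assoc, hU, mul_one]) hf
  rw [← h, mul_assoc _ U, hU', mul_one]

end Operators

end RHF

end

noncomputable section

namespace RHF

/-! ### The functional `Tr F(b, ·)` -/

section TraceF

variable {b : ℝ}

/-- This lemma and the next three restate results on a general Hilbert space for the instance of the
functional calculus that is registered for `L²(ℝ)`. -/
theorem cfc_apply_eigenvector_L2R {A : L2R →L[ℂ] L2R} (hA : IsSelfAdjoint A) {v : L2R} {a : ℝ}
    (hv : A v = (a : ℂ) • v) {f : ℝ → ℝ} (hf : Continuous f) : cfc f A v = (f a : ℂ) • v :=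
  cfc_apply_eigenvector hA hv hf

theorem cfc_add_smul_ketbra {A : L2R →L[ℂ] L2R} (hA : IsSelfAdjoint A) {e : L2R} (he : ‖e‖ = 1)
    {a : ℝ} (hAe : A e = (a : ℂ) • e) (s : ℝ) {f : ℝ → ℝ} (hf : Continuous f) :
    cfc f (A + s • ketbra e) = cfc f A + (f (a + s) - f a) • ketbra e :=
  cfc_add_smul_rankOne hA he hAe s hf

theorem cfc_conj_unitary_L2R {A U : L2R →L[ℂ] L2R} (hA : IsSelfAdjoint A) (hU : star U * U = 1)
    (hU' : U * star U = 1) {f : ℝ → ℝ} (hf : Continuous f) :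
    cfc f (U * A * star U) = U * cfc f A * star U :=
  cfc_conj_unitary hA hU hU' hf

theorem le_re_inner_cfc_L2R {A : L2R →L[ℂ] L2R} (hA : IsSelfAdjoint A) {e : L2R} (he : ‖e‖ = 1)
    {f : ℝ → ℝ} (hf : Continuous f) {c : ℝ}
    (hc : ∀ y, f (⟪e, A e⟫_ℂ).re + c * (y - (⟪e, A e⟫_ℂ).re) ≤ f y) :
    f (⟪e, A e⟫_ℂ).re ≤ (⟪e, cfc f A e⟫_ℂ).re :=
  le_re_inner_cfc hA he hf hc

theorem real_smul_apply (c : ℝ) (T : L2R →L[ℂ] L2R) (x : L2R) : (c • T) x = (c : ℂ) • T x :=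
  (Complex.coe_smul c (T x)).symm

theorem isPositive_cfc_F (b : ℝ) (A : L2R →L[ℂ] L2R) : (cfc (F b) A).IsPositive :=
  (ContinuousLinearMap.nonneg_iff_isPositive _).1 (cfc_nonneg fun x _ => F_nonneg b x)

theorem isCompactOperator_of_trace {A : L2R →L[ℂ] L2R} (hA : A.IsPositive) (ht : trace A ≠ ⊤) :
    IsCompactOperator A := by
  have hs : Summable fun i => ‖CFC.sqrt A (onb i)‖ ^ 2 := by
    rw [trace_of_decomposes (decomposes_sqrt hA onb)] at ht
    have := ENNReal.summable_toReal ht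
    simpa using this
  have h := isCompactOperator_of_summable onb (sqrt_isSelfAdjoint A) hs
  have e : (fun x => A x) = fun x => CFC.sqrt A (CFC.sqrt A x) :=
    funext fun x => (sqrt_sqrt_apply hA x).symm
  change IsCompactOperator (fun x => A x)
  rw [e]
  exact h.comp_clm (CFC.sqrt A)

theorem exists_eigenbasis {A R : L2R →L[ℂ] L2R} (hA : A.IsPositive) (ht : trace A ≠ ⊤)
    (hR : IsSelfAdjoint R) (hAR : Commute A R) :
    ∃ (ι : Type) (e : HilbertBasis ι ℂ L2R) (g r : ι → ℝ), (∀ i, A (e i) = (g i : ℂ) • e i) ∧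
      (∀ i, 0 ≤ g i) ∧ ∀ i, g i ≠ 0 → R (e i) = (r i : ℂ) • e i := by
  obtain ⟨ι, e, g, r, h1, h2⟩ := exists_joint_eigenbasis hA.isSelfAdjoint
    (isCompactOperator_of_trace hA ht) hR hAR
  refine ⟨ι, e, g, r, h1, fun i => ?_, h2⟩
  have h3 := hA.re_inner_nonneg_right (e i)
  rw [h1, inner_smul_right, inner_self_eq_norm_sq_to_K, e.orthonormal.1 i] at h3
  simpa using h3

theorem re_inner_le_trace {A : L2R →L[ℂ] L2R} (hA : A.IsPositive) (ht : trace A ≠ ⊤) {e : L2R}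
    (he : ‖e‖ = 1) : (⟪e, A e⟫_ℂ).re ≤ (trace A).toReal := by
  refine (ENNReal.ofReal_le_iff_le_toReal ht).1 ?_
  rw [← decomposes_sqrt hA onb e, trace_of_decomposes (decomposes_sqrt hA onb)]
  refine ENNReal.tsum_le_tsum fun i => pow_le_pow_left' ((enorm_inner_le' _ _).trans ?_) 2
  rw [← ofReal_norm e, he, ENNReal.ofReal_one, mul_one]

/-- Monotonicity and Lipschitz continuity of `Tr F(b, ·)`: in an eigenbasis of `A`, Jensen's
inequality bounds the diagonal of `F(b, B)` from below. -/
theorem trace_cfc_F_le (hb : b ≠ 0) {A B C : L2R →L[ℂ] L2R} (hA : A.IsPositive)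
    (hB : B.IsPositive) (hC : C.IsPositive) (ht : trace A ≠ ⊤) (htB : trace B ≠ ⊤)
    (htC : trace C ≠ ⊤) (hle : A ≤ B + C) {m : ℝ} (hm : (trace B).toReal + (trace C).toReal ≤ m) :
    trace (cfc (F b) A) ≤
      trace (cfc (F b) B) + ENNReal.ofReal (2 * Real.pi * m + |b|) * trace C := by
  obtain ⟨ι, e, a, -, hAe, ha, -⟩ := exists_eigenbasis hA ht (.zero _) (Commute.zero_right A)
  have hm0 : 0 ≤ m := (add_nonneg ENNReal.toReal_nonneg ENNReal.toReal_nonneg).trans hm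
  have hL : 0 ≤ 2 * Real.pi * m + |b| := by positivity
  rw [trace_eq_tsum (isPositive_cfc_F b A) e, trace_eq_tsum (isPositive_cfc_F b B) e,
    trace_eq_tsum hC e, ← ENNReal.tsum_mul_left, ← ENNReal.tsum_add]
  refine ENNReal.tsum_le_tsum fun i => ?_
  have he := e.orthonormal.1 i
  have hee : ⟪e i, e i⟫_ℂ = 1 := by rw [inner_self_eq_norm_sq_to_K, he]; simp
  have hγ : 0 ≤ (⟪e i, C (e i)⟫_ℂ).re := hC.re_inner_nonneg_right _
  have hβ : 0 ≤ (⟪e i, B (e i)⟫_ℂ).re := hB.re_inner_nonneg_right _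
  have hJ := le_re_inner_cfc_L2R hB.isSelfAdjoint he (continuous_F hb)
    (F_add_slope_le hb (⟪e i, B (e i)⟫_ℂ).re)
  have h1 : (⟪e i, A (e i)⟫_ℂ).re ≤ (⟪e i, B (e i)⟫_ℂ).re + (⟪e i, C (e i)⟫_ℂ).re := by
    have := re_inner_le_of_le hle (e i)
    rwa [add_apply, inner_add_right, Complex.add_re] at this
  rw [hAe, inner_smul_right, hee, mul_one, Complex.ofReal_re] at h1
  rw [cfc_apply_eigenvector_L2R hA.isSelfAdjoint (hAe i) (continuous_F hb), inner_smul_right, hee,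
    mul_one, Complex.ofReal_re, ← ENNReal.ofReal_mul hL,
    ← ENNReal.ofReal_add ((F_nonneg _ _).trans hJ) (mul_nonneg hL hγ)]
  refine ENNReal.ofReal_le_ofReal ?_
  have h2 := F_mono hb (ha i) h1
  have h3 := F_sub_le hb (le_add_of_nonneg_right hγ)
    ((add_le_add (re_inner_le_trace hB htB he) (re_inner_le_trace hC htC he)).trans hm)
  rw [add_sub_cancel_left] at h3
  linarith

theorem trace_zero : trace (0 : L2R →L[ℂ] L2R) = 0 := by simp [trace]

theorem trace_cfc_F_ne_top (hb : b ≠ 0) {A : L2R →L[ℂ] L2R} (hA : A.IsPositive)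
    (ht : trace A ≠ ⊤) : trace (cfc (F b) A) ≠ ⊤ := by
  have h := trace_cfc_F_le hb hA ContinuousLinearMap.isPositive_zero hA ht (by simp [trace_zero]) ht
    (by rw [zero_add]) le_rfl
  have h0 : cfc (F b) (0 : L2R →L[ℂ] L2R) = 0 := by
    rw [cfc_apply_zero, F_zero, map_zero]
  rw [h0, trace_zero, zero_add] at h
  exact ne_top_of_le_ne_top (ENNReal.mul_ne_top ENNReal.ofReal_ne_top ht) h

theorem smul_ketbra {c : ℝ} (hc : 0 ≤ c) (v : L2R) :
    c • ketbra v = ketbra (((Real.sqrt c : ℝ) : ℂ) • v) := by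
  ext1 x
  rw [real_smul_apply, InnerProductSpace.rankOne_apply, InnerProductSpace.rankOne_apply,
    inner_smul_left, smul_smul, Complex.conj_ofReal, smul_smul]
  congr 1
  have := Real.mul_self_sqrt hc
  rw [mul_right_comm, ← Complex.ofReal_mul, this]

theorem trace_smul_ketbra {c : ℝ} (hc : 0 ≤ c) (v : L2R) :
    trace (c • ketbra v) = ENNReal.ofReal (c * ‖v‖ ^ 2) := by
  rw [smul_ketbra hc, trace_ketbra, enorm_sq_eq_ofReal, norm_smul, mul_pow, Complex.norm_real,
    Real.norm_eq_abs, sq_abs, Real.sq_sqrt hc]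

theorem smul_ketbra_isPositive {c : ℝ} (hc : 0 ≤ c) (v : L2R) : (c • ketbra v).IsPositive := by
  rw [smul_ketbra hc]
  exact ketbra_isPositive _

theorem trace_cfc_F_add_smul_ketbra (hb : b ≠ 0) {A : L2R →L[ℂ] L2R} (hA : A.IsPositive)
    {e : L2R} (he : ‖e‖ = 1) {a : ℝ} (hAe : A e = (a : ℂ) • e) (s : ℝ) :
    trace (cfc (F b) (A + s • ketbra e)) + ENNReal.ofReal (F b a)
      = trace (cfc (F b) A) + ENNReal.ofReal (F b (a + s)) := by
  have h := cfc_add_smul_ketbra hA.isSelfAdjoint he hAe s (continuous_F hb)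
  have h1 : cfc (F b) (A + s • ketbra e) + F b a • ketbra e
      = cfc (F b) A + F b (a + s) • ketbra e := by
    rw [h, sub_smul]
    abel
  have h2 : ∀ c, 0 ≤ c → trace (c • ketbra e) = ENNReal.ofReal c := fun c hc => by
    rw [trace_smul_ketbra hc, he, one_pow, mul_one]
  rw [← h2 _ (F_nonneg b a), ← h2 _ (F_nonneg b (a + s)),
    ← trace_add (isPositive_cfc_F b _) (smul_ketbra_isPositive (F_nonneg b a) e), h1,
    trace_add (isPositive_cfc_F b _) (smul_ketbra_isPositive (F_nonneg b _) e)]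

theorem trace_conj_unitary {A U : L2R →L[ℂ] L2R} (hA : A.IsPositive) (hU : star U * U = 1) :
    trace (U * A * star U) = trace A := by
  have h1 : Decomposes (fun i => U (CFC.sqrt A (onb i))) (U * A * star U) := by
    intro ξ
    have h := decomposes_sqrt hA onb (star U ξ)
    rw [ContinuousLinearMap.star_eq_adjoint] at h ⊢
    rw [ContinuousLinearMap.adjoint_inner_left] at h
    simp_rw [ContinuousLinearMap.adjoint_inner_right] at h
    exact h
  have h2 : ∀ x, ‖U x‖ₑ = ‖x‖ₑ := by
    intro x
    have h3 : star U (U x) = x := congrArg (fun T : L2R →L[ℂ] L2R => T x) hU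
    have h4 : ‖U x‖ ^ 2 = ‖x‖ ^ 2 := by
      rw [@norm_sq_eq_re_inner ℂ, @norm_sq_eq_re_inner ℂ, ← ContinuousLinearMap.adjoint_inner_left,
        ← ContinuousLinearMap.star_eq_adjoint, h3]
    rw [← ofReal_norm, ← ofReal_norm, (sq_eq_sq₀ (norm_nonneg _) (norm_nonneg _)).1 h4]
  rw [trace_of_decomposes h1, trace_of_decomposes (decomposes_sqrt hA onb)]
  exact tsum_congr fun i => by rw [h2]

theorem trace_cfc_F_conj_unitary (hb : b ≠ 0) {A U : L2R →L[ℂ] L2R} (hA : A.IsPositive)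
    (hU : star U * U = 1) (hU' : U * star U = 1) :
    trace (cfc (F b) (U * A * star U)) = trace (cfc (F b) A) := by
  rw [cfc_conj_unitary_L2R hA.isSelfAdjoint hU hU' (continuous_F hb),
    trace_conj_unitary (isPositive_cfc_F b A) hU]

end TraceF

end RHF

end

noncomputable section

namespace RHF

/-! ### An admissible state of finite energy -/

section FiniteEnergy

open Real (sigmoid)

/-- The weak derivative of a continuously varying square integrable function agrees with its
classical derivative, if the latter is square integrable. -/
theorem isWeakDeriv_toLp {p p' : ℝ → ℂ} (hp : MemLp p 2) (hp' : MemLp p' 2)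
    (hd : ∀ x, HasDerivAt p (p' x) x) : IsWeakDeriv (hp.toLp p) (hp'.toLp p') := by
  intro φ hφ
  have e1 : ∫ x, deriv φ x • (hp.toLp p) x = ∫ x, p x * (((deriv φ : ℝ → ℝ) x : ℝ) : ℂ) := by
    refine integral_congr_ae ?_
    filter_upwards [hp.coeFn_toLp] with x hx
    rw [hx, Complex.real_smul, mul_comm]
  have e2 : ∫ x, φ x • (hp'.toLp p') x = ∫ x, p' x * (φ x : ℂ) := by
    refine integral_congr_ae ?_
    filter_upwards [hp'.coeFn_toLp] with x hx
    rw [hx, Complex.real_smul, mul_comm]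
  have i1 : ∀ (η : ℝ → ℝ), IsTestFunction η → ∀ q : ℝ → ℂ, MemLp q 2 →
      Integrable fun x => q x * (η x : ℂ) := by
    intro η hη q hq
    refine (integrable_test_smul hη.1.continuous hη.2
      (hq.locallyIntegrable (by norm_num))).congr (ae_of_all _ fun x => ?_)
    simp only [Complex.real_smul, mul_comm]
  rw [e1, e2]
  exact integral_mul_deriv_eq_deriv_mul_of_integrable (fun x _ => hd x)
    (fun x _ => (hφ.1.differentiable (by simp) x).hasDerivAt.ofReal_comp)
    (i1 _ hφ.deriv p hp) (i1 _ hφ p' hp') (i1 _ hφ p hp)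

theorem hartree_congr {f g : ℝ → ℝ} (h : f =ᵐ[volume] g) : hartree f = hartree g := by
  have e : primitive f = primitive g := by
    funext x
    exact integral_congr_ae (ae_restrict_of_ae h)
  unfold hartree
  rw [e, integrable_congr h]

theorem sigmoid_neg_abs_le (t : ℝ) : sigmoid (-|t|) ≤ 2 * (1 + t ^ 2)⁻¹ := by
  have h1 : sigmoid (-|t|) ≤ Real.exp (-|t|) := by
    rw [← Real.sigmoid_mul_rexp_neg]
    exact mul_le_of_le_one_left (Real.exp_pos _).le (Real.sigmoid_le_one _)
  have h2 := Real.quadratic_le_exp_of_nonneg (abs_nonneg t)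
  rw [sq_abs] at h2
  refine h1.trans ?_
  rw [Real.exp_neg, ← div_eq_mul_inv, inv_eq_one_div, div_le_div_iff₀ (Real.exp_pos _) (by positivity)]
  nlinarith [abs_nonneg t]

theorem integrable_sigmoid_neg_abs : Integrable fun t : ℝ => sigmoid (-|t|) :=
  (integrable_inv_one_add_sq.const_mul 2).mono'
    (continuous_abs.neg.sigmoid).aestronglyMeasurable
    (ae_of_all _ fun t => by
      rw [Real.norm_of_nonneg (Real.sigmoid_nonneg _)]
      exact sigmoid_neg_abs_le t)

/-- The derivative of the logistic function. -/
def bump (t : ℝ) : ℝ := sigmoid t * (1 - sigmoid t)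

theorem bump_nonneg (t : ℝ) : 0 ≤ bump t :=
  mul_nonneg (Real.sigmoid_nonneg t) (sub_nonneg.2 (Real.sigmoid_le_one t))

theorem bump_pos (t : ℝ) : 0 < bump t :=
  mul_pos (Real.sigmoid_pos t) (sub_pos.2 (Real.sigmoid_lt_one t))

theorem bump_le_one (t : ℝ) : bump t ≤ 1 :=
  mul_le_one₀ (Real.sigmoid_le_one t) (sub_nonneg.2 (Real.sigmoid_le_one t))
    (sub_le_self _ (Real.sigmoid_nonneg t))

theorem bump_le (t : ℝ) : bump t ≤ sigmoid (-|t|) := by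
  rcases le_total 0 t with h | h
  · rw [abs_of_nonneg h, Real.sigmoid_neg]
    exact mul_le_of_le_one_left (sub_nonneg.2 (Real.sigmoid_le_one t)) (Real.sigmoid_le_one t)
  · rw [abs_of_nonpos h, neg_neg]
    exact mul_le_of_le_one_right (Real.sigmoid_nonneg t) (sub_le_self _ (Real.sigmoid_nonneg t))

theorem continuous_bump : Continuous bump :=
  continuous_sigmoid.mul (continuous_const.sub continuous_sigmoid)

theorem integrable_bump : Integrable bump :=
  integrable_sigmoid_neg_abs.mono' continuous_bump.aestronglyMeasurable
    (ae_of_all _ fun t => by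
      rw [Real.norm_of_nonneg (bump_nonneg t)]
      exact bump_le t)

theorem hasDerivAt_bump (t : ℝ) : HasDerivAt bump (bump t * (1 - 2 * sigmoid t)) t := by
  have h := (Real.hasDerivAt_sigmoid t).mul ((Real.hasDerivAt_sigmoid t).const_sub 1)
  refine h.congr_deriv ?_
  simp only [bump]
  ring

theorem abs_bump_deriv_le (t : ℝ) : |bump t * (1 - 2 * sigmoid t)| ≤ bump t := by
  rw [abs_mul, abs_of_nonneg (bump_nonneg t)]
  refine mul_le_of_le_one_right (bump_nonneg t) (abs_le.2 ⟨?_, ?_⟩)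
  · linarith [Real.sigmoid_le_one t]
  · linarith [Real.sigmoid_nonneg t]

variable {μ : ℝ → ℝ}

theorem hasDerivAt_integral_comp_sub_mul (hμ : Integrable μ) {f f' : ℝ → ℝ} (hf : Continuous f)
    (hf' : Continuous f') (hf1 : ∀ t, |f t| ≤ 1) (hf1' : ∀ t, |f' t| ≤ 1)
    (hd : ∀ t, HasDerivAt f (f' t) t) (x : ℝ) :
    HasDerivAt (fun x => ∫ y, f (x - y) * μ y) (∫ y, f' (x - y) * μ y) x := by
  have hm : ∀ {g : ℝ → ℝ}, Continuous g → ∀ x, AEStronglyMeasurable (fun y => g (x - y) * μ y) := by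
    intro g hg x
    exact (hg.comp (by fun_prop)).aestronglyMeasurable.mul hμ.1
  refine (hasDerivAt_integral_of_dominated_loc_of_deriv_le (s := Set.univ) (bound := fun y => |μ y|)
    univ_mem (Eventually.of_forall (hm hf)) ?_ (F' := fun x y => f' (x - y) * μ y) (hm hf' x)
    (ae_of_all _ fun y x _ => ?_) hμ.abs (ae_of_all _ fun y x _ => ?_)).2
  · refine hμ.abs.mono' (hm hf x) (ae_of_all _ fun y => ?_)
    rw [Real.norm_eq_abs, abs_mul]
    exact mul_le_of_le_one_left (abs_nonneg _) (hf1 _)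
  · rw [Real.norm_eq_abs, abs_mul]
    exact mul_le_of_le_one_left (abs_nonneg _) (hf1' _)
  · have := ((hd (x - y)).comp x ((hasDerivAt_id x).sub_const y)).mul_const (μ y)
    simpa using this

/-- The density of the trial state: a smooth mollification of the background `μ`. -/
def smear (μ : ℝ → ℝ) (x : ℝ) : ℝ := ∫ y, bump (x - y) * μ y

theorem integrable_comp_sub_mul (hμ : Integrable μ) {f : ℝ → ℝ} (hf : Continuous f)
    (hf1 : ∀ t, |f t| ≤ 1) (x : ℝ) : Integrable fun y => f (x - y) * μ y := by
  refine hμ.abs.mono' ((hf.comp (by fun_prop)).aestronglyMeasurable.mul hμ.1)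
    (ae_of_all _ fun y => ?_)
  rw [Real.norm_eq_abs, abs_mul]
  exact mul_le_of_le_one_left (abs_nonneg _) (hf1 _)

theorem integrable_integral_comp_sub_mul (hμ : Integrable μ) {f : ℝ → ℝ} (hf : Integrable f) :
    Integrable fun x => ∫ y, f (x - y) * μ y := by
  have h := hμ.integrable_convolution (ContinuousLinearMap.mul ℝ ℝ) hf
  refine h.congr (ae_of_all _ fun x => ?_)
  simp only [convolution_def, ContinuousLinearMap.mul_apply', mul_comm]

theorem smear_nonneg (hμ0 : ∀ᵐ x, 0 ≤ μ x) (x : ℝ) : 0 ≤ smear μ x :=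
  integral_nonneg_of_ae (by
    filter_upwards [hμ0] with y hy
    exact mul_nonneg (bump_nonneg _) hy)

theorem abs_bump_le_one (t : ℝ) : |bump t| ≤ 1 := by
  rw [abs_of_nonneg (bump_nonneg t)]
  exact bump_le_one t

theorem integrable_smear (hμ : Integrable μ) : Integrable (smear μ) :=
  integrable_integral_comp_sub_mul hμ integrable_bump

theorem hasDerivAt_smear (hμ : Integrable μ) (x : ℝ) :
    HasDerivAt (smear μ) (∫ y, bump (x - y) * (1 - 2 * sigmoid (x - y)) * μ y) x :=
  hasDerivAt_integral_comp_sub_mul hμ continuous_bump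
    (continuous_bump.mul (continuous_const.sub (continuous_const.mul continuous_sigmoid)))
    abs_bump_le_one (fun t => (abs_bump_deriv_le t).trans (bump_le_one t)) hasDerivAt_bump x

theorem abs_deriv_smear_le (hμ : Integrable μ) (hμ0 : ∀ᵐ x, 0 ≤ μ x) (x : ℝ) :
    |deriv (smear μ) x| ≤ smear μ x := by
  rw [(hasDerivAt_smear hμ x).deriv]
  refine (abs_integral_le_integral_abs).trans (integral_mono_of_nonneg
    (ae_of_all _ fun _ => abs_nonneg _)
    (integrable_comp_sub_mul hμ continuous_bump abs_bump_le_one x) ?_)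
  filter_upwards [hμ0] with y hy
  rw [abs_mul, abs_of_nonneg hy]
  exact mul_le_mul_of_nonneg_right (abs_bump_deriv_le _) hy

theorem smear_eq_zero (hμ : Integrable μ) (hμ0 : ∀ᵐ x, 0 ≤ μ x) {x : ℝ} (h : smear μ x = 0) :
    smear μ = 0 := by
  have h1 : (fun y => bump (x - y) * μ y) =ᵐ[volume] 0 := by
    rw [← integral_eq_zero_iff_of_nonneg_ae ?_
      (integrable_comp_sub_mul hμ continuous_bump abs_bump_le_one x)]
    · exact h
    · filter_upwards [hμ0] with y hy
      exact mul_nonneg (bump_nonneg _) hy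
  funext z
  refine integral_eq_zero_of_ae ?_
  filter_upwards [h1] with y hy
  have : μ y = 0 := (mul_eq_zero.1 hy).resolve_left (bump_pos _).ne'
  simp [this]

theorem hasDerivAt_sqrt_smear (hμ : Integrable μ) (hμ0 : ∀ᵐ x, 0 ≤ μ x) (x : ℝ) :
    HasDerivAt (fun x => √(smear μ x)) (deriv (smear μ) x / (2 * √(smear μ x))) x := by
  rcases eq_or_ne (smear μ x) 0 with h | h
  · rw [smear_eq_zero hμ hμ0 h]
    simpa using hasDerivAt_const x (0 : ℝ)
  · rw [(hasDerivAt_smear hμ x).deriv]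
    exact (hasDerivAt_smear hμ x).sqrt h

theorem hasDerivAt_integral_sigmoid (hμ : Integrable μ) (x : ℝ) :
    HasDerivAt (fun x => ∫ y, sigmoid (x - y) * μ y) (smear μ x) x :=
  hasDerivAt_integral_comp_sub_mul hμ continuous_sigmoid continuous_bump
    (fun t => by
      rw [abs_of_nonneg (Real.sigmoid_nonneg t)]
      exact Real.sigmoid_le_one t) abs_bump_le_one Real.hasDerivAt_sigmoid x

theorem tendsto_integral_sigmoid (hμ : Integrable μ) {l : Filter ℝ} [l.IsCountablyGenerated] {c : ℝ}
    (h : ∀ y : ℝ, Tendsto (fun x => sigmoid (x - y)) l (𝓝 c)) :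
    Tendsto (fun x => ∫ y, sigmoid (x - y) * μ y) l (𝓝 (∫ y, c * μ y)) := by
  refine tendsto_integral_filter_of_dominated_convergence (fun y => |μ y|) ?_ ?_ hμ.abs ?_
  · exact Eventually.of_forall fun x =>
      ((continuous_sigmoid.comp (by fun_prop)).aestronglyMeasurable.mul hμ.1)
  · refine Eventually.of_forall fun x => ae_of_all _ fun y => ?_
    rw [Real.norm_eq_abs, abs_mul, abs_of_nonneg (Real.sigmoid_nonneg _)]
    exact mul_le_of_le_one_left (abs_nonneg _) (Real.sigmoid_le_one _)
  · exact ae_of_all _ fun y => (h y).mul_const _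

theorem primitive_smear (hμ : Integrable μ) (x : ℝ) :
    primitive (smear μ) x = ∫ y, sigmoid (x - y) * μ y := by
  have h := integral_Iic_of_hasDerivAt_of_tendsto' (a := x)
    (fun x _ => hasDerivAt_integral_sigmoid hμ x) (integrable_smear hμ).integrableOn
    (tendsto_integral_sigmoid hμ (c := 0) fun y =>
      Real.tendsto_sigmoid_atBot.comp (tendsto_atBot_add_const_right _ (-y) tendsto_id))
  simp only [zero_mul, integral_zero, sub_zero] at h
  exact h

theorem integral_smear (hμ : Integrable μ) : ∫ x, smear μ x = ∫ x, μ x := by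
  have h := integral_of_hasDerivAt_of_tendsto (fun x => hasDerivAt_integral_sigmoid hμ x)
    (integrable_smear hμ) (tendsto_integral_sigmoid hμ (c := 0) fun y =>
      Real.tendsto_sigmoid_atBot.comp (tendsto_atBot_add_const_right _ (-y) tendsto_id))
    (tendsto_integral_sigmoid hμ (c := 1) fun y =>
      Real.tendsto_sigmoid_atTop.comp (tendsto_atTop_add_const_right _ (-y) tendsto_id))
  simpa using h

/-- The primitive of `bump ⋆ μ - μ` is the convolution of `μ` with the difference of the logistic and
the Heaviside function, which decays exponentially. -/
theorem abs_primitive_smear_sub_le (hμ : Integrable μ) (x : ℝ) :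
    |primitive (fun t => smear μ t - μ t) x| ≤ ∫ y, sigmoid (-|x - y|) * |μ y| := by
  have h1 : primitive (fun t => smear μ t - μ t) x
      = ∫ y, (sigmoid (x - y) * μ y - (Set.Iic x).indicator μ y) := by
    have e : primitive (fun t => smear μ t - μ t) x = primitive (smear μ) x - primitive μ x :=
      integral_sub (integrable_smear hμ).integrableOn hμ.integrableOn
    rw [e, primitive_smear hμ, primitive, ← integral_indicator measurableSet_Iic, integral_sub]
    · exact integrable_comp_sub_mul hμ continuous_sigmoid (fun t => by
        rw [abs_of_nonneg (Real.sigmoid_nonneg t)]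
        exact Real.sigmoid_le_one t) x
    · exact hμ.indicator measurableSet_Iic
  rw [h1]
  refine abs_integral_le_integral_abs.trans (integral_mono_of_nonneg
    (ae_of_all _ fun _ => abs_nonneg _) (integrable_comp_sub_mul hμ.abs (f := fun t => sigmoid (-|t|))
      continuous_abs.neg.sigmoid (fun t => by
        rw [abs_of_nonneg (Real.sigmoid_nonneg _)]
        exact Real.sigmoid_le_one _) x) (ae_of_all _ fun y => ?_))
  by_cases hy : y ≤ x
  · have h2 : (Set.Iic x).indicator μ y = μ y := Set.indicator_of_mem (Set.mem_Iic.2 hy) _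
    simp only [h2, abs_of_nonneg (sub_nonneg.2 hy), Real.sigmoid_neg]
    rw [← sub_one_mul, abs_mul, abs_sub_comm, abs_of_nonneg (sub_nonneg.2 (Real.sigmoid_le_one _))]
  · have h2 : (Set.Iic x).indicator μ y = 0 := Set.indicator_of_notMem (by simpa using hy) _
    simp only [h2, abs_of_nonpos (sub_nonpos.2 (not_le.1 hy).le), neg_neg, sub_zero]
    rw [abs_mul, abs_of_nonneg (Real.sigmoid_nonneg _)]

theorem hartree_smear_ne_top (hμ : Integrable μ) : hartree (fun x => smear μ x - μ x) ≠ ⊤ := by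
  have hi : Integrable fun x => smear μ x - μ x := (integrable_smear hμ).sub hμ
  rw [hartree, if_pos hi]
  refine ENNReal.mul_ne_top ENNReal.ofReal_ne_top ?_
  set k : ℝ → ℝ := fun x => ∫ y, sigmoid (-|x - y|) * |μ y|
  have hk : Integrable k := integrable_integral_comp_sub_mul (μ := fun y => |μ y|) hμ.abs
    integrable_sigmoid_neg_abs
  have hkb : ∀ x, k x ≤ ∫ y, |μ y| := fun x =>
    integral_mono_of_nonneg (ae_of_all _ fun y => mul_nonneg (Real.sigmoid_nonneg _) (abs_nonneg _))
      hμ.abs (ae_of_all _ fun y => mul_le_of_le_one_left (abs_nonneg _) (Real.sigmoid_le_one _))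
  have hle : ∀ x, ‖primitive (fun t => smear μ t - μ t) x‖ₑ ^ 2
      ≤ ENNReal.ofReal (k x * ∫ y, |μ y|) := by
    intro x
    rw [enorm_sq_eq_ofReal, Real.norm_eq_abs]
    refine ENNReal.ofReal_le_ofReal ?_
    have h := abs_primitive_smear_sub_le hμ x
    rw [sq]
    exact mul_le_mul h (h.trans (hkb x)) (abs_nonneg _) ((abs_nonneg _).trans h)
  refine ne_top_of_le_ne_top ?_ (lintegral_mono hle)
  have := (hk.mul_const (∫ y, |μ y|)).lintegral_lt_top
  exact this.ne

/-- The energy is finite on the rank one state `|√ρ⟩⟨√ρ|`, where `ρ` is a mollification of `μ`. -/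
theorem exists_admissible_energy_ne_top {b : ℝ} (hb : b ≠ 0) (hμ : Integrable μ)
    (hμ0 : ∀ᵐ x, 0 ≤ μ x) : ∃ G ∈ admissible (∫ x, μ x), energy b μ G ≠ ⊤ := by
  set p : ℝ → ℂ := fun x => ((√(smear μ x) : ℝ) : ℂ)
  set p' : ℝ → ℂ := fun x => ((deriv (smear μ) x / (2 * √(smear μ x)) : ℝ) : ℂ)
  have hsc : Continuous (smear μ) :=
    continuous_iff_continuousAt.2 fun x => (hasDerivAt_smear hμ x).continuousAt
  have hnorm : ∀ x, ‖p x‖ ^ 2 = smear μ x := fun x => by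
    rw [Complex.norm_real, Real.norm_eq_abs, sq_abs, Real.sq_sqrt (smear_nonneg hμ0 x)]
  have hp : MemLp p 2 := by
    have hpm : AEStronglyMeasurable p :=
      (Complex.continuous_ofReal.comp hsc.sqrt).aestronglyMeasurable
    rw [memLp_two_iff_integrable_sq_norm hpm]
    exact (integrable_smear hμ).congr (ae_of_all _ fun x => (hnorm x).symm)
  have hp'm : AEStronglyMeasurable p' := by
    have : Measurable p' := Complex.measurable_ofReal.comp
      ((measurable_deriv _).div (hsc.sqrt.measurable.const_mul 2))
    exact this.aestronglyMeasurable
  have hp' : MemLp p' 2 := by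
    refine hp.mono hp'm (ae_of_all _ fun x => ?_)
    have hs := smear_nonneg hμ0 x
    rw [Complex.norm_real, Complex.norm_real, Real.norm_eq_abs, Real.norm_eq_abs, abs_div,
      abs_of_nonneg (Real.sqrt_nonneg _), abs_mul, abs_of_nonneg (Real.sqrt_nonneg _), abs_two]
    rcases hs.eq_or_lt with h0 | h0
    · simp [← h0]
    · have h1 := abs_deriv_smear_le hμ hμ0 x
      have h2 : 0 < √(smear μ x) := Real.sqrt_pos.2 h0
      rw [div_le_iff₀ (by positivity)]
      nlinarith [Real.mul_self_sqrt hs]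
  have hd : IsWeakDeriv (hp.toLp p) (hp'.toLp p') :=
    isWeakDeriv_toLp hp hp' fun x => (hasDerivAt_sqrt_smear hμ hμ0 x).ofReal_comp
  have htr : trace (ketbra (hp.toLp p)) = ENNReal.ofReal (∫ x, μ x) := by
    rw [trace_ketbra, ← lintegral_enorm_sq, ← integral_smear hμ,
      ofReal_integral_eq_lintegral_ofReal (integrable_smear hμ) (ae_of_all _ (smear_nonneg hμ0))]
    refine lintegral_congr_ae ?_
    filter_upwards [hp.coeFn_toLp] with x hx
    rw [hx, enorm_sq_eq_ofReal, hnorm]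
  refine ⟨ketbra (hp.toLp p), ⟨ketbra_isPositive _, htr⟩, ?_⟩
  have hden : (fun x => density (ketbra (hp.toLp p)) x - μ x)
      =ᵐ[volume] fun x => smear μ x - μ x := by
    filter_upwards [density_ketbra (hp.toLp p), hp.coeFn_toLp] with x h1 h2
    rw [h1, h2, hnorm]
  rw [energy, hartree_congr hden, traceNegLaplacian_ketbra, dirichlet_eq hd]
  refine ENNReal.add_ne_top.2 ⟨ENNReal.add_ne_top.2 ⟨?_, ?_⟩, ?_⟩
  · exact ENNReal.mul_ne_top (by simp) (ENNReal.pow_ne_top enorm_ne_top)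
  · exact trace_cfc_F_ne_top hb (ketbra_isPositive _) (by rw [htr]; exact ENNReal.ofReal_ne_top)
  · exact ENNReal.mul_ne_top (by simp) (hartree_smear_ne_top hμ)

variable {b : ℝ} {G : L2R →L[ℂ] L2R}

theorem IsMinimizer.isPositive (hG : IsMinimizer b μ G) : G.IsPositive := hG.1.1

theorem IsMinimizer.trace_ne_top (hG : IsMinimizer b μ G) : trace G ≠ ⊤ := by
  rw [hG.1.2]
  exact ENNReal.ofReal_ne_top

theorem IsMinimizer.energy_ne_top (hG : IsMinimizer b μ G) (hb : b ≠ 0) (hμ : Integrable μ)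
    (hμ0 : ∀ᵐ x, 0 ≤ μ x) : energy b μ G ≠ ⊤ := by
  obtain ⟨G', h, h'⟩ := exists_admissible_energy_ne_top hb hμ hμ0
  exact ne_top_of_le_ne_top h' (hG.2 G' h)

theorem IsMinimizer.traceNegLaplacian_ne_top (hG : IsMinimizer b μ G) (hb : b ≠ 0)
    (hμ : Integrable μ) (hμ0 : ∀ᵐ x, 0 ≤ μ x) : traceNegLaplacian G ≠ ⊤ := by
  intro h
  refine hG.energy_ne_top hb hμ hμ0 ?_
  rw [energy, h, ENNReal.mul_top (by simp)]
  simp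

theorem IsMinimizer.hartree_ne_top (hG : IsMinimizer b μ G) (hb : b ≠ 0) (hμ : Integrable μ)
    (hμ0 : ∀ᵐ x, 0 ≤ μ x) : hartree (fun x => density G x - μ x) ≠ ⊤ := by
  intro h
  refine hG.energy_ne_top hb hμ hμ0 ?_
  rw [energy, h, ENNReal.mul_top (by simp)]
  simp

end FiniteEnergy

end RHF

end

noncomputable section

namespace RHF

/-! ### The mean-field potential -/

section Potential

variable {f : ℝ → ℝ}

theorem primitive_sub_primitive (hf : Integrable f) (x y : ℝ) :
    primitive f y - primitive f x = ∫ t in x..y, f t :=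
  intervalIntegral.integral_Iic_sub_Iic hf.integrableOn hf.integrableOn

theorem primitive_eq (hf : Integrable f) : primitive f = fun x => primitive f 0 + ∫ t in 0..x, f t := by
  funext x
  rw [← primitive_sub_primitive hf]
  ring

theorem continuous_primitive (hf : Integrable f) : Continuous (primitive f) := by
  rw [primitive_eq hf]
  exact continuous_const.add (intervalIntegral.continuous_primitive
    (fun a b => hf.intervalIntegrable) 0)

theorem absolutelyContinuous_primitive (hf : Integrable f) (x y : ℝ) :
    AbsolutelyContinuousOnInterval (primitive f) x y := by
  have h : primitive f = fun z => primitive f x + ∫ t in x..z, f t := by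
    funext z
    rw [← primitive_sub_primitive hf]
    ring
  rw [h]
  have hc : AbsolutelyContinuousOnInterval (fun _ : ℝ => primitive f x) x y :=
    (LipschitzWith.const (primitive f x)).lipschitzOnWith.absolutelyContinuousOnInterval
  exact hc.fun_add (hf.intervalIntegrable.absolutelyContinuousOnInterval_intervalIntegral (by simp))

theorem ae_hasDerivAt_primitive (hf : Integrable f) : ∀ᵐ x, HasDerivAt (primitive f) (f x) x := by
  filter_upwards [LocallyIntegrable.ae_hasDerivAt_integral hf.locallyIntegrable] with x hx
  rw [primitive_eq hf]
  exact (hx 0).const_add _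

theorem abs_primitive_le (hf : Integrable f) (x : ℝ) : |primitive f x| ≤ ∫ t, |f t| :=
  abs_integral_le_integral_abs.trans
    (setIntegral_le_integral hf.abs (ae_of_all _ fun _ => abs_nonneg _))

theorem tendsto_primitive_atBot (hf : Integrable f) : Tendsto (primitive f) atBot (𝓝 0) := by
  have h := tendsto_integral_filter_of_dominated_convergence (μ := volume) (l := atBot)
    (F := fun x : ℝ => (Set.Iic x).indicator f) (f := fun _ => (0 : ℝ)) (fun t => |f t|)
    (Eventually.of_forall fun x => (hf.indicator measurableSet_Iic).1)
    (Eventually.of_forall fun x => ae_of_all _ fun t => norm_indicator_le_norm_self f t) hf.abs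
    (ae_of_all _ fun t => tendsto_const_nhds.congr' (by
      filter_upwards [eventually_lt_atBot t] with x hx
      rw [Set.indicator_of_notMem (by simpa using hx)]))
  simp only [integral_indicator measurableSet_Iic, integral_zero] at h
  exact h

theorem tendsto_primitive_atTop (hf : Integrable f) :
    Tendsto (primitive f) atTop (𝓝 (∫ x, f x)) := by
  have h := tendsto_integral_filter_of_dominated_convergence (μ := volume) (l := atTop)
    (F := fun x : ℝ => (Set.Iic x).indicator f) (f := f) (fun t => |f t|)
    (Eventually.of_forall fun x => (hf.indicator measurableSet_Iic).1)
    (Eventually.of_forall fun x => ae_of_all _ fun t => norm_indicator_le_norm_self f t) hf.abs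
    (ae_of_all _ fun t => tendsto_const_nhds.congr' (by
      filter_upwards [eventually_ge_atTop t] with x hx
      rw [Set.indicator_of_mem (by simpa using hx)]))
  simp only [integral_indicator measurableSet_Iic] at h
  exact h

theorem integrable_of_hartree_ne_top (h : hartree f ≠ ⊤) : Integrable f := by
  by_contra hc
  exact h (by rw [hartree, if_neg hc])

theorem hartree_eq (hf : Integrable f) :
    hartree f = ENNReal.ofReal (4 * Real.pi) * ∫⁻ x, ‖primitive f x‖ₑ ^ 2 := by
  rw [hartree, if_pos hf]

theorem memLp_primitive (h : hartree f ≠ ⊤) : MemLp (primitive f) 2 := by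
  have hf := integrable_of_hartree_ne_top h
  refine ⟨(continuous_primitive hf).aestronglyMeasurable, ?_⟩
  rw [hartree_eq hf] at h
  have h1 : ∫⁻ x, ‖primitive f x‖ₑ ^ 2 ≠ ⊤ := fun h2 => by
    rw [h2, ENNReal.mul_top (by simp [Real.pi_pos])] at h
    exact h rfl
  rw [eLpNorm_lt_top_iff_lintegral_rpow_enorm_lt_top (by norm_num) (by norm_num)]
  simpa using lt_top_iff_ne_top.2 h1

theorem eq_zero_of_integrable_of_tendsto {g : ℝ → ℝ} {c : ℝ} (hg : Integrable g)
    (h : Tendsto g atTop (𝓝 c)) : c = 0 := by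
  by_contra hc
  have h1 : ∀ᶠ x in atTop, |c| / 2 < |g x| :=
    h.abs.eventually (lt_mem_nhds (half_lt_self (abs_pos.2 hc)))
  obtain ⟨a, ha⟩ := eventually_atTop.1 h1
  have h2 : IntegrableOn (fun _ : ℝ => |c| / 2) (Set.Ici a) :=
    hg.abs.integrableOn.mono' aestronglyMeasurable_const
      ((ae_restrict_iff' measurableSet_Ici).2 (ae_of_all _ fun x hx => by
        rw [Real.norm_of_nonneg (by positivity)]
        exact (ha x hx).le))
  rw [integrableOn_const_iff] at h2
  simp [hc] at h2

theorem integral_eq_zero_of_hartree_ne_top (h : hartree f ≠ ⊤) : ∫ x, f x = 0 := by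
  have h1 := (memLp_primitive h).integrable_sq
  have h2 := (tendsto_primitive_atTop (integrable_of_hartree_ne_top h)).pow 2
  exact pow_eq_zero_iff two_ne_zero |>.1 (eq_zero_of_integrable_of_tendsto h1 h2)

/-- The solution `Φ(x) = -4π ∫₀ˣ W_f` of `-Φ'' = 4π f`. -/
def meanField (f : ℝ → ℝ) (x : ℝ) : ℝ := -(4 * Real.pi) * ∫ t in 0..x, primitive f t

theorem hasDerivAt_meanField (hf : Integrable f) (x : ℝ) :
    HasDerivAt (meanField f) (-(4 * Real.pi) * primitive f x) x :=
  ((continuous_primitive hf).integral_hasStrictDerivAt 0 x).hasDerivAt.const_mul _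

theorem deriv_meanField (hf : Integrable f) :
    deriv (meanField f) = fun x => -(4 * Real.pi) * primitive f x :=
  funext fun x => (hasDerivAt_meanField hf x).deriv

theorem continuous_meanField (hf : Integrable f) : Continuous (meanField f) :=
  continuous_iff_continuousAt.2 fun x => (hasDerivAt_meanField hf x).continuousAt

theorem isMeanFieldPotential_meanField (h : hartree f ≠ ⊤) :
    IsMeanFieldPotential f (meanField f) := by
  have hf := integrable_of_hartree_ne_top h
  have hd := deriv_meanField hf
  refine ⟨fun x => (hasDerivAt_meanField hf x).differentiableAt, fun x y => ?_, ?_, ?_, ?_, ?_⟩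
  · rw [hd]
    exact (absolutelyContinuous_primitive hf x y).const_mul _
  · filter_upwards [ae_hasDerivAt_primitive hf] with x hx
    rw [hd, (hx.const_mul _).deriv]
    ring
  · rw [hd]
    simpa [integral_eq_zero_of_hartree_ne_top h] using
      (tendsto_primitive_atTop hf).const_mul (-(4 * Real.pi))
  · rw [hd]
    simpa using (tendsto_primitive_atBot hf).const_mul (-(4 * Real.pi))
  · simp [meanField]

theorem IsMeanFieldPotential.unique {Φ Ψ : ℝ → ℝ} (hΦ : IsMeanFieldPotential f Φ)
    (hΨ : IsMeanFieldPotential f Ψ) : Ψ = Φ := by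
  have h1 : ∀ x y, deriv Φ x - deriv Ψ x = deriv Φ y - deriv Ψ y := by
    intro x y
    have hac := (hΦ.absolutelyContinuous x y).sub (hΨ.absolutelyContinuous x y)
    obtain ⟨C, hC⟩ := hac.const_of_ae_hasDerivAt_zero (by
      filter_upwards [hΦ.equation, hΨ.equation,
        (hΦ.absolutelyContinuous x y).ae_differentiableAt,
        (hΨ.absolutelyContinuous x y).ae_differentiableAt] with z e1 e2 d1 d2 hz
      have := (d1 hz).hasDerivAt.sub (d2 hz).hasDerivAt
      refine this.congr_deriv ?_
      linarith)
    exact (hC x (by simp)).trans (hC y (by simp)).symm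
  have h2 : ∀ x, deriv Φ x - deriv Ψ x = 0 := by
    intro x
    have h3 := hΦ.deriv_atTop.sub hΨ.deriv_atTop
    have h4 : Tendsto (fun y => deriv Φ y - deriv Ψ y) atTop (𝓝 (deriv Φ x - deriv Ψ x)) :=
      tendsto_const_nhds.congr fun y => h1 x y
    simpa using tendsto_nhds_unique h4 h3
  funext x
  have h5 := is_const_of_deriv_eq_zero (hΨ.differentiable.sub hΦ.differentiable) (fun y => by
    rw [deriv_sub (hΨ.differentiable y) (hΦ.differentiable y)]
    linarith [h2 y]) x 0
  simp only [Pi.sub_apply, hΦ.zero, hΨ.zero] at h5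
  linarith

/-- The mean-field potential is Lipschitz continuous. -/
theorem exists_lipschitz_meanField (hf : Integrable f) :
    ∃ K, ∀ x y, |meanField f x - meanField f y| ≤ K * |x - y| := by
  refine ⟨4 * Real.pi * ∫ t, |f t|, fun x y => ?_⟩
  refine Convex.norm_image_sub_le_of_norm_hasDerivWithin_le (s := Set.univ) (f := meanField f)
    (fun z _ => (hasDerivAt_meanField hf z).hasDerivWithinAt) (fun z _ => ?_) convex_univ
    (Set.mem_univ y) (Set.mem_univ x)
  rw [norm_mul, norm_neg, Real.norm_of_nonneg (by positivity)]
  exact mul_le_mul_of_nonneg_left (abs_primitive_le hf z) (by positivity)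

section Variation

variable {κ : ℝ → ℝ} {N : ℝ}

theorem primitive_eq_zero_of_support (h0 : ∫ x, κ x = 0)
    (hs : ∀ᵐ x, N < |x| → κ x = 0) {x : ℝ} (hx : N ≤ |x|) : primitive κ x = 0 := by
  rcases le_total x 0 with h | h
  · rw [abs_of_nonpos h] at hx
    refine setIntegral_eq_zero_of_ae_eq_zero (t := Set.Iic x) ?_
    filter_upwards [hs, Measure.ae_ne volume x] with t ht htx hmem
    have : t < x := lt_of_le_of_ne hmem htx
    refine ht ?_
    rw [abs_of_neg (this.trans_le h)]
    linarith
  · rw [abs_of_nonneg h] at hx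
    rw [← h0]
    refine setIntegral_eq_integral_of_ae_compl_eq_zero ?_
    filter_upwards [hs] with t ht hmem
    have h1 : x < t := by simpa using hmem
    exact ht (hx.trans_lt (h1.trans_le (le_abs_self t)))

/-- Integration by parts in the interaction energy of `f` with a localised neutral perturbation. -/
theorem integral_primitive_mul_primitive (hf : Integrable f) (hκ : Integrable κ) (hN : 0 ≤ N)
    (h0 : ∫ x, κ x = 0) (hs : ∀ᵐ x, N < |x| → κ x = 0) :
    4 * Real.pi * ∫ x, primitive f x * primitive κ x = ∫ x, meanField f x * κ x := by
  have hNN : -N ≤ N := by linarith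
  have hout : ∀ (g q : ℝ → ℝ), (∀ᵐ x, N < |x| → q x = 0) →
      ∫ x, g x * q x = ∫ x in (-N)..N, g x * q x := by
    intro g q hq
    rw [intervalIntegral.integral_of_le hNN]
    refine (setIntegral_eq_integral_of_ae_compl_eq_zero ?_).symm
    filter_upwards [hq, Measure.ae_ne volume (-N)] with x hx hxN hmem
    rw [hx, mul_zero]
    rw [lt_abs]
    by_contra hc
    push Not at hc
    exact hmem ⟨lt_of_le_of_ne (by linarith) (Ne.symm hxN), hc.1⟩
  rw [hout _ _ (ae_of_all _ fun x hx => primitive_eq_zero_of_support h0 hs hx.le), hout _ _ hs]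
  obtain ⟨K, hK⟩ := exists_lipschitz_meanField hf
  have hΦ : AbsolutelyContinuousOnInterval (meanField f) (-N) N :=
    (LipschitzWith.of_dist_le_mul (K := K.toNNReal) fun x y => by
      rw [Real.dist_eq, Real.dist_eq]
      exact (hK x y).trans (mul_le_mul_of_nonneg_right (Real.le_coe_toNNReal K)
        (abs_nonneg _))).lipschitzOnWith.absolutelyContinuousOnInterval
  have h := hΦ.integral_mul_deriv_eq_deriv_mul (absolutelyContinuous_primitive hκ (-N) N)
  rw [primitive_eq_zero_of_support (x := N) h0 hs (le_abs_self N),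
    primitive_eq_zero_of_support (x := -N) h0 hs (by rw [abs_neg]; exact le_abs_self N)] at h
  have e : ∫ x in (-N)..N, meanField f x * deriv (primitive κ) x
      = ∫ x in (-N)..N, meanField f x * κ x := by
    refine intervalIntegral.integral_congr_ae ?_
    filter_upwards [ae_hasDerivAt_primitive hκ] with x hx _
    rw [hx.deriv]
  rw [← e, h, deriv_meanField hf, ← intervalIntegral.integral_const_mul]
  simp only [mul_zero, sub_zero, zero_sub, ← intervalIntegral.integral_neg]
  congr 1
  funext x
  ring

/-- Second order expansion of the Hartree energy in a localised neutral perturbation. -/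
theorem hartree_add_le (h : hartree f ≠ ⊤) (hκ : Integrable κ) (hN : 0 ≤ N)
    (h0 : ∫ x, κ x = 0) (hs : ∀ᵐ x, N < |x| → κ x = 0) :
    hartree (fun x => f x + κ x) ≠ ⊤ ∧
    (hartree (fun x => f x + κ x)).toReal ≤ (hartree f).toReal + 2 * (∫ x, meanField f x * κ x)
      + 8 * Real.pi * N * (∫ x, |κ x|) ^ 2 := by
  have hf := integrable_of_hartree_ne_top h
  have hfκ : Integrable fun x => f x + κ x := hf.add hκ
  have hW : primitive (fun x => f x + κ x) = fun x => primitive f x + primitive κ x := by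
    funext x
    exact integral_add hf.integrableOn hκ.integrableOn
  have hκs : ∀ x, N < |x| → primitive κ x = 0 := fun x hx =>
    primitive_eq_zero_of_support h0 hs hx.le
  have hcs : HasCompactSupport (primitive κ) :=
    HasCompactSupport.intro (K := Set.Icc (-N) N) isCompact_Icc fun x hx => hκs x (by
      rw [lt_abs]
      by_contra hc
      push Not at hc
      exact hx ⟨by linarith, hc.1⟩)
  have hκL : MemLp (primitive κ) 2 := (continuous_primitive hκ).memLp_of_hasCompactSupport hcs
  have hfL := memLp_primitive h
  have key : ∀ {g : ℝ → ℝ}, Integrable g → MemLp (primitive g) 2 →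
      hartree g = ENNReal.ofReal (4 * Real.pi * ∫ x, primitive g x ^ 2) := by
    intro g hg hgL
    rw [hartree_eq hg, ENNReal.ofReal_mul (p := 4 * Real.pi) (by positivity),
      ofReal_integral_eq_lintegral_ofReal hgL.integrable_sq (ae_of_all _ fun x => sq_nonneg _)]
    congr 1
    refine lintegral_congr fun x => ?_
    rw [enorm_sq_eq_ofReal, Real.norm_eq_abs, sq_abs]
  have hsum : MemLp (primitive fun x => f x + κ x) 2 := by
    rw [hW]
    exact hfL.add hκL
  have e1 := key hfκ hsum
  have e2 := key hf hfL
  refine ⟨by rw [e1]; exact ENNReal.ofReal_ne_top, ?_⟩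
  have hnn : ∀ g : ℝ → ℝ, 0 ≤ 4 * Real.pi * ∫ x, g x ^ 2 := fun g =>
    mul_nonneg (by positivity) (integral_nonneg fun x => sq_nonneg _)
  rw [e1, e2, ENNReal.toReal_ofReal (hnn _), ENNReal.toReal_ofReal (hnn _), hW,
    ← integral_primitive_mul_primitive hf hκ hN h0 hs]
  have hmul : Integrable fun x => primitive f x * primitive κ x := hfL.integrable_mul hκL
  have hex : ∫ x, (primitive f x + primitive κ x) ^ 2 = (∫ x, primitive f x ^ 2)
      + 2 * (∫ x, primitive f x * primitive κ x) + ∫ x, primitive κ x ^ 2 := by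
    have hi : Integrable fun x => primitive f x ^ 2 + 2 * (primitive f x * primitive κ x) :=
      hfL.integrable_sq.add (hmul.const_mul 2)
    rw [← integral_const_mul, ← integral_add hfL.integrable_sq (hmul.const_mul 2),
      ← integral_add hi hκL.integrable_sq]
    refine integral_congr_ae (ae_of_all _ fun x => ?_)
    ring
  have hlast : ∫ x, primitive κ x ^ 2 ≤ 2 * N * (∫ x, |κ x|) ^ 2 := by
    calc ∫ x, primitive κ x ^ 2
        ≤ ∫ x, (Set.Icc (-N) N).indicator (fun _ => (∫ x, |κ x|) ^ 2) x := by
          refine integral_mono hκL.integrable_sq ?_ fun x => ?_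
          · exact (integrable_indicator_iff measurableSet_Icc).2
              (integrableOn_const (by simp) (by simp))
          · by_cases hx : x ∈ Set.Icc (-N) N
            · simp only [Set.indicator_of_mem hx]
              exact sq_le_sq.2 ((abs_primitive_le hκ x).trans (le_abs_self _))
            · simp only [Set.indicator_of_notMem hx]
              rw [hκs x (by
                rw [lt_abs]
                by_contra hc
                push Not at hc
                exact hx ⟨by linarith, hc.1⟩)]
              simp
      _ = 2 * N * (∫ x, |κ x|) ^ 2 := by
          rw [integral_indicator measurableSet_Icc, setIntegral_const, smul_eq_mul,
            measureReal_def, Real.volume_Icc, ENNReal.toReal_ofReal (by linarith)]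
          ring
  rw [hex]
  nlinarith [Real.pi_pos]

end Variation

end Potential

end RHF

end

noncomputable section

namespace RHF

/-! ### Finite rank variations of a minimizer -/

section Variations

variable {b : ℝ} {μ : ℝ → ℝ} {G : L2R →L[ℂ] L2R}

theorem integrable_normSq (c : L2R) : Integrable fun x => ‖c x‖ ^ 2 :=
  (Lp.memLp c).integrable_norm_pow (by norm_num)

theorem integral_normSq (c : L2R) : ∫ x, ‖c x‖ ^ 2 = ‖c‖ ^ 2 := by
  rw [integral_eq_lintegral_of_nonneg_ae (ae_of_all _ fun x => by positivity)
    (integrable_normSq c).1]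
  have h := lintegral_enorm_sq c
  simp_rw [enorm_sq_eq_ofReal] at h
  rw [h, ENNReal.toReal_ofReal (by positivity)]

theorem trace_ketbra_eq_ofReal (c : L2R) : trace (ketbra c) = ENNReal.ofReal (‖c‖ ^ 2) := by
  rw [trace_ketbra, enorm_sq_eq_ofReal]

theorem trace_ketbra_ne_top (c : L2R) : trace (ketbra c) ≠ ⊤ := by
  rw [trace_ketbra_eq_ofReal]
  exact ENNReal.ofReal_ne_top

theorem traceNegLaplacian_ketbra_eq_ofReal {c c' : L2R} (h : IsWeakDeriv c c') :
    traceNegLaplacian (ketbra c) = ENNReal.ofReal (‖c'‖ ^ 2) := by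
  rw [traceNegLaplacian_ketbra, dirichlet_eq h, enorm_sq_eq_ofReal]

/-- The minimality of `G` tested against a state `G'` that differs from it by rank one operators
with a localised density. -/
theorem IsMinimizer.variation (hG : IsMinimizer b μ G) (hb : b ≠ 0) (hμ : Integrable μ)
    (hμ0 : ∀ᵐ x, 0 ≤ μ x) {G' : L2R →L[ℂ] L2R} (hG' : G'.IsPositive)
    {c₁ c₂ c₃ d c₁' c₂' c₃' d' : L2R}
    (hadd : G' + ketbra d = G + (ketbra c₁ + (ketbra c₂ + ketbra c₃)))
    (h₁ : IsWeakDeriv c₁ c₁') (h₂ : IsWeakDeriv c₂ c₂') (h₃ : IsWeakDeriv c₃ c₃')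
    (hd : IsWeakDeriv d d') (hnorm : ‖c₁‖ ^ 2 + (‖c₂‖ ^ 2 + ‖c₃‖ ^ 2) = ‖d‖ ^ 2)
    {N : ℝ} (hN : 0 ≤ N)
    (hs : ∀ᵐ x, N < |x| → ‖c₁ x‖ ^ 2 + (‖c₂ x‖ ^ 2 + ‖c₃ x‖ ^ 2) - ‖d x‖ ^ 2 = 0) {τ : ℝ}
    (hτ : (trace (cfc (F b) G')).toReal ≤ (trace (cfc (F b) G)).toReal + τ) :
    0 ≤ (‖c₁'‖ ^ 2 + (‖c₂'‖ ^ 2 + ‖c₃'‖ ^ 2) - ‖d'‖ ^ 2) / 2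
      + (∫ x, meanField (fun x => density G x - μ x) x
          * (‖c₁ x‖ ^ 2 + (‖c₂ x‖ ^ 2 + ‖c₃ x‖ ^ 2) - ‖d x‖ ^ 2))
      + τ + 4 * Real.pi * N
        * (∫ x, |‖c₁ x‖ ^ 2 + (‖c₂ x‖ ^ 2 + ‖c₃ x‖ ^ 2) - ‖d x‖ ^ 2|) ^ 2 := by
  set κ : ℝ → ℝ := fun x => ‖c₁ x‖ ^ 2 + (‖c₂ x‖ ^ 2 + ‖c₃ x‖ ^ 2) - ‖d x‖ ^ 2 with hκdef
  set f : ℝ → ℝ := fun x => density G x - μ x with hf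
  have hGp := hG.isPositive
  have hGt := hG.trace_ne_top
  have hGk := hG.traceNegLaplacian_ne_top hb hμ hμ0
  have hGh := hG.hartree_ne_top hb hμ hμ0
  have k₁ := ketbra_isPositive c₁
  have k₂ := ketbra_isPositive c₂
  have k₃ := ketbra_isPositive c₃
  have kd := ketbra_isPositive d
  have ht : trace G' = trace G := by
    have h := congrArg trace hadd
    rw [trace_add hG' kd, trace_add hGp (k₁.add (k₂.add k₃)), trace_add k₁ (k₂.add k₃),
      trace_add k₂ k₃, trace_ketbra_eq_ofReal, trace_ketbra_eq_ofReal, trace_ketbra_eq_ofReal,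
      trace_ketbra_eq_ofReal, ← ENNReal.ofReal_add (by positivity) (by positivity),
      ← ENNReal.ofReal_add (by positivity) (by positivity), hnorm] at h
    exact (ENNReal.add_left_inj ENNReal.ofReal_ne_top).1 h
  have hGt' : trace G' ≠ ⊤ := by rw [ht]; exact hGt
  have hk : traceNegLaplacian G' + ENNReal.ofReal (‖d'‖ ^ 2) = traceNegLaplacian G
      + ENNReal.ofReal (‖c₁'‖ ^ 2 + (‖c₂'‖ ^ 2 + ‖c₃'‖ ^ 2)) := by
    have h := congrArg traceNegLaplacian hadd
    rwa [traceNegLaplacian_add hG' kd, traceNegLaplacian_add hGp (k₁.add (k₂.add k₃)),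
      traceNegLaplacian_add k₁ (k₂.add k₃), traceNegLaplacian_add k₂ k₃,
      traceNegLaplacian_ketbra_eq_ofReal h₁, traceNegLaplacian_ketbra_eq_ofReal h₂,
      traceNegLaplacian_ketbra_eq_ofReal h₃, traceNegLaplacian_ketbra_eq_ofReal hd,
      ← ENNReal.ofReal_add (by positivity) (by positivity),
      ← ENNReal.ofReal_add (by positivity) (by positivity)] at h
  have hGk' : traceNegLaplacian G' ≠ ⊤ := by
    refine ne_top_of_le_ne_top ?_ (le_self_add (a := traceNegLaplacian G')
      (b := ENNReal.ofReal (‖d'‖ ^ 2)))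
    rw [hk]
    exact ENNReal.add_ne_top.2 ⟨hGk, ENNReal.ofReal_ne_top⟩
  have hkr : (traceNegLaplacian G').toReal + ‖d'‖ ^ 2
      = (traceNegLaplacian G).toReal + (‖c₁'‖ ^ 2 + (‖c₂'‖ ^ 2 + ‖c₃'‖ ^ 2)) := by
    have h := congrArg ENNReal.toReal hk
    rwa [ENNReal.toReal_add hGk' ENNReal.ofReal_ne_top, ENNReal.toReal_add hGk
      ENNReal.ofReal_ne_top, ENNReal.toReal_ofReal (by positivity),
      ENNReal.toReal_ofReal (by positivity)] at h
  have hden : (fun x => density G' x - μ x) =ᵐ[volume] fun x => f x + κ x := by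
    have h23 : trace (ketbra c₂ + ketbra c₃) ≠ ⊤ := by
      rw [trace_add k₂ k₃]
      exact ENNReal.add_ne_top.2 ⟨trace_ketbra_ne_top _, trace_ketbra_ne_top _⟩
    have h123 : trace (ketbra c₁ + (ketbra c₂ + ketbra c₃)) ≠ ⊤ := by
      rw [trace_add k₁ (k₂.add k₃)]
      exact ENNReal.add_ne_top.2 ⟨trace_ketbra_ne_top _, h23⟩
    filter_upwards [density_add hG' kd hGt' (trace_ketbra_ne_top d),
      density_add hGp (k₁.add (k₂.add k₃)) hGt h123,
      density_add k₁ (k₂.add k₃) (trace_ketbra_ne_top _) h23,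
      density_add k₂ k₃ (trace_ketbra_ne_top _) (trace_ketbra_ne_top _),
      density_ketbra c₁, density_ketbra c₂, density_ketbra c₃, density_ketbra d]
      with x e1 e2 e3 e4 e5 e6 e7 e8
    rw [hadd, e2, e3, e4, e5, e6, e7, e8] at e1
    simp only [hf, hκdef]
    linarith
  have hκ : Integrable κ := ((integrable_normSq c₁).add
    ((integrable_normSq c₂).add (integrable_normSq c₃))).sub (integrable_normSq d)
  have hκ0 : ∫ x, κ x = 0 := by
    have e1 : ∫ x, κ x = (∫ x, (‖c₁ x‖ ^ 2 + (‖c₂ x‖ ^ 2 + ‖c₃ x‖ ^ 2))) - ∫ x, ‖d x‖ ^ 2 :=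
      integral_sub ((integrable_normSq c₁).add
        ((integrable_normSq c₂).add (integrable_normSq c₃))) (integrable_normSq d)
    have e2 : ∫ x, (‖c₁ x‖ ^ 2 + (‖c₂ x‖ ^ 2 + ‖c₃ x‖ ^ 2))
        = (∫ x, ‖c₁ x‖ ^ 2) + ∫ x, (‖c₂ x‖ ^ 2 + ‖c₃ x‖ ^ 2) :=
      integral_add (integrable_normSq c₁) ((integrable_normSq c₂).add (integrable_normSq c₃))
    rw [e1, e2, integral_add (integrable_normSq c₂) (integrable_normSq c₃), integral_normSq,
      integral_normSq, integral_normSq, integral_normSq, hnorm, sub_self]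
  obtain ⟨hh1, hh2⟩ := hartree_add_le hGh hκ hN hκ0 hs
  have hE := hG.2 G' ⟨hG', ht.trans hG.1.2⟩
  rw [energy, energy, hartree_congr hden] at hE
  have hF := trace_cfc_F_ne_top hb hGp hGt
  have hF' := trace_cfc_F_ne_top hb hG' hGt'
  have h2 : (2⁻¹ : ℝ≥0∞) ≠ ⊤ := by simp
  have hE' := ENNReal.toReal_mono (ENNReal.add_ne_top.2 ⟨ENNReal.add_ne_top.2
    ⟨ENNReal.mul_ne_top h2 hGk', hF'⟩, ENNReal.mul_ne_top h2 hh1⟩) hE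
  rw [ENNReal.toReal_add (ENNReal.add_ne_top.2 ⟨ENNReal.mul_ne_top h2 hGk', hF'⟩)
      (ENNReal.mul_ne_top h2 hh1), ENNReal.toReal_add (ENNReal.mul_ne_top h2 hGk') hF',
    ENNReal.toReal_add (ENNReal.add_ne_top.2 ⟨ENNReal.mul_ne_top h2 hGk, hF⟩)
      (ENNReal.mul_ne_top h2 hGh), ENNReal.toReal_add (ENNReal.mul_ne_top h2 hGk) hF,
    ENNReal.toReal_mul, ENNReal.toReal_mul, ENNReal.toReal_mul, ENNReal.toReal_mul,
    ENNReal.toReal_inv, ENNReal.toReal_ofNat] at hE'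
  linarith

end Variations

end RHF

end

noncomputable section

namespace RHF

/-! ### The Hamiltonian on test functions -/

section Hamiltonian

variable {Φ : ℝ → ℝ}

theorem memLp_mul_test (hΦ : Continuous Φ) (u : testSpace) :
    MemLp (fun x => (Φ x : ℂ) * (u : ℝ → ℂ) x) 2 :=
  ((Complex.continuous_ofReal.comp hΦ).mul (test_continuous u)).memLp_of_hasCompactSupport
    (test_hasCompactSupport u).mul_left

/-- Multiplication of a test function by the continuous function `Φ`. -/
def potT (hΦ : Continuous Φ) : testSpace →ₗ[ℂ] L2R where
  toFun u := (memLp_mul_test hΦ u).toLp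
  map_add' u v := by
    rw [← MemLp.toLp_add]
    refine MemLp.toLp_congr _ _ (ae_of_all _ fun x => ?_)
    exact mul_add _ _ _
  map_smul' c u := by
    rw [RingHom.id_apply, ← MemLp.toLp_const_smul]
    refine MemLp.toLp_congr _ _ (ae_of_all _ fun x => ?_)
    exact mul_left_comm _ _ _

theorem coeFn_potT (hΦ : Continuous Φ) (u : testSpace) :
    (potT hΦ u : ℝ → ℂ) =ᵐ[volume] fun x => (Φ x : ℂ) * (u : ℝ → ℂ) x :=
  (memLp_mul_test hΦ u).coeFn_toLp

theorem inner_potT (hΦ : Continuous Φ) (u : testSpace) (f : L2R) :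
    ⟪potT hΦ u, f⟫_ℂ = ∫ x, (Φ x : ℂ) * (starRingEnd ℂ ((u : ℝ → ℂ) x) * f x) := by
  rw [L2.inner_def]
  refine integral_congr_ae ?_
  filter_upwards [coeFn_potT hΦ u] with x hx
  rw [hx, RCLike.inner_apply, map_mul, Complex.conj_ofReal]
  ring

/-- The operator `-½ Δ₁ + Φ` on test functions. -/
def hamT (hΦ : Continuous Φ) : testSpace →ₗ[ℂ] L2R :=
  -((1 / 2 : ℂ) • (toL2 ∘ₗ derivT ∘ₗ derivT)) + potT hΦ

theorem hamT_apply (hΦ : Continuous Φ) (u : testSpace) :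
    hamT hΦ u = -((1 / 2 : ℂ) • toL2 (derivT (derivT u))) + potT hΦ u := rfl

theorem inner_hamT (hΦ : Continuous Φ) (u : testSpace) (f : L2R) :
    ⟪hamT hΦ u, f⟫_ℂ = -(1 / 2) * ⟪toL2 (derivT (derivT u)), f⟫_ℂ + ⟪potT hΦ u, f⟫_ℂ := by
  have h2 : starRingEnd ℂ (1 / 2 : ℂ) = 1 / 2 := by
    rw [map_div₀, map_one, map_ofNat]
  rw [hamT_apply, inner_add_left, inner_neg_left, inner_smul_left, h2, neg_mul]

theorem isSchrodingerPair_iff (hΦ : Continuous Φ) (ψ w : L2R) :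
    IsSchrodingerPair Φ ψ w ↔ ∀ u, ⟪hamT hΦ u, ψ⟫_ℂ = ⟪toL2 u, w⟫_ℂ := by
  have hloc : LocallyIntegrable fun x => Φ x • ψ x :=
    (locallyIntegrable_L2R ψ).continuous_smul hΦ
  rw [← forall_real_iff_forall, IsSchrodingerPair, and_iff_right hloc]
  refine forall_congr' fun φ => forall_congr' fun hφ => ?_
  rw [inner_hamT, derivT_ofRealT, derivT_ofRealT, inner_ofRealT, inner_ofRealT, inner_potT,
    iteratedDeriv_succ, iteratedDeriv_one]
  have e : ∫ x, (Φ x : ℂ) * (starRingEnd ℂ ((ofRealT φ hφ : ℝ → ℂ) x) * ψ x)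
      = ∫ x, φ x • (Φ x • ψ x) := by
    refine integral_congr_ae (ae_of_all _ fun x => ?_)
    simp only [ofRealT_apply, Complex.conj_ofReal, Complex.real_smul]
    ring
  rw [e]

theorem inner_derivT_derivT (u : testSpace) {f g : L2R} (h : IsWeakDeriv f g) :
    ⟪toL2 (derivT (derivT u)), f⟫_ℂ = -⟪toL2 (derivT u), g⟫_ℂ :=
  (isWeakDeriv_iff f g).1 h (derivT u)

theorem isSchrodingerPair_hamT (hΦ : Continuous Φ) (u : testSpace) :
    IsSchrodingerPair Φ (toL2 u) (hamT hΦ u) := by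
  rw [isSchrodingerPair_iff hΦ]
  intro v
  rw [← inner_conj_symm (toL2 v), inner_hamT, inner_hamT, map_add, map_mul,
    inner_derivT_derivT v (isWeakDeriv_toL2 u), inner_derivT_derivT u (isWeakDeriv_toL2 v),
    map_neg, inner_conj_symm]
  have e : ⟪potT hΦ v, toL2 u⟫_ℂ = starRingEnd ℂ ⟪potT hΦ u, toL2 v⟫_ℂ := by
    rw [inner_potT, inner_potT, ← integral_conj]
    refine integral_congr_ae ?_
    filter_upwards [coeFn_toL2 u, coeFn_toL2 v] with x hu hv
    rw [hu, hv]
    simp only [map_mul, Complex.conj_ofReal, Complex.conj_conj]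
    ring
  have h2 : starRingEnd ℂ (1 / 2 : ℂ) = 1 / 2 := by
    rw [map_div₀, map_one, map_ofNat]
  rw [e, h2, map_neg, inner_conj_symm, inner_conj_symm]

theorem integrable_mul_normSq (hΦ : Continuous Φ) (u : testSpace) :
    Integrable fun x => Φ x * ‖(u : ℝ → ℂ) x‖ ^ 2 := by
  have hc : HasCompactSupport fun x => Φ x * ‖(u : ℝ → ℂ) x‖ ^ 2 :=
    (test_hasCompactSupport u).mono fun x hx h => hx (by simp [h])
  exact (hΦ.mul ((test_continuous u).norm.pow 2)).integrable_of_hasCompactSupport hc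

/-- The quadratic form of `-½ Δ₁ + Φ` on test functions. -/
theorem re_inner_hamT_self (hΦ : Continuous Φ) (u : testSpace) :
    (⟪hamT hΦ u, toL2 u⟫_ℂ).re
      = ‖toL2 (derivT u)‖ ^ 2 / 2 + ∫ x, Φ x * ‖(u : ℝ → ℂ) x‖ ^ 2 := by
  have e : ⟪potT hΦ u, toL2 u⟫_ℂ = ((∫ x, Φ x * ‖(u : ℝ → ℂ) x‖ ^ 2 : ℝ) : ℂ) := by
    rw [inner_potT, ← integral_complex_ofReal]
    refine integral_congr_ae ?_
    filter_upwards [coeFn_toL2 u] with x hu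
    rw [hu, ← Complex.normSq_eq_conj_mul_self, Complex.normSq_eq_norm_sq]
    exact (Complex.ofReal_mul _ _).symm
  rw [inner_hamT, e, inner_derivT_derivT u (isWeakDeriv_toL2 u), inner_self_eq_norm_sq_to_K,
    Complex.add_re, Complex.ofReal_re]
  have h2 : (RCLike.ofReal ‖toL2 (derivT u)‖ : ℂ) = (‖toL2 (derivT u)‖ : ℂ) := rfl
  rw [h2]
  have h3 : -(1 / 2 : ℂ) * -(((‖toL2 (derivT u)‖ : ℝ) : ℂ) ^ 2)
      = ((‖toL2 (derivT u)‖ ^ 2 / 2 : ℝ) : ℂ) := by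
    push_cast
    ring
  rw [h3, Complex.ofReal_re]

end Hamiltonian

end RHF

end

noncomputable section

namespace RHF

/-! ### First variation of the energy -/

section Deform

open InnerProductSpace

variable {E : Type} [NormedAddCommGroup E] [InnerProductSpace ℂ E] [CompleteSpace E]

/-- The deformation `(1 + z |u⟩⟨u|) G (1 + z̄ |u⟩⟨u|)` of `G`. -/
def deform (G : E →L[ℂ] E) (u : E) (z : ℂ) : E →L[ℂ] E :=
  (1 + z • rankOne ℂ u u) * G * star (1 + z • rankOne ℂ u u)

variable {G : E →L[ℂ] E}

theorem deform_isPositive (hG : G.IsPositive) (u : E) (z : ℂ) : (deform G u z).IsPositive := by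
  rw [deform, mul_assoc]
  exact hG.conj_adjoint (1 + z • rankOne ℂ u u)

theorem star_one_add_smul (u : E) (z : ℂ) :
    star (1 + z • rankOne ℂ u u) = 1 + starRingEnd ℂ z • rankOne ℂ u u := by
  rw [star_add, star_one, star_smul, (isSelfAdjoint_rankOne_self u).star_eq]
  rfl

theorem one_add_smul_rankOne_apply (u : E) (c : ℂ) (y : E) :
    (1 + c • rankOne ℂ u u) y = y + (c * ⟪u, y⟫_ℂ) • u := by
  rw [add_apply, smul_apply, rankOne_apply, smul_smul]
  rfl

theorem deform_apply (hG : IsSelfAdjoint G) (u : E) (z : ℂ) (x : E) :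
    deform G u z x = G x + (starRingEnd ℂ z * ⟪u, x⟫_ℂ) • G u
      + (z * (⟪G u, x⟫_ℂ + starRingEnd ℂ z * ⟪u, x⟫_ℂ * ⟪u, G u⟫_ℂ)) • u := by
  have h2 : ⟪u, G x⟫_ℂ = ⟪G u, x⟫_ℂ := (hG.isSymmetric u x).symm
  have h3 : deform G u z x
      = (1 + z • rankOne ℂ u u) (G ((1 + starRingEnd ℂ z • rankOne ℂ u u) x)) := by
    rw [deform, star_one_add_smul]
    rfl
  rw [h3, one_add_smul_rankOne_apply, one_add_smul_rankOne_apply, map_add, map_smul,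
    inner_add_right, inner_smul_right, h2]

/-- Completing the square: a deformation changes `G` by three rank one operators, one of which is
subtracted. -/
theorem deform_add_rankOne (hG : IsSelfAdjoint G) (u : E) (z : ℂ) {m : ℝ} (hm0 : 0 ≤ m)
    (hm : ⟪u, G u⟫_ℂ = m) :
    deform G u z + rankOne ℂ (u - (starRingEnd ℂ z / 2) • G u) (u - (starRingEnd ℂ z / 2) • G u)
      = G + (rankOne ℂ (u + (starRingEnd ℂ z / 2) • G u) (u + (starRingEnd ℂ z / 2) • G u)
        + rankOne ℂ (((‖z‖ * Real.sqrt m : ℝ) : ℂ) • u) (((‖z‖ * Real.sqrt m : ℝ) : ℂ) • u)) := by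
  ext1 x
  have hz : ((‖z‖ * Real.sqrt m : ℝ) : ℂ) * ((‖z‖ * Real.sqrt m : ℝ) : ℂ)
      = z * starRingEnd ℂ z * m := by
    rw [Complex.mul_conj, Complex.normSq_eq_norm_sq, ← Complex.ofReal_mul, ← Complex.ofReal_mul]
    congr 1
    have := Real.mul_self_sqrt hm0
    linear_combination ‖z‖ ^ 2 * this
  have h2 : starRingEnd ℂ (2 : ℂ) = 2 := map_ofNat _ 2
  set r := ((‖z‖ * Real.sqrt m : ℝ) : ℂ) with hr
  have hrr : starRingEnd ℂ r = r := Complex.conj_ofReal _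
  simp only [add_apply, rankOne_apply, deform_apply hG, hm, inner_add_left, inner_sub_left,
    inner_smul_left, map_div₀, Complex.conj_conj, h2]
  generalize ⟪u, x⟫_ℂ = p
  generalize ⟪G u, x⟫_ℂ = q
  have e : (starRingEnd ℂ r * p) • r • u = (z * starRingEnd ℂ z * (m : ℂ) * p) • u := by
    rw [hrr, smul_smul, mul_right_comm, hz]
  rw [e]
  module
end Deform

section FirstVariation

variable {b : ℝ} {μ : ℝ → ℝ} {G : L2R →L[ℂ] L2R}

/-- The mean-field potential generated by the state `G` and the background `μ`. -/
abbrev statePot (G : L2R →L[ℂ] L2R) (μ : ℝ → ℝ) : ℝ → ℝ := meanField fun x => density G x - μ x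

theorem normSq_add_sub (x y : ℂ) :
    ‖x + y‖ ^ 2 - ‖x - y‖ ^ 2 = 4 * (starRingEnd ℂ x * y).re := by
  rw [← Complex.normSq_eq_norm_sq, ← Complex.normSq_eq_norm_sq, Complex.normSq_add,
    Complex.normSq_sub]
  simp only [Complex.mul_re, Complex.conj_re, Complex.conj_im]
  ring

theorem norm_sq_add_sub (x y : L2R) : ‖x + y‖ ^ 2 - ‖x - y‖ ^ 2 = 4 * (⟪x, y⟫_ℂ).re := by
  rw [norm_add_sq (𝕜 := ℂ), norm_sub_sq (𝕜 := ℂ), RCLike.re_to_complex]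
  ring

theorem integral_linear_combination {f g h : ℝ → ℝ} (hf : Integrable f) (hg : Integrable g)
    (hh : Integrable h) (p q r : ℝ) : ∫ x, (p * f x + q * g x + r * h x)
      = p * (∫ x, f x) + q * (∫ x, g x) + r * ∫ x, h x := by
  have hfg : Integrable fun x => p * f x + q * g x := (hf.const_mul p).add (hg.const_mul q)
  rw [integral_add hfg (hh.const_mul r), integral_add (hf.const_mul p) (hg.const_mul q),
    integral_const_mul, integral_const_mul, integral_const_mul]

theorem norm_real_smul_sq (c : ℝ) (x : L2R) : ‖(c : ℂ) • x‖ ^ 2 = c ^ 2 * ‖x‖ ^ 2 := by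
  rw [norm_smul, mul_pow, Complex.norm_real, Real.norm_eq_abs, sq_abs]

theorem ketbra_smul_add (G : L2R →L[ℂ] L2R) (hG : IsSelfAdjoint G) (u φ : L2R) (z : ℂ) {m : ℝ}
    (hm0 : 0 ≤ m) (hm : ⟪u, G u⟫_ℂ = m) :
    deform G u z + ketbra φ + ketbra (u - (starRingEnd ℂ z / 2) • G u)
      = G + (ketbra (u + (starRingEnd ℂ z / 2) • G u)
        + (ketbra (((‖z‖ * Real.sqrt m : ℝ) : ℂ) • u) + ketbra φ)) := by
  have h : deform G u z + ketbra (u - (starRingEnd ℂ z / 2) • G u)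
      = G + (ketbra (u + (starRingEnd ℂ z / 2) • G u)
        + ketbra (((‖z‖ * Real.sqrt m : ℝ) : ℂ) • u)) := deform_add_rankOne hG u z hm0 hm
  rw [add_right_comm, h, add_assoc, add_assoc]

set_option maxHeartbeats 1000000 in
/-- Minimality of `G` tested against the deformation along `u`, with the trace restored by `s |φ⟩⟨φ|`.
The density of this variation has compact support, so that its Hartree energy is quadratic in `z`. -/
theorem IsMinimizer.exists_deform_bound (hG : IsMinimizer b μ G) (hb : b ≠ 0) (hμ : Integrable μ)
    (hμ0 : ∀ᵐ x, 0 ≤ μ x) (hΦ : Continuous (statePot G μ)) (u φ : testSpace)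
    (hu : ‖toL2 u‖ = 1) (hφ : ‖toL2 φ‖ = 1) {m : ℝ} (hm : ⟪toL2 u, G (toL2 u)⟫_ℂ = m) :
    ∃ C, 0 ≤ C ∧ ∀ (z : ℂ) (s τ : ℝ), ‖z‖ ≤ 1 → 0 ≤ s → 2 * z.re * m + ‖z‖ ^ 2 * m + s = 0 →
      (trace (cfc (F b) (deform G (toL2 u) z
        + ketbra (((Real.sqrt s : ℝ) : ℂ) • toL2 φ)))).toReal
          ≤ (trace (cfc (F b) G)).toReal + τ →
      0 ≤ 2 * (starRingEnd ℂ z * ⟪hamT hΦ u, G (toL2 u)⟫_ℂ).re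
        + ‖z‖ ^ 2 * m * (⟪hamT hΦ u, toL2 u⟫_ℂ).re + s * (⟪hamT hΦ φ, toL2 φ⟫_ℂ).re + τ
        + C * ‖z‖ ^ 2 := by
  set w := G (toL2 u) with hw
  have hGp := hG.isPositive
  have hm0 : 0 ≤ m := by
    have := hGp.re_inner_nonneg_right (toL2 u)
    rw [← hw, hm] at this
    simpa using this
  obtain ⟨g, hg⟩ := exists_weakDeriv_apply hGp (hG.traceNegLaplacian_ne_top hb hμ hμ0) (toL2 u)
  rw [← hw] at hg
  obtain ⟨N, hN, hsupp⟩ : ∃ N : ℝ, 0 ≤ N ∧ ∀ x, N < |x| → (u : ℝ → ℂ) x = 0 ∧ (φ : ℝ → ℂ) x = 0 := by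
    obtain ⟨N, hN⟩ := (((test_hasCompactSupport u).isCompact.union
      (test_hasCompactSupport φ).isCompact).isBounded).exists_norm_le
    refine ⟨max N 0, le_max_right _ _, fun x hx => ⟨?_, ?_⟩⟩ <;> by_contra hc
    · exact absurd (hN x (Or.inl (subset_tsupport _ hc)))
        (not_le.2 ((le_max_left _ _).trans_lt hx))
    · exact absurd (hN x (Or.inr (subset_tsupport _ hc)))
        (not_le.2 ((le_max_left _ _).trans_lt hx))
  refine ⟨4 * Real.pi * N * (1 + ‖w‖ ^ 2 + 3 * m) ^ 2, by positivity, ?_⟩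
  intro z s τ hz hs hzs hτ
  set ζ : ℂ := starRingEnd ℂ z / 2 with hζ
  have hzre : |z.re| ≤ ‖z‖ := Complex.abs_re_le_norm z
  have hsb : s ≤ 2 * ‖z‖ * m := by
    have h1 := abs_le.1 hzre
    nlinarith [mul_nonneg (sq_nonneg ‖z‖) hm0, mul_nonneg (norm_nonneg z) hm0]
  have hα : (‖z‖ * Real.sqrt m) ^ 2 = ‖z‖ ^ 2 * m := by rw [mul_pow, Real.sq_sqrt hm0]
  have hβ : Real.sqrt s ^ 2 = s := Real.sq_sqrt hs
  have hnorm : ‖toL2 u + ζ • w‖ ^ 2 + (‖((‖z‖ * Real.sqrt m : ℝ) : ℂ) • toL2 u‖ ^ 2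
      + ‖((Real.sqrt s : ℝ) : ℂ) • toL2 φ‖ ^ 2) = ‖toL2 u - ζ • w‖ ^ 2 := by
    have h1 := norm_sq_add_sub (toL2 u) (ζ • w)
    rw [inner_smul_right, hm, Complex.re_mul_ofReal, hζ] at h1
    have h2 : (starRingEnd ℂ z / 2).re = z.re / 2 := by simp
    rw [h2] at h1
    rw [norm_real_smul_sq, norm_real_smul_sq, hα, hβ, hu, hφ]
    linarith
  -- the density of the variation, pointwise
  set k : ℝ → ℝ := fun x => 2 * (starRingEnd ℂ z * (starRingEnd ℂ ((u : ℝ → ℂ) x) * w x)).re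
    + ‖z‖ ^ 2 * m * ‖(u : ℝ → ℂ) x‖ ^ 2 + s * ‖(φ : ℝ → ℂ) x‖ ^ 2 with hk
  have hκ : ∀ᵐ x, ‖(toL2 u + ζ • w : L2R) x‖ ^ 2
      + (‖(((‖z‖ * Real.sqrt m : ℝ) : ℂ) • toL2 u : L2R) x‖ ^ 2
      + ‖(((Real.sqrt s : ℝ) : ℂ) • toL2 φ : L2R) x‖ ^ 2) - ‖(toL2 u - ζ • w : L2R) x‖ ^ 2 = k x := by
    filter_upwards [Lp.coeFn_add (toL2 u) (ζ • w), Lp.coeFn_sub (toL2 u) (ζ • w),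
      Lp.coeFn_smul ζ w, Lp.coeFn_smul ((‖z‖ * Real.sqrt m : ℝ) : ℂ) (toL2 u),
      Lp.coeFn_smul ((Real.sqrt s : ℝ) : ℂ) (toL2 φ), coeFn_toL2 u, coeFn_toL2 φ]
      with x e1 e2 e3 e4 e5 e6 e7
    have h1 := normSq_add_sub ((u : ℝ → ℂ) x) (ζ * w x)
    have h2 : (starRingEnd ℂ ((u : ℝ → ℂ) x) * (ζ * w x)).re
        = (starRingEnd ℂ z * (starRingEnd ℂ ((u : ℝ → ℂ) x) * w x)).re / 2 := by
      rw [hζ, show starRingEnd ℂ ((u : ℝ → ℂ) x) * (starRingEnd ℂ z / 2 * w x)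
        = (starRingEnd ℂ z * (starRingEnd ℂ ((u : ℝ → ℂ) x) * w x)) / 2 by ring]
      simp
    rw [h2] at h1
    rw [e1, e2, e4, e5, Pi.add_apply, Pi.sub_apply, e3, Pi.smul_apply, Pi.smul_apply, Pi.smul_apply,
      e6, e7, smul_eq_mul, smul_eq_mul, smul_eq_mul, norm_mul, norm_mul, Complex.norm_real,
      Complex.norm_real, Real.norm_eq_abs, Real.norm_eq_abs, mul_pow, mul_pow, sq_abs, sq_abs, hα,
      hβ]
    simp only [hk]
    linarith
  have hvar := hG.variation hb hμ hμ0 (N := N) (τ := τ)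
    ((deform_isPositive hGp (toL2 u) z).add (ketbra_isPositive (((Real.sqrt s : ℝ) : ℂ) • toL2 φ)))
    (ketbra_smul_add G hGp.isSelfAdjoint (toL2 u) (((Real.sqrt s : ℝ) : ℂ) • toL2 φ) z hm0 hm)
    ((isWeakDeriv_toL2 u).add (hg.smul ζ)) ((isWeakDeriv_toL2 u).smul _)
    ((isWeakDeriv_toL2 φ).smul _) ((isWeakDeriv_toL2 u).sub (hg.smul ζ)) hnorm hN
    (by
      filter_upwards [hκ] with x hx hxN
      rw [hx]
      simp [hk, hsupp x hxN]) hτ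
  have hI1 : ∫ x, statePot G μ x * (‖(toL2 u + ζ • w : L2R) x‖ ^ 2
      + (‖(((‖z‖ * Real.sqrt m : ℝ) : ℂ) • toL2 u : L2R) x‖ ^ 2
      + ‖(((Real.sqrt s : ℝ) : ℂ) • toL2 φ : L2R) x‖ ^ 2) - ‖(toL2 u - ζ • w : L2R) x‖ ^ 2)
      = 2 * (starRingEnd ℂ z * ⟪potT hΦ u, w⟫_ℂ).re
        + ‖z‖ ^ 2 * m * (∫ x, statePot G μ x * ‖(u : ℝ → ℂ) x‖ ^ 2)
        + s * (∫ x, statePot G μ x * ‖(φ : ℝ → ℂ) x‖ ^ 2) := by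
    have hi : Integrable fun x => ((statePot G μ x : ℝ) : ℂ)
        * (starRingEnd ℂ ((u : ℝ → ℂ) x) * w x) := by
      refine (L2.integrable_inner (𝕜 := ℂ) (potT hΦ u) w).congr ?_
      filter_upwards [coeFn_potT hΦ u] with x hx
      rw [hx, RCLike.inner_apply, map_mul, Complex.conj_ofReal]
      ring
    have hi2 := hi.const_mul (starRingEnd ℂ z)
    have e1 : (starRingEnd ℂ z * ⟪potT hΦ u, w⟫_ℂ).re = ∫ x, (starRingEnd ℂ z
        * (((statePot G μ x : ℝ) : ℂ) * (starRingEnd ℂ ((u : ℝ → ℂ) x) * w x))).re := by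
      rw [inner_potT, ← integral_const_mul]
      exact (integral_re hi2).symm
    have hi3 : Integrable fun x => (starRingEnd ℂ z
        * (((statePot G μ x : ℝ) : ℂ) * (starRingEnd ℂ ((u : ℝ → ℂ) x) * w x))).re := hi2.re
    rw [e1, ← integral_linear_combination hi3 (integrable_mul_normSq hΦ u)
      (integrable_mul_normSq hΦ φ)]
    refine integral_congr_ae ?_
    filter_upwards [hκ] with x hx
    rw [hx]
    simp only [hk]
    rw [mul_left_comm (starRingEnd ℂ z) ((statePot G μ x : ℝ) : ℂ), Complex.re_ofReal_mul]
    ring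
  have hI2 : ∫ x, |‖(toL2 u + ζ • w : L2R) x‖ ^ 2
      + (‖(((‖z‖ * Real.sqrt m : ℝ) : ℂ) • toL2 u : L2R) x‖ ^ 2
      + ‖(((Real.sqrt s : ℝ) : ℂ) • toL2 φ : L2R) x‖ ^ 2) - ‖(toL2 u - ζ • w : L2R) x‖ ^ 2|
      ≤ ‖z‖ * (1 + ‖w‖ ^ 2 + 3 * m) := by
    have e := integral_linear_combination (integrable_normSq (toL2 u)) (integrable_normSq w)
      (integrable_normSq (toL2 φ)) (‖z‖ + ‖z‖ ^ 2 * m) ‖z‖ s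
    have hint : Integrable fun x => (‖z‖ + ‖z‖ ^ 2 * m) * ‖toL2 u x‖ ^ 2 + ‖z‖ * ‖w x‖ ^ 2
        + s * ‖toL2 φ x‖ ^ 2 :=
      (((integrable_normSq _).const_mul _).add ((integrable_normSq _).const_mul _)).add
        ((integrable_normSq _).const_mul _)
    refine (integral_mono_of_nonneg (ae_of_all _ fun x => abs_nonneg _) hint ?_).trans ?_
    · filter_upwards [hκ, coeFn_toL2 u, coeFn_toL2 φ] with x hx h1 h2
      rw [hx, h1, h2]
      simp only [hk]
      have h3 : |(starRingEnd ℂ z * (starRingEnd ℂ ((u : ℝ → ℂ) x) * w x)).re|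
          ≤ ‖z‖ * (‖(u : ℝ → ℂ) x‖ * ‖w x‖) := by
        refine (Complex.abs_re_le_norm _).trans ?_
        rw [norm_mul, norm_mul, RCLike.norm_conj, RCLike.norm_conj]
      have h4 : ‖z‖ * (‖(u : ℝ → ℂ) x‖ * ‖w x‖)
          ≤ ‖z‖ * ((‖(u : ℝ → ℂ) x‖ ^ 2 + ‖w x‖ ^ 2) / 2) :=
        mul_le_mul_of_nonneg_left (by nlinarith [sq_nonneg (‖(u : ℝ → ℂ) x‖ - ‖w x‖)])
          (norm_nonneg z)
      have h5 : 0 ≤ ‖z‖ ^ 2 * m * ‖(u : ℝ → ℂ) x‖ ^ 2 := by positivity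
      have h6 : 0 ≤ s * ‖(φ : ℝ → ℂ) x‖ ^ 2 := by positivity
      obtain ⟨h7, h8⟩ := abs_le.1 h3
      exact abs_le.2 ⟨by linarith, by linarith⟩
    · rw [e, integral_normSq, integral_normSq, integral_normSq, hu, hφ]
      nlinarith [mul_nonneg (norm_nonneg z) hm0]
  have hkin : (‖toL2 (derivT u) + ζ • g‖ ^ 2 + (‖((‖z‖ * Real.sqrt m : ℝ) : ℂ) • toL2 (derivT u)‖ ^ 2
      + ‖((Real.sqrt s : ℝ) : ℂ) • toL2 (derivT φ)‖ ^ 2) - ‖toL2 (derivT u) - ζ • g‖ ^ 2) / 2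
      = 2 * (starRingEnd ℂ z * (-(1 / 2) * ⟪toL2 (derivT (derivT u)), w⟫_ℂ)).re
        + ‖z‖ ^ 2 * m * (‖toL2 (derivT u)‖ ^ 2 / 2) + s * (‖toL2 (derivT φ)‖ ^ 2 / 2) := by
    have h1 := norm_sq_add_sub (toL2 (derivT u)) (ζ • g)
    have h2 : (starRingEnd ℂ z * (-(1 / 2) * ⟪toL2 (derivT (derivT u)), w⟫_ℂ)).re
        = (⟪toL2 (derivT u), ζ • g⟫_ℂ).re := by
      rw [inner_derivT_derivT u hg, inner_smul_right, hζ]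
      congr 1
      ring
    rw [norm_real_smul_sq, norm_real_smul_sq, hα, hβ, h2]
    linarith
  rw [hI1, hkin] at hvar
  have hsq := pow_le_pow_left₀ (integral_nonneg fun _ => abs_nonneg _) hI2 2
  have hC := mul_le_mul_of_nonneg_left hsq (show 0 ≤ 4 * Real.pi * N by positivity)
  rw [re_inner_hamT_self hΦ u, re_inner_hamT_self hΦ φ, inner_hamT, mul_add, Complex.add_re]
  rw [mul_pow] at hC
  linarith

end FirstVariation

end RHF

end

noncomputable section

namespace RHF

/-! ### The minimizer commutes with the Hamiltonian on test functions -/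

section Commutation

open InnerProductSpace in
theorem one_add_smul_rankOne_mul {E : Type} [NormedAddCommGroup E] [InnerProductSpace ℂ E]
    [CompleteSpace E] {u : E} (hu : ‖u‖ = 1) {z w : ℂ} (h : z + w + z * w = 0) :
    (1 + z • rankOne ℂ u u) * (1 + w • rankOne ℂ u u) = 1 := by
  have hP : rankOne ℂ u u * rankOne ℂ u u = rankOne ℂ u u := (isIdempotentElem_rankOne_self hu).eq
  rw [add_mul, one_mul, mul_add, mul_one, smul_mul_smul_comm, hP]
  have : (1 + w • rankOne ℂ u u + (z • rankOne ℂ u u + (z * w) • rankOne ℂ u u))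
      = 1 + (z + w + z * w) • rankOne ℂ u u := by
    rw [add_smul, add_smul]
    abel
  rw [this, h, zero_smul, add_zero]

variable {b : ℝ} {μ : ℝ → ℝ} {G : L2R →L[ℂ] L2R}

theorem inner_apply_self_eq_re (hG : IsSelfAdjoint G) (x : L2R) :
    ⟪x, G x⟫_ℂ = (((⟪x, G x⟫_ℂ).re : ℝ) : ℂ) := by
  refine (Complex.conj_eq_iff_re.1 ?_).symm
  rw [inner_conj_symm]
  exact hG.isSymmetric x x

/-- For `|1 + z| = 1` the deformation is a unitary conjugation. -/
theorem trace_cfc_F_deform_unitary (hb : b ≠ 0) (hG : G.IsPositive) {u : L2R} (hu : ‖u‖ = 1)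
    {z : ℂ} (hz : z + starRingEnd ℂ z + z * starRingEnd ℂ z = 0) :
    trace (cfc (F b) (deform G u z)) = trace (cfc (F b) G) := by
  have h1 : star (1 + z • ketbra u) = 1 + starRingEnd ℂ z • ketbra u := star_one_add_smul u z
  have h2 : (1 + starRingEnd ℂ z • ketbra u) * (1 + z • ketbra u) = 1 :=
    one_add_smul_rankOne_mul hu (by rw [← hz]; ring)
  have h3 : (1 + z • ketbra u) * (1 + starRingEnd ℂ z • ketbra u) = 1 :=
    one_add_smul_rankOne_mul hu hz
  rw [← h1] at h2 h3
  exact trace_cfc_F_conj_unitary hb hG h2 h3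

theorem eq_zero_of_forall_small {X D : ℝ} (hD : 0 ≤ D)
    (h : ∀ β : ℝ, |β| ≤ 1 / 2 → 0 ≤ 2 * β * X + β ^ 2 * D) : X = 0 := by
  by_contra hX
  have hX' : 0 < |X| := abs_pos.2 hX
  have hden : 0 < D + 1 + 2 * |X| := by positivity
  have h1 := h (-(X / (D + 1 + 2 * |X|))) (by
    rw [abs_neg, abs_div, abs_of_pos hden, div_le_iff₀ hden]
    linarith)
  have h2 : 2 * -(X / (D + 1 + 2 * |X|)) * X + (-(X / (D + 1 + 2 * |X|))) ^ 2 * D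
      = X ^ 2 / (D + 1 + 2 * |X|) ^ 2 * (D - 2 * (D + 1 + 2 * |X|)) := by
    field_simp
    ring
  rw [h2] at h1
  have h3 : 0 < X ^ 2 / (D + 1 + 2 * |X|) ^ 2 := by positivity
  nlinarith

/-- `⟨H u, G u⟩` is real: the energy is stationary under the unitary rotations
`1 + z |u⟩⟨u|`, `|1 + z| = 1`. -/
theorem IsMinimizer.im_inner_hamT_eq_zero (hG : IsMinimizer b μ G) (hb : b ≠ 0)
    (hμ : Integrable μ) (hμ0 : ∀ᵐ x, 0 ≤ μ x) (hΦ : Continuous (statePot G μ)) {u : testSpace}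
    (hu : ‖toL2 u‖ = 1) : (⟪hamT hΦ u, G (toL2 u)⟫_ℂ).im = 0 := by
  have hGp := hG.isPositive
  have hm : ⟪toL2 u, G (toL2 u)⟫_ℂ = (((⟪toL2 u, G (toL2 u)⟫_ℂ).re : ℝ) : ℂ) :=
    inner_apply_self_eq_re hGp.isSelfAdjoint _
  obtain ⟨C, hC, h⟩ := hG.exists_deform_bound hb hμ hμ0 hΦ u u hu hu hm
  set m := (⟪toL2 u, G (toL2 u)⟫_ℂ).re
  set X := ⟪hamT hΦ u, G (toL2 u)⟫_ℂ
  set q := (⟪hamT hΦ u, toL2 u⟫_ℂ).re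
  refine eq_zero_of_forall_small (D := 2 * |X.re| + 2 * |m * q| + 2 * C) (by positivity)
    fun β hβ => ?_
  have hβ2 : β ^ 2 ≤ 1 / 4 := by
    rw [← sq_abs]
    nlinarith [abs_nonneg β]
  have hs0 : Real.sqrt (1 - β ^ 2) ^ 2 = 1 - β ^ 2 := Real.sq_sqrt (by linarith)
  have hs1 : Real.sqrt (1 - β ^ 2) ≤ 1 := Real.sqrt_le_one.2 (by nlinarith [sq_nonneg β])
  have hs2 : 1 - β ^ 2 ≤ Real.sqrt (1 - β ^ 2) := by
    nlinarith [Real.sqrt_nonneg (1 - β ^ 2)]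
  -- `1 + z = √(1 - β²) + i β` is a phase
  set z : ℂ := ⟨Real.sqrt (1 - β ^ 2) - 1, β⟩
  have hzn : ‖z‖ ^ 2 = -(2 * z.re) := by
    rw [← Complex.normSq_eq_norm_sq, Complex.normSq_apply]
    change (Real.sqrt (1 - β ^ 2) - 1) * (Real.sqrt (1 - β ^ 2) - 1) + β * β
      = -(2 * (Real.sqrt (1 - β ^ 2) - 1))
    linarith
  have hzn2 : ‖z‖ ^ 2 ≤ 2 * β ^ 2 := by
    rw [hzn]
    change -(2 * (Real.sqrt (1 - β ^ 2) - 1)) ≤ 2 * β ^ 2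
    linarith
  have hz1 : ‖z‖ ≤ 1 := by
    rw [← sq_le_one_iff₀ (norm_nonneg z)]
    linarith
  have hz0 : z + starRingEnd ℂ z + z * starRingEnd ℂ z = 0 := by
    rw [Complex.mul_conj, Complex.normSq_eq_norm_sq, hzn, Complex.add_conj]
    push_cast
    ring
  have h1 := h z 0 0 hz1 le_rfl (by rw [hzn]; ring) (by
    have e : ketbra (((Real.sqrt 0 : ℝ) : ℂ) • toL2 u) = 0 := by
      rw [Real.sqrt_zero, Complex.ofReal_zero, zero_smul]
      simp [ketbra]
    rw [e, add_zero, add_zero, trace_cfc_F_deform_unitary hb hGp hu hz0])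
  have h2 : (starRingEnd ℂ z * X).re = (Real.sqrt (1 - β ^ 2) - 1) * X.re + β * X.im := by
    rw [Complex.mul_re, Complex.conj_re, Complex.conj_im]
    ring
  rw [h2] at h1
  have h3 : (Real.sqrt (1 - β ^ 2) - 1) * X.re ≤ β ^ 2 * |X.re| := by
    have h4 : -|X.re| ≤ X.re := neg_abs_le _
    nlinarith [abs_nonneg X.re]
  have h5 : ‖z‖ ^ 2 * m * q ≤ 2 * β ^ 2 * |m * q| := by
    rw [mul_assoc]
    exact (mul_le_mul_of_nonneg_left (le_abs_self _) (sq_nonneg _)).trans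
      (mul_le_mul_of_nonneg_right hzn2 (abs_nonneg _))
  have h6 : C * ‖z‖ ^ 2 ≤ C * (2 * β ^ 2) := mul_le_mul_of_nonneg_left hzn2 hC
  linarith

/-- Polarisation: a sesquilinear form vanishing on the diagonal vanishes. -/
theorem sesq_eq_zero {V : Type*} [AddCommGroup V] [Module ℂ V] (B : V → V → ℂ)
    (h1 : ∀ u v w, B (u + v) w = B u w + B v w) (h2 : ∀ u v w, B u (v + w) = B u v + B u w)
    (h3 : ∀ (c : ℂ) u v, B (c • u) v = starRingEnd ℂ c * B u v)
    (h4 : ∀ (c : ℂ) u v, B u (c • v) = c * B u v) (h0 : ∀ u, B u u = 0) (u v : V) : B u v = 0 := by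
  have e1 := h0 (u + v)
  have e2 := h0 (u + Complex.I • v)
  rw [h1, h2, h2, h0, h0] at e1
  rw [h1, h2, h2, h3, h4, h3, h4, h0, h0, Complex.conj_I] at e2
  have e3 : Complex.I * (B u v - B v u) = 0 := by linear_combination e2
  have e4 := (mul_eq_zero.1 e3).resolve_left Complex.I_ne_zero
  linear_combination (1 / 2 : ℂ) * e1 + (1 / 2 : ℂ) * e4

/-- The minimizer commutes with the Hamiltonian, on test functions. -/
theorem IsMinimizer.isSchrodingerPair_apply (hG : IsMinimizer b μ G) (hb : b ≠ 0)
    (hμ : Integrable μ) (hμ0 : ∀ᵐ x, 0 ≤ μ x) (hΦ : Continuous (statePot G μ)) (v : testSpace) :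
    IsSchrodingerPair (statePot G μ) (G (toL2 v)) (G (hamT hΦ v)) := by
  have hGs := hG.isPositive.isSelfAdjoint.isSymmetric
  rw [isSchrodingerPair_iff hΦ]
  intro u
  have hs : ⟪toL2 u, G (hamT hΦ v)⟫_ℂ = ⟪G (toL2 u), hamT hΦ v⟫_ℂ := (hGs _ _).symm
  rw [hs, ← sub_eq_zero]
  refine sesq_eq_zero (fun u v : testSpace => ⟪hamT hΦ u, G (toL2 v)⟫_ℂ
    - ⟪G (toL2 u), hamT hΦ v⟫_ℂ) ?_ ?_ ?_ ?_ ?_ u v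
  · intro u v w
    simp only [map_add, inner_add_left]
    ring
  · intro u v w
    simp only [map_add, inner_add_right]
    ring
  · intro c u v
    simp only [map_smul, inner_smul_left]
    ring
  · intro c u v
    simp only [map_smul, inner_smul_right]
    ring
  · intro u
    have him : ∀ u : testSpace, ‖toL2 u‖ = 1 → ⟪hamT hΦ u, G (toL2 u)⟫_ℂ
        - ⟪G (toL2 u), hamT hΦ u⟫_ℂ = 0 := by
      intro u hu
      rw [← inner_conj_symm (G (toL2 u)), sub_eq_zero, eq_comm, Complex.conj_eq_iff_im]
      exact hG.im_inner_hamT_eq_zero hb hμ hμ0 hΦ hu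
    rcases eq_or_ne (toL2 u) 0 with h0 | h0
    · have hu0 : ∀ w, ⟪hamT hΦ u, w⟫_ℂ = 0 := by
        have := (schrodingerGraph_single_valued (statePot G μ)) (toL2 u, hamT hΦ u)
          (isSchrodingerPair_hamT hΦ u) h0
        intro w
        simp only at this
        rw [this, inner_zero_left]
      simp only [h0, map_zero, inner_zero_left, inner_zero_right, sub_zero]
    · have hn : ‖toL2 u‖ ≠ 0 := norm_ne_zero_iff.2 h0
      have h1 := him (((‖toL2 u‖⁻¹ : ℝ) : ℂ) • u) (by
        rw [map_smul, norm_smul, Complex.norm_real, norm_inv, norm_norm, inv_mul_cancel₀ hn])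
      simp only [map_smul, inner_smul_left, inner_smul_right, ← mul_sub] at h1
      have hne : ((‖toL2 u‖⁻¹ : ℝ) : ℂ) ≠ 0 := Complex.ofReal_ne_zero.2 (inv_ne_zero hn)
      exact (mul_eq_zero.1 ((mul_eq_zero.1 h1).resolve_left hne)).resolve_left
        ((map_ne_zero _).2 hne)

end Commutation

end RHF

end

noncomputable section

namespace RHF

/-! ### Comparison of deformed states and the first variation inequality -/

section Comparison

variable {b : ℝ} {μ : ℝ → ℝ} {G : L2R →L[ℂ] L2R}

theorem trace_mono {A B : L2R →L[ℂ] L2R} (hA : A.IsPositive) (hAB : A ≤ B) :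
    trace A ≤ trace B := by
  have : B = A + (B - A) := by abel
  rw [this, trace_add hA hAB]
  exact le_self_add

/-- `A` is a nonnegative operator with the finite trace `a`. -/
def HasTrace (A : L2R →L[ℂ] L2R) (a : ℝ) : Prop :=
  A.IsPositive ∧ 0 ≤ a ∧ trace A = ENNReal.ofReal a

theorem HasTrace.add {A B : L2R →L[ℂ] L2R} {x y : ℝ} (hA : HasTrace A x) (hB : HasTrace B y) :
    HasTrace (A + B) (x + y) :=
  ⟨hA.1.add hB.1, add_nonneg hA.2.1 hB.2.1, by
    rw [trace_add hA.1 hB.1, hA.2.2, hB.2.2, ENNReal.ofReal_add hA.2.1 hB.2.1]⟩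

theorem hasTrace_smul_ketbra {c : ℝ} (hc : 0 ≤ c) (v : L2R) :
    HasTrace (c • ketbra v) (c * ‖v‖ ^ 2) :=
  ⟨smul_ketbra_isPositive hc v, by positivity, trace_smul_ketbra hc v⟩

theorem re_inner_smul_ketbra (c : ℝ) (v x : L2R) :
    (⟪x, (c • ketbra v) x⟫_ℂ).re = c * ‖⟪v, x⟫_ℂ‖ ^ 2 := by
  rw [real_smul_apply, inner_smul_right, Complex.re_ofReal_mul, re_inner_ketbra]

theorem re_inner_deform (hG : IsSelfAdjoint G) (u x : L2R) (t : ℝ) :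
    (⟪x, deform G u ((-t : ℝ) : ℂ) x⟫_ℂ).re = (⟪x, G x⟫_ℂ).re
      - 2 * t * (starRingEnd ℂ ⟪u, x⟫_ℂ * ⟪G u, x⟫_ℂ).re
      + t ^ 2 * (⟪u, G u⟫_ℂ).re * ‖⟪u, x⟫_ℂ‖ ^ 2 := by
  have h : deform G u ((-t : ℝ) : ℂ) x = G x
      + (starRingEnd ℂ ((-t : ℝ) : ℂ) * ⟪u, x⟫_ℂ) • G u
      + (((-t : ℝ) : ℂ) * (⟪G u, x⟫_ℂ + starRingEnd ℂ ((-t : ℝ) : ℂ) * ⟪u, x⟫_ℂ * ⟪u, G u⟫_ℂ)) • u :=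
    deform_apply hG u _ x
  rw [h, inner_add_right, inner_add_right, inner_smul_right, inner_smul_right,
    ← inner_conj_symm x (G u), ← inner_conj_symm x u, Complex.conj_ofReal,
    inner_apply_self_eq_re hG u]
  generalize ⟪u, x⟫_ℂ = p
  generalize ⟪G u, x⟫_ℂ = q
  rw [← Complex.normSq_eq_norm_sq, Complex.normSq_apply]
  simp only [Complex.add_re, Complex.mul_re, Complex.mul_im, Complex.ofReal_re, Complex.ofReal_im,
    Complex.conj_re, Complex.conj_im, Complex.add_im]
  ring

theorem two_mul_le_div_add {x y η : ℝ} (hη : 0 < η) : 2 * (x * y) ≤ x ^ 2 / η + η * y ^ 2 := by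
  have h : x ^ 2 / η + η * y ^ 2 - 2 * (x * y) = (x - η * y) ^ 2 / η := by
    field_simp
    ring
  have := div_nonneg (sq_nonneg (x - η * y)) hη.le
  linarith

theorem abs_re_conj_mul_le (x y : ℂ) : |(starRingEnd ℂ x * y).re| ≤ ‖x‖ * ‖y‖ := by
  refine (Complex.abs_re_le_norm _).trans ?_
  rw [norm_mul, RCLike.norm_conj]

/-- The error operator in the comparison of the deformations along `(u, φ)` and `(e, f)`. -/
def errOp (G : L2R →L[ℂ] L2R) (u φ e f : L2R) (η t m s : ℝ) : L2R →L[ℂ] L2R :=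
  (t / η) • ketbra (u - e) + (t * η) • ketbra (G u) + ((t * η) • ketbra e
    + (t / η) • ketbra (G (u - e))) + (t ^ 2 * m) • ketbra u
    + ((s / (2 * η)) • ketbra (φ - f) + (s * η / 2) • ketbra (φ + f))

theorem hasTrace_errOp (u φ e f : L2R) {η t m s : ℝ} (hη : 0 < η) (ht : 0 ≤ t) (hm : 0 ≤ m)
    (hs : 0 ≤ s) : HasTrace (errOp G u φ e f η t m s) (t / η * ‖u - e‖ ^ 2 + t * η * ‖G u‖ ^ 2
      + (t * η * ‖e‖ ^ 2 + t / η * ‖G (u - e)‖ ^ 2) + t ^ 2 * m * ‖u‖ ^ 2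
      + (s / (2 * η) * ‖φ - f‖ ^ 2 + s * η / 2 * ‖φ + f‖ ^ 2)) :=
  (((((hasTrace_smul_ketbra (by positivity) _).add (hasTrace_smul_ketbra (by positivity) _)).add
    ((hasTrace_smul_ketbra (by positivity) _).add (hasTrace_smul_ketbra (by positivity) _))).add
    (hasTrace_smul_ketbra (by positivity) _))).add
    ((hasTrace_smul_ketbra (by positivity) _).add (hasTrace_smul_ketbra (by positivity) _))

/-- The deformations are compared as quadratic forms; the mixed terms are split by Young's inequality
with the parameter `η`. -/
theorem deform_le_deform_add_errOp (hG : G.IsPositive) (u φ e f : L2R) {η t m s : ℝ} (hη : 0 < η)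
    (ht : 0 ≤ t) (hm : (⟪u, G u⟫_ℂ).re = m) (hs : 0 ≤ s) :
    deform G u ((-t : ℝ) : ℂ) + ketbra (((Real.sqrt s : ℝ) : ℂ) • φ)
      ≤ deform G e ((-t : ℝ) : ℂ) + ketbra (((Real.sqrt s : ℝ) : ℂ) • f)
        + errOp G u φ e f η t m s := by
  have hm0 : 0 ≤ m := hm ▸ hG.re_inner_nonneg_right u
  have hsa := hG.isSelfAdjoint
  refine le_of_re_inner
    ((deform_isPositive hG _ _).add (ketbra_isPositive _)).isSelfAdjoint
    (((deform_isPositive hG _ _).add (ketbra_isPositive _)).add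
      (hasTrace_errOp u φ e f hη ht hm0 hs).1).isSelfAdjoint fun x => ?_
  rw [← smul_ketbra hs, ← smul_ketbra hs]
  simp only [errOp, add_apply, inner_add_right, Complex.add_re, re_inner_smul_ketbra,
    re_inner_deform hsa, hm]
  rw [map_sub]
  simp only [inner_sub_left, inner_add_left]
  have he : 0 ≤ t ^ 2 * (⟪e, G e⟫_ℂ).re * ‖⟪e, x⟫_ℂ‖ ^ 2 :=
    mul_nonneg (mul_nonneg (sq_nonneg _) (hG.re_inner_nonneg_right e)) (sq_nonneg _)
  generalize ⟪u, x⟫_ℂ = pu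
  generalize ⟪e, x⟫_ℂ = pe at he ⊢
  generalize ⟪G u, x⟫_ℂ = qu
  generalize ⟪G e, x⟫_ℂ = qe
  generalize ⟪φ, x⟫_ℂ = a
  generalize ⟪f, x⟫_ℂ = c
  have h1 : (starRingEnd ℂ pu * qu).re = (starRingEnd ℂ pe * qe).re
      + (starRingEnd ℂ (pu - pe) * qu).re + (starRingEnd ℂ pe * (qu - qe)).re := by
    rw [← Complex.add_re, ← Complex.add_re, map_sub]
    congr 1
    ring
  have h2 := (abs_le.1 (abs_re_conj_mul_le (pu - pe) qu)).1
  have h3 := (abs_le.1 (abs_re_conj_mul_le pe (qu - qe))).1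
  have h4 := two_mul_le_div_add (x := ‖pu - pe‖) (y := ‖qu‖) hη
  have h5 := two_mul_le_div_add (x := ‖qu - qe‖) (y := ‖pe‖) hη
  have h6 : ‖a‖ ^ 2 - ‖c‖ ^ 2 = (starRingEnd ℂ (a - c) * (a + c)).re := by
    rw [← Complex.normSq_eq_norm_sq, ← Complex.normSq_eq_norm_sq, Complex.normSq_apply,
      Complex.normSq_apply]
    simp only [Complex.mul_re, Complex.conj_re, Complex.conj_im, Complex.sub_re, Complex.sub_im,
      Complex.add_re, Complex.add_im]
    ring
  have h7 := (abs_le.1 (abs_re_conj_mul_le (a - c) (a + c))).2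
  have h8 := two_mul_le_div_add (x := ‖a - c‖) (y := ‖a + c‖) hη
  have h9 : s * ‖a‖ ^ 2 ≤ s * ‖c‖ ^ 2
      + (s / (2 * η) * ‖a - c‖ ^ 2 + s * η / 2 * ‖a + c‖ ^ 2) := by
    have : s / (2 * η) * ‖a - c‖ ^ 2 + s * η / 2 * ‖a + c‖ ^ 2
        = s / 2 * (‖a - c‖ ^ 2 / η + η * ‖a + c‖ ^ 2) := by
      field_simp
    rw [this]
    have := mul_le_mul_of_nonneg_left (show ‖a‖ ^ 2 - ‖c‖ ^ 2
      ≤ (‖a - c‖ ^ 2 / η + η * ‖a + c‖ ^ 2) / 2 by linarith) hs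
    linarith
  have h10 : -(2 * t * (starRingEnd ℂ pu * qu).re) ≤ -(2 * t * (starRingEnd ℂ pe * qe).re)
      + (t / η * ‖pu - pe‖ ^ 2 + t * η * ‖qu‖ ^ 2 + (t * η * ‖pe‖ ^ 2 + t / η * ‖qu - qe‖ ^ 2)) := by
    have : t / η * ‖pu - pe‖ ^ 2 + t * η * ‖qu‖ ^ 2 + (t * η * ‖pe‖ ^ 2 + t / η * ‖qu - qe‖ ^ 2)
        = t * (‖pu - pe‖ ^ 2 / η + η * ‖qu‖ ^ 2 + (‖qu - qe‖ ^ 2 / η + η * ‖pe‖ ^ 2)) := by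
      field_simp
      ring
    rw [this, h1]
    have := mul_le_mul_of_nonneg_left (show -(2 * ((starRingEnd ℂ (pu - pe) * qu).re
      + (starRingEnd ℂ pe * (qu - qe)).re)) ≤ ‖pu - pe‖ ^ 2 / η + η * ‖qu‖ ^ 2
        + (‖qu - qe‖ ^ 2 / η + η * ‖pe‖ ^ 2) by linarith) ht
    linarith
  linarith

theorem nonneg_of_forall_add_sq {A B : ℝ} (h : ∀ t : ℝ, 0 < t → t ≤ 1 → 0 ≤ t * A + t ^ 2 * B) :
    0 ≤ A := by
  by_contra hA
  push Not at hA
  have hB : 0 < |B| - A + 1 := by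
    have := abs_nonneg B
    linarith
  have ht : 0 < -A / (|B| - A + 1) := div_pos (by linarith) hB
  have h1 := h _ ht (by
    rw [div_le_one hB]
    have := abs_nonneg B
    linarith)
  have h2 : -A / (|B| - A + 1) * A + (-A / (|B| - A + 1)) ^ 2 * B
      = -A / (|B| - A + 1) * (A + -A / (|B| - A + 1) * B) := by ring
  rw [h2] at h1
  have h3 : 0 ≤ A + -A / (|B| - A + 1) * B := nonneg_of_mul_nonneg_right h1 ht
  have h4 : -A / (|B| - A + 1) * B ≤ -A / (|B| - A + 1) * |B| :=
    mul_le_mul_of_nonneg_left (le_abs_self B) ht.le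
  have h5 : -A / (|B| - A + 1) * |B| < -A := by
    rw [div_mul_eq_mul_div, div_lt_iff₀ hB]
    nlinarith [abs_nonneg B]
  linarith

/-- The first variation inequality. Particles are moved from `u` to `φ`, and the change of
`Tr F(b, ·)` is controlled by the one along a reference pair `(e, f)`. -/
theorem IsMinimizer.first_variation (hG : IsMinimizer b μ G) (hb : b ≠ 0) (hμ : Integrable μ)
    (hμ0 : ∀ᵐ x, 0 ≤ μ x) (hΦ : Continuous (statePot G μ)) {u φ : testSpace}
    (hu : ‖toL2 u‖ = 1) (hφ : ‖toL2 φ‖ = 1) {m : ℝ} (hm : (⟪toL2 u, G (toL2 u)⟫_ℂ).re = m)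
    (e f : L2R) {K₁ γ γ₂ : ℝ}
    (hT : ∀ t s : ℝ, 0 < t → t ≤ 1 → s = (2 * t - t ^ 2) * m →
      trace (deform G e ((-t : ℝ) : ℂ) + ketbra (((Real.sqrt s : ℝ) : ℂ) • f)) ≤ ENNReal.ofReal K₁ ∧
      (trace (cfc (F b) (deform G e ((-t : ℝ) : ℂ)
        + ketbra (((Real.sqrt s : ℝ) : ℂ) • f)))).toReal
          ≤ (trace (cfc (F b) G)).toReal + t * γ + t ^ 2 * γ₂)
    {η D : ℝ} (hη : 0 < η) (hK₁ : 0 ≤ K₁) (hD : ‖toL2 u - e‖ ^ 2 / η + η * ‖G (toL2 u)‖ ^ 2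
      + η * ‖e‖ ^ 2 + ‖G (toL2 u - e)‖ ^ 2 / η
      + m * (‖toL2 φ - f‖ ^ 2 / η + η * ‖toL2 φ + f‖ ^ 2) ≤ D) :
    2 * (⟪hamT hΦ u, G (toL2 u)⟫_ℂ).re ≤ 2 * m * (⟪hamT hΦ φ, toL2 φ⟫_ℂ).re + γ
      + (2 * Real.pi * (K₁ + (D + m)) + |b|) * D := by
  have hGp := hG.isPositive
  have hm0 : 0 ≤ m := hm ▸ hGp.re_inner_nonneg_right _
  have hD0 : 0 ≤ D := le_trans (by positivity) hD
  obtain ⟨C, hC, h⟩ := hG.exists_deform_bound hb hμ hμ0 hΦ u φ hu hφ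
    (m := m) (by rw [inner_apply_self_eq_re hGp.isSelfAdjoint, hm])
  set L := 2 * Real.pi * (K₁ + (D + m)) + |b| with hL
  have hL0 : 0 ≤ L := by positivity
  set X := (⟪hamT hΦ u, G (toL2 u)⟫_ℂ).re
  set q := (⟪hamT hΦ u, toL2 u⟫_ℂ).re
  set p := (⟪hamT hΦ φ, toL2 φ⟫_ℂ).re
  have key : 0 ≤ -2 * X + 2 * m * p + γ + L * D := by
    refine nonneg_of_forall_add_sq (B := m * q - m * p + γ₂ + L * m + C) fun t ht ht1 => ?_
    set s := (2 * t - t ^ 2) * m with hs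
    have hs0 : 0 ≤ s := mul_nonneg (by nlinarith) hm0
    have hs1 : s ≤ 2 * t * m := by
      rw [hs]
      nlinarith [mul_nonneg (sq_nonneg t) hm0]
    obtain ⟨hT1, hT2⟩ := hT t s ht ht1 hs
    have hle := deform_le_deform_add_errOp hGp (toL2 u) (toL2 φ) e f hη ht.le hm hs0
    have hC' := hasTrace_errOp (G := G) (toL2 u) (toL2 φ) e f hη ht.le hm0 hs0
    set T := deform G e ((-t : ℝ) : ℂ) + ketbra (((Real.sqrt s : ℝ) : ℂ) • f)
    set A := deform G (toL2 u) ((-t : ℝ) : ℂ) + ketbra (((Real.sqrt s : ℝ) : ℂ) • toL2 φ)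
    set E := errOp G (toL2 u) (toL2 φ) e f η t m s
    have hTp : T.IsPositive := (deform_isPositive hGp _ _).add (ketbra_isPositive _)
    have hAp : A.IsPositive := (deform_isPositive hGp _ _).add (ketbra_isPositive _)
    have hTt : trace T ≠ ⊤ := ne_top_of_le_ne_top ENNReal.ofReal_ne_top hT1
    have hEt : trace E ≠ ⊤ := by
      rw [hC'.2.2]
      exact ENNReal.ofReal_ne_top
    have hAt : trace A ≠ ⊤ := by
      refine ne_top_of_le_ne_top ?_ (trace_mono hAp hle)
      rw [trace_add hTp hC'.1]
      exact ENNReal.add_ne_top.2 ⟨hTt, hEt⟩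
    have hEr : (trace E).toReal ≤ t * D + t ^ 2 * m := by
      rw [hC'.2.2, ENNReal.toReal_ofReal hC'.2.1, hu]
      have e1 : s / (2 * η) * ‖toL2 φ - f‖ ^ 2 + s * η / 2 * ‖toL2 φ + f‖ ^ 2
          = s / 2 * (‖toL2 φ - f‖ ^ 2 / η + η * ‖toL2 φ + f‖ ^ 2) := by
        field_simp
      have e2 : s / 2 * (‖toL2 φ - f‖ ^ 2 / η + η * ‖toL2 φ + f‖ ^ 2)
          ≤ t * m * (‖toL2 φ - f‖ ^ 2 / η + η * ‖toL2 φ + f‖ ^ 2) :=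
        mul_le_mul_of_nonneg_right (by linarith) (by positivity)
      have e3 := mul_le_mul_of_nonneg_left hD ht.le
      have e4 : t / η * ‖toL2 u - e‖ ^ 2 + t * η * ‖G (toL2 u)‖ ^ 2
          + (t * η * ‖e‖ ^ 2 + t / η * ‖G (toL2 u - e)‖ ^ 2)
          = t * (‖toL2 u - e‖ ^ 2 / η + η * ‖G (toL2 u)‖ ^ 2 + η * ‖e‖ ^ 2
            + ‖G (toL2 u - e)‖ ^ 2 / η) := by
        field_simp
        ring
      rw [e1, e4]
      linarith
    have hF := trace_cfc_F_le hb hAp hTp hC'.1 hAt hTt hEt hle (m := K₁ + (D + m)) (by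
      have h1 : (trace T).toReal ≤ K₁ := by
        have := ENNReal.toReal_mono ENNReal.ofReal_ne_top hT1
        rwa [ENNReal.toReal_ofReal hK₁] at this
      have h2 : t * D + t ^ 2 * m ≤ D + m := by
        have := mul_le_of_le_one_left hD0 ht1
        have := mul_le_of_le_one_left hm0 (show t ^ 2 ≤ 1 by nlinarith)
        linarith
      linarith)
    have hF' := ENNReal.toReal_mono (ENNReal.add_ne_top.2 ⟨trace_cfc_F_ne_top hb hTp hTt,
      ENNReal.mul_ne_top ENNReal.ofReal_ne_top hEt⟩) hF
    rw [ENNReal.toReal_add (trace_cfc_F_ne_top hb hTp hTt)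
      (ENNReal.mul_ne_top ENNReal.ofReal_ne_top hEt), ENNReal.toReal_mul,
      ENNReal.toReal_ofReal hL0] at hF'
    have hnz : ‖((-t : ℝ) : ℂ)‖ = t := by
      rw [Complex.norm_real, norm_neg, Real.norm_of_nonneg ht.le]
    have h1 := h ((-t : ℝ) : ℂ) s (t * γ + t ^ 2 * γ₂ + L * (t * D + t ^ 2 * m))
      (by rw [hnz]; exact ht1) hs0 (by rw [hnz, Complex.ofReal_re, hs]; ring) (by
        have := mul_le_mul_of_nonneg_left hEr hL0
        linarith)
    rw [hnz, Complex.conj_ofReal, Complex.re_ofReal_mul, hs] at h1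
    linarith
  linarith

end Comparison

end RHF

end

noncomputable section

namespace RHF

/-! ### The mean-field potential is bounded below -/

section LowerBound

variable {b : ℝ} {μ : ℝ → ℝ} {G : L2R →L[ℂ] L2R}

theorem exists_unit_test_pos (hG : G.IsPositive) (hG0 : G ≠ 0) :
    ∃ u : testSpace, ‖toL2 u‖ = 1 ∧ 0 < (⟪toL2 u, G (toL2 u)⟫_ℂ).re := by
  by_contra hc
  push Not at hc
  refine hG0 ?_
  have h1 : ∀ u : testSpace, CFC.sqrt G (toL2 u) = 0 := by
    intro u
    rcases eq_or_ne (toL2 u) 0 with h0 | h0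
    · rw [h0, map_zero]
    · have hn : ‖toL2 u‖ ≠ 0 := norm_ne_zero_iff.2 h0
      have h2 := hc (((‖toL2 u‖⁻¹ : ℝ) : ℂ) • u) (by
        rw [map_smul, norm_smul, Complex.norm_real, norm_inv, norm_norm, inv_mul_cancel₀ hn])
      rw [re_inner_eq_norm_sqrt hG, map_smul, map_smul] at h2
      have h3 : ‖((‖toL2 u‖⁻¹ : ℝ) : ℂ) • CFC.sqrt G (toL2 u)‖ = 0 := by
        have := sq_nonneg ‖((‖toL2 u‖⁻¹ : ℝ) : ℂ) • CFC.sqrt G (toL2 u)‖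
        exact pow_eq_zero_iff two_ne_zero |>.1 (le_antisymm h2 this)
      rw [norm_eq_zero, smul_eq_zero] at h3
      exact h3.resolve_left (Complex.ofReal_ne_zero.2 (inv_ne_zero hn))
  have h2 : ∀ x : L2R, CFC.sqrt G x = 0 := fun x =>
    congrFun (dense_toL2.equalizer (CFC.sqrt G).continuous continuous_const
      (funext fun u => h1 u)) x
  ext1 x
  rw [← sqrt_sqrt_apply hG, h2]
  rfl

theorem ketbra_zero : ketbra (0 : L2R) = 0 := by
  simp [ketbra]

theorem deform_zero (G : L2R →L[ℂ] L2R) (z : ℂ) : deform G 0 z = G := by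
  have h : (1 + z • ketbra (0 : L2R)) = 1 := by rw [ketbra_zero, smul_zero, add_zero]
  change (1 + z • ketbra (0 : L2R)) * G * star (1 + z • ketbra (0 : L2R)) = G
  rw [h, star_one, one_mul, mul_one]

/-- The Hamiltonian is bounded below on test functions: otherwise moving particles from a fixed
state to states of very negative energy would lower the total energy. -/
theorem IsMinimizer.exists_form_lower_bound (hG : IsMinimizer b μ G) (hb : b ≠ 0)
    (hμ : Integrable μ) (hμ0 : ∀ᵐ x, 0 ≤ μ x) (hΦ : Continuous (statePot G μ)) (hG0 : G ≠ 0) :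
    ∃ C, ∀ φ : testSpace, C * ‖toL2 φ‖ ^ 2 ≤ (⟪hamT hΦ φ, toL2 φ⟫_ℂ).re := by
  obtain ⟨u, hu, hm⟩ := exists_unit_test_pos hG.isPositive hG0
  set m := (⟪toL2 u, G (toL2 u)⟫_ℂ).re with hmdef
  set w := G (toL2 u) with hw
  set D := 2 * ‖w‖ ^ 2 + 1 + 2 * m with hD
  set L := 2 * Real.pi * ((trace G).toReal + (D + m)) + |b| with hL
  have hgt := hG.trace_ne_top
  have h1 : ∀ φ : testSpace, ‖toL2 φ‖ = 1 →
      (2 * (⟪hamT hΦ u, w⟫_ℂ).re - L * D) / (2 * m) ≤ (⟪hamT hΦ φ, toL2 φ⟫_ℂ).re := by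
    intro φ hφ
    have h := hG.first_variation hb hμ hμ0 hΦ hu hφ hmdef.symm 0 0 (K₁ := (trace G).toReal)
      -- for the reference pair `e = f = 0` the comparison operator is `G` itself
      (γ := 0) (γ₂ := 0) (η := 1) (D := D) (fun t s _ _ _ => by
        rw [deform_zero, smul_zero, ketbra_zero, add_zero, ENNReal.ofReal_toReal hgt]
        exact ⟨le_rfl, by simp⟩) one_pos ENNReal.toReal_nonneg (by
        rw [sub_zero, sub_zero, add_zero, norm_zero, hu, hφ, ← hw, hD]
        apply le_of_eq
        ring)
    rw [div_le_iff₀ (by positivity)]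
    linarith
  refine ⟨(2 * (⟪hamT hΦ u, w⟫_ℂ).re - L * D) / (2 * m), fun φ => ?_⟩
  rcases eq_or_ne (toL2 φ) 0 with h0 | h0
  · simp [h0]
  · have hn : ‖toL2 φ‖ ≠ 0 := norm_ne_zero_iff.2 h0
    have h2 := h1 (((‖toL2 φ‖⁻¹ : ℝ) : ℂ) • φ) (by
      rw [map_smul, norm_smul, Complex.norm_real, norm_inv, norm_norm, inv_mul_cancel₀ hn])
    rw [map_smul, map_smul, inner_smul_left, inner_smul_right, Complex.conj_ofReal,
      Complex.re_ofReal_mul, Complex.re_ofReal_mul] at h2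
    have h3 := mul_le_mul_of_nonneg_right h2 (sq_nonneg ‖toL2 φ‖)
    refine h3.trans (le_of_eq ?_)
    field_simp

theorem norm_toL2_sq (u : testSpace) : ‖toL2 u‖ ^ 2 = ∫ x, ‖(u : ℝ → ℂ) x‖ ^ 2 := by
  rw [← integral_normSq]
  refine integral_congr_ae ?_
  filter_upwards [coeFn_toL2 u] with x hx
  rw [hx]

theorem exists_test_bump : ∃ χ : ℝ → ℝ, IsTestFunction χ ∧ (∀ x, 1 ≤ |x| → χ x = 0) ∧
    0 < ∫ x, χ x ^ 2 := by
  let c : ContDiffBump (0 : ℝ) := ⟨1 / 2, 1, by norm_num, by norm_num⟩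
  refine ⟨c, ⟨c.contDiff, c.hasCompactSupport⟩, fun x hx => c.zero_of_le_dist ?_, ?_⟩
  · rw [Real.dist_eq, sub_zero]
    exact hx
  · have hcont : Continuous fun x => (c x) ^ 2 := c.continuous.pow 2
    have hs : HasCompactSupport fun x => (c x) ^ 2 :=
      c.hasCompactSupport.mono fun x hx h => hx (by simp [h])
    refine hcont.integral_pos_of_hasCompactSupport_nonneg_nonzero hs (fun x => sq_nonneg _)
      (x := 0) ?_
    rw [c.one_of_mem_closedBall (by simp [c.rIn_pos.le])]
    norm_num

/-- Translates of one test function turn a lower bound of the quadratic form into a pointwise lower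
bound of the Lipschitz continuous potential. -/
theorem exists_le_of_form_lower_bound {Φ : ℝ → ℝ} (hΦ : Continuous Φ) {K C : ℝ}
    (hK : ∀ x y, |Φ x - Φ y| ≤ K * |x - y|)
    (hC : ∀ φ : testSpace, C * ‖toL2 φ‖ ^ 2 ≤ (⟪hamT hΦ φ, toL2 φ⟫_ℂ).re) :
    ∃ c, ∀ y, c ≤ Φ y := by
  obtain ⟨χ, hχ, hχ0, hn⟩ := exists_test_bump
  set n := ∫ x, χ x ^ 2 with hndef
  set k := ∫ x, deriv χ x ^ 2 with hkdef
  have hK0 : 0 ≤ K := by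
    have := (abs_nonneg _).trans (hK 1 0)
    simpa using this
  refine ⟨(C * n - k / 2) / n - K, fun y => ?_⟩
  have hty : IsTestFunction fun x => χ (x - y) :=
    ⟨hχ.1.comp (contDiff_id.sub contDiff_const), by
      have := hχ.2.comp_homeomorph (Homeomorph.subRight y)
      exact this⟩
  have h := hC (ofRealT _ hty)
  rw [re_inner_hamT_self, norm_toL2_sq, norm_toL2_sq, derivT_ofRealT] at h
  have hnorm : ∀ r : ℝ, ‖(r : ℂ)‖ ^ 2 = r ^ 2 := fun r => by
    rw [Complex.norm_real, Real.norm_eq_abs, sq_abs]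
  simp only [ofRealT_apply, hnorm] at h
  have hd : (deriv fun x => χ (x - y)) = fun x => deriv χ (x - y) :=
    funext fun x => deriv_comp_sub_const (f := χ) (a := y) (x := x)
  rw [hd, integral_sub_right_eq_self (fun x => χ x ^ 2) y,
    integral_sub_right_eq_self (fun x => deriv χ x ^ 2) y, ← hndef, ← hkdef] at h
  have hi : Integrable fun x => χ (x - y) ^ 2 := by
    have : Integrable fun x => χ x ^ 2 :=
      (hχ.1.continuous.pow 2).integrable_of_hasCompactSupport
        (hχ.2.mono fun x hx h => hx (by simp [h]))
    exact this.comp_sub_right y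
  have hle : ∫ x, Φ x * χ (x - y) ^ 2 ≤ (Φ y + K) * n := by
    rw [hndef, ← integral_sub_right_eq_self (fun x => χ x ^ 2) y, ← integral_const_mul]
    have hi2 := integrable_mul_normSq hΦ (ofRealT _ hty)
    simp only [ofRealT_apply, hnorm] at hi2
    refine integral_mono hi2 (hi.const_mul _) fun x => ?_
    rcases le_total 1 |x - y| with h1 | h1
    · simp [hχ0 _ h1]
    · refine mul_le_mul_of_nonneg_right ?_ (sq_nonneg _)
      have := (abs_le.1 (hK x y)).2
      nlinarith
  rw [sub_le_iff_le_add, div_le_iff₀ hn]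
  linarith

/-- The state `G = 0` is admissible only for `μ = 0`. -/
theorem IsMinimizer.meanField_eq_zero (hG : IsMinimizer b μ G) (hμ : Integrable μ)
    (hμ0 : ∀ᵐ x, 0 ≤ μ x) (hG0 : G = 0) : statePot G μ = 0 := by
  have ht : trace G = 0 := by rw [hG0, trace_zero]
  have h1 : ∫ x, μ x = 0 := by
    have h2 := hG.1.2
    rw [ht, eq_comm, ENNReal.ofReal_eq_zero] at h2
    exact le_antisymm h2 (integral_nonneg_of_ae hμ0)
  have h3 : ∫ x, density G x = 0 := by
    rw [integral_density hG.isPositive hG.trace_ne_top, ht, ENNReal.toReal_zero]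
  rw [integral_eq_zero_iff_of_nonneg_ae hμ0 hμ] at h1
  rw [integral_eq_zero_iff_of_nonneg_ae (ae_of_all _ (density_nonneg G))
    (integrable_density hG.isPositive hG.trace_ne_top)] at h3
  have h4 : ∀ x, primitive (fun x => density G x - μ x) x = 0 := fun x => by
    refine integral_eq_zero_of_ae (ae_restrict_of_ae ?_)
    filter_upwards [h1, h3] with t e1 e2
    simp only [e1, e2, Pi.zero_apply, sub_zero]
  funext x
  simp [statePot, meanField, h4]

theorem IsMinimizer.integrable_sub (hG : IsMinimizer b μ G) (hμ : Integrable μ) :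
    Integrable fun x => density G x - μ x :=
  (integrable_density hG.isPositive hG.trace_ne_top).sub hμ

theorem IsMinimizer.continuous_statePot (hG : IsMinimizer b μ G) (hμ : Integrable μ) :
    Continuous (statePot G μ) :=
  continuous_meanField (hG.integrable_sub hμ)

theorem IsMinimizer.exists_le_statePot (hG : IsMinimizer b μ G) (hb : b ≠ 0)
    (hμ : Integrable μ) (hμ0 : ∀ᵐ x, 0 ≤ μ x) : ∃ c, ∀ y, c ≤ statePot G μ y := by
  rcases eq_or_ne G 0 with hG0 | hG0
  · refine ⟨0, fun y => ?_⟩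
    rw [hG.meanField_eq_zero hμ hμ0 hG0]
    exact le_rfl
  · have hΦ := hG.continuous_statePot hμ
    obtain ⟨C, hC⟩ := hG.exists_form_lower_bound hb hμ hμ0 hΦ hG0
    obtain ⟨K, hK⟩ := exists_lipschitz_meanField (hG.integrable_sub hμ)
    exact exists_le_of_form_lower_bound hΦ hK hC

end LowerBound

end RHF

end

noncomputable section

namespace RHF

/-! ### The lemma of du Bois-Reymond and uniqueness for `-½ ψ'' + V ψ = 0` -/

section DuBoisReymond

variable {T A g : ℝ → ℝ}

theorem exists_support_bound {φ : ℝ → ℝ} (hφ : HasCompactSupport φ) :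
    ∃ N, 0 ≤ N ∧ ∀ x, N < |x| → φ x = 0 := by
  obtain ⟨N, hN⟩ := hφ.isCompact.isBounded.exists_norm_le
  refine ⟨max N 0, le_max_right _ _, fun x hx => ?_⟩
  by_contra hc
  exact absurd (hN x (subset_tsupport _ hc)) (not_le.2 ((le_max_left _ _).trans_lt hx))

theorem integrable_test_mul {φ : ℝ → ℝ} (hφ : IsTestFunction φ) (hT : LocallyIntegrable T) :
    Integrable fun x => φ x * T x :=
  hT.integrable_smul_left_of_hasCompactSupport hφ.1.continuous hφ.2

theorem integrable_test {φ : ℝ → ℝ} (hφ : IsTestFunction φ) : Integrable φ :=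
  hφ.1.continuous.integrable_of_hasCompactSupport hφ.2

theorem exists_test_antideriv {φ : ℝ → ℝ} (hφ : IsTestFunction φ) (h0 : ∫ x, φ x = 0) :
    ∃ θ, IsTestFunction θ ∧ deriv θ = φ := by
  have hi := integrable_test hφ
  have hd : ∀ x, HasDerivAt (primitive φ) (φ x) x := fun x => by
    rw [primitive_eq hi]
    exact (hφ.1.continuous.integral_hasStrictDerivAt 0 x).hasDerivAt.const_add _
  have hde : deriv (primitive φ) = φ := funext fun x => (hd x).deriv
  obtain ⟨N, hN, hs⟩ := exists_support_bound hφ.2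
  refine ⟨primitive φ, ⟨contDiff_infty_iff_deriv.2 ⟨fun x => (hd x).differentiableAt, ?_⟩, ?_⟩, hde⟩
  · rw [hde]
    exact hφ.1
  · refine HasCompactSupport.intro (K := Set.Icc (-N) N) isCompact_Icc fun x hx => ?_
    refine primitive_eq_zero_of_support h0 (ae_of_all _ hs) ?_
    rw [le_abs]
    by_contra hc
    push Not at hc
    exact hx ⟨by linarith, hc.1.le⟩

theorem exists_test_integral_one : ∃ χ, IsTestFunction χ ∧ ∫ x, χ x = 1 := by
  obtain ⟨χ, hχ, -, hpos⟩ := exists_test_bump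
  refine ⟨fun x => (∫ x, χ x ^ 2)⁻¹ * χ x ^ 2, ⟨contDiff_const.mul (hχ.1.pow 2), ?_⟩, ?_⟩
  · exact hχ.2.mono fun x hx h => hx (by simp [h])
  · rw [integral_const_mul, inv_mul_cancel₀ hpos.ne']

theorem IsTestFunction.sub_const_mul {φ χ : ℝ → ℝ} (hφ : IsTestFunction φ) (hχ : IsTestFunction χ)
    (c : ℝ) : IsTestFunction fun x => φ x - c * χ x :=
  ⟨hφ.1.sub (contDiff_const.mul hχ.1), hφ.2.sub hχ.2.mul_left⟩

/-- The lemma of du Bois-Reymond. -/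
theorem ae_eq_const_of_integral_deriv_mul (hT : LocallyIntegrable T)
    (h : ∀ φ, IsTestFunction φ → ∫ x, deriv φ x * T x = 0) : ∃ c, T =ᵐ[volume] fun _ => c := by
  obtain ⟨χ, hχ, hχ1⟩ := exists_test_integral_one
  set c := ∫ x, χ x * T x with hc
  refine ⟨c, ?_⟩
  have hTc : LocallyIntegrable fun x => T x - c := hT.sub (locallyIntegrable_const c)
  have h1 := ae_eq_zero_of_integral_contDiff_smul_eq_zero hTc fun φ hφ hφ' => by
    have hφt : IsTestFunction φ := ⟨hφ, hφ'⟩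
    have hi := integrable_test hφt
    obtain ⟨θ, hθ, hθ'⟩ := exists_test_antideriv (hφt.sub_const_mul hχ (∫ x, φ x)) (by
      rw [integral_sub hi ((integrable_test hχ).const_mul _), integral_const_mul, hχ1, mul_one,
        sub_self])
    have h2 := h θ hθ
    rw [hθ'] at h2
    have h3 : ∫ x, (φ x - (∫ x, φ x) * χ x) * T x = (∫ x, φ x * T x) - (∫ x, φ x) * c := by
      rw [hc, ← integral_const_mul, ← integral_sub (integrable_test_mul hφt hT)
        ((integrable_test_mul hχ hT).const_mul _)]
      refine integral_congr_ae (ae_of_all _ fun x => ?_)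
      ring
    have h4 : ∫ x, φ x • (T x - c) = (∫ x, φ x * T x) - (∫ x, φ x) * c := by
      rw [← integral_mul_const, ← integral_sub (integrable_test_mul hφt hT) (hi.mul_const c)]
      refine integral_congr_ae (ae_of_all _ fun x => ?_)
      simp only [smul_eq_mul]
      ring
    rw [h4, ← h3, h2]
  filter_upwards [h1] with x hx
  linarith

theorem integral_deriv_mul_eq (hA : LocallyIntegrable A) (hg : ∀ x, g x = ∫ t in 0..x, A t)
    {φ : ℝ → ℝ} (hφ : IsTestFunction φ) : ∫ x, deriv φ x * g x = -∫ x, φ x * A x := by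
  obtain ⟨N, hN, hs⟩ := exists_support_bound hφ.2
  obtain ⟨N', hN', hs'⟩ := exists_support_bound hφ.deriv.2
  set K := max N N' + 1
  have hK : N < K ∧ N' < K := ⟨by linarith [le_max_left N N'], by linarith [le_max_right N N']⟩
  have hK0 : 0 ≤ K := by linarith
  have hout : ∀ (p q : ℝ → ℝ), (∀ x, K ≤ |x| → p x = 0) →
      ∫ x, p x * q x = ∫ x in (-K)..K, p x * q x := by
    intro p q hp
    rw [intervalIntegral.integral_of_le (by linarith)]
    refine (setIntegral_eq_integral_of_forall_compl_eq_zero fun x hx => ?_).symm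
    rw [hp, zero_mul]
    rw [le_abs]
    by_contra hc
    push Not at hc
    exact hx ⟨by linarith, hc.1.le⟩
  rw [hout _ _ fun x hx => hs' x (hK.2.trans_le hx), hout _ _ fun x hx => hs x (hK.1.trans_le hx)]
  have hint : IntervalIntegrable A volume (-K) K :=
    (hA.integrableOn_isCompact isCompact_uIcc).intervalIntegrable
  have hgAC : AbsolutelyContinuousOnInterval g (-K) K := by
    rw [show g = fun x => ∫ t in 0..x, A t from funext hg]
    exact hint.absolutelyContinuousOnInterval_intervalIntegral (by
      rw [Set.uIcc_of_le (by linarith)]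
      exact ⟨by linarith, hK0⟩)
  have hφAC : AbsolutelyContinuousOnInterval φ (-K) K :=
    ContDiffOn.absolutelyContinuousOnInterval (hφ.1.of_le (by simp)).contDiffOn
  have h := hφAC.integral_mul_deriv_eq_deriv_mul hgAC
  rw [hs K (by rw [abs_of_nonneg hK0]; exact hK.1),
    hs (-K) (by rw [abs_neg, abs_of_nonneg hK0]; exact hK.1)] at h
  have e : ∫ x in (-K)..K, φ x * deriv g x = ∫ x in (-K)..K, φ x * A x := by
    refine intervalIntegral.integral_congr_ae ?_
    filter_upwards [LocallyIntegrable.ae_hasDerivAt_integral hA] with x hx _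
    rw [show g = fun x => ∫ t in 0..x, A t from funext hg, (hx 0).deriv]
  rw [← e, h]
  ring

/-- A distribution whose second derivative is the locally integrable function `A` is, up to an
affine function, the second primitive of `A`. -/
theorem ae_eq_of_integral_deriv_deriv_mul (hT : LocallyIntegrable T) (hA : LocallyIntegrable A)
    (h : ∀ φ, IsTestFunction φ → ∫ x, deriv (deriv φ) x * T x = ∫ x, φ x * A x) :
    ∃ k c, T =ᵐ[volume] fun x => (∫ s in 0..x, ((∫ t in 0..s, A t) + k)) + c := by
  obtain ⟨χ, hχ, hχ1⟩ := exists_test_integral_one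
  set g : ℝ → ℝ := fun s => ∫ t in 0..s, A t with hg
  have hgc : Continuous g := intervalIntegral.continuous_primitive
    (fun a b => (hA.integrableOn_isCompact isCompact_uIcc).intervalIntegrable) 0
  set k := -(∫ x, deriv χ x * T x) - ∫ x, χ x * g x with hk
  have hgk : LocallyIntegrable fun s => g s + k := (hgc.add continuous_const).locallyIntegrable
  set p : ℝ → ℝ := fun x => ∫ s in 0..x, (g s + k) with hp
  have hpc : Continuous p := intervalIntegral.continuous_primitive
    (fun a b => (hgc.add continuous_const).intervalIntegrable a b) 0
  obtain ⟨c, hc⟩ := ae_eq_const_of_integral_deriv_mul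
    (T := fun x => T x - p x) (hT.sub hpc.locallyIntegrable) (fun φ hφ => by
      have hi := integrable_test hφ
      obtain ⟨θ, hθ, hθ'⟩ := exists_test_antideriv (hφ.sub_const_mul hχ (∫ x, φ x)) (by
        rw [integral_sub hi ((integrable_test hχ).const_mul _), integral_const_mul, hχ1, mul_one,
          sub_self])
      have h1 := h θ hθ
      have h2 := integral_deriv_mul_eq hA (fun _ => rfl) hθ
      have hdd : deriv (deriv θ) = fun x => deriv φ x - (∫ x, φ x) * deriv χ x := by
        rw [hθ']
        funext x
        rw [deriv_fun_sub (hφ.1.differentiable (by simp) x)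
          ((hχ.1.differentiable (by simp) x).const_mul _), deriv_const_mul_field]
      rw [hdd] at h1
      rw [hθ'] at h2
      have h3 : ∫ x, (deriv φ x - (∫ x, φ x) * deriv χ x) * T x
          = (∫ x, deriv φ x * T x) - (∫ x, φ x) * ∫ x, deriv χ x * T x := by
        rw [← integral_const_mul, ← integral_sub (integrable_test_mul hφ.deriv hT)
          ((integrable_test_mul hχ.deriv hT).const_mul _)]
        refine integral_congr_ae (ae_of_all _ fun x => ?_)
        ring
      have h4 : ∫ x, (φ x - (∫ x, φ x) * χ x) * g x
          = (∫ x, φ x * g x) - (∫ x, φ x) * ∫ x, χ x * g x := by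
        rw [← integral_const_mul, ← integral_sub (integrable_test_mul hφ hgc.locallyIntegrable)
          ((integrable_test_mul hχ hgc.locallyIntegrable).const_mul _)]
        refine integral_congr_ae (ae_of_all _ fun x => ?_)
        ring
      have h5 := integral_deriv_mul_eq (g := p) hgk (fun _ => rfl) hφ
      have h6 : ∫ x, φ x * (g x + k) = (∫ x, φ x * g x) + k * ∫ x, φ x := by
        rw [← integral_const_mul, ← integral_add (integrable_test_mul hφ hgc.locallyIntegrable)
          (hi.const_mul k)]
        refine integral_congr_ae (ae_of_all _ fun x => ?_)
        ring
      have h7 : ∫ x, deriv φ x * (T x - p x) = (∫ x, deriv φ x * T x) - ∫ x, deriv φ x * p x := by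
        rw [← integral_sub (integrable_test_mul hφ.deriv hT)
          (integrable_test_mul hφ.deriv hpc.locallyIntegrable)]
        refine integral_congr_ae (ae_of_all _ fun x => ?_)
        ring
      have h2' : ∫ x, (φ x - (∫ x, φ x) * χ x) * g x = -∫ x, θ x * A x := h2
      rw [h7, h5, h6, hk]
      rw [h3] at h1
      rw [h4] at h2'
      linear_combination h1 + h2')
  refine ⟨k, c, ?_⟩
  filter_upwards [hc] with x hx
  linarith

/-- A nonnegative integrable midpoint convex function vanishes: integrate the inequality over `t`. -/
theorem eq_zero_of_midpoint_le {P : ℝ → ℝ} (hP : Integrable P) (h0 : ∀ x, 0 ≤ P x)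
    (h : ∀ x t, P x ≤ (P (x + t) + P (x - t)) / 2) (x : ℝ) : P x = 0 := by
  refine le_antisymm ?_ (h0 x)
  have h1 : ∀ N : ℝ, 0 < N → N * P x ≤ ∫ y, P y := by
    intro N hN
    have e1 : ∫ t in Set.Ioc 0 N, P (x + t) ≤ ∫ y, P y := by
      rw [← integral_add_left_eq_self P x]
      exact setIntegral_le_integral (hP.comp_add_left x) (ae_of_all _ fun t => h0 _)
    have e2 : ∫ t in Set.Ioc 0 N, P (x - t) ≤ ∫ y, P y := by
      rw [← integral_sub_left_eq_self P volume x]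
      exact setIntegral_le_integral (hP.comp_sub_left x) (ae_of_all _ fun t => h0 _)
    have e3 : ∫ _ in Set.Ioc 0 N, P x ≤ ∫ t in Set.Ioc 0 N, (P (x + t) + P (x - t)) / 2 := by
      refine setIntegral_mono_on (integrableOn_const (by simp) (by simp))
        (((hP.comp_add_left x).add (hP.comp_sub_left x)).div_const 2).integrableOn
        measurableSet_Ioc fun t _ => h x t
    rw [setIntegral_const, measureReal_def, Real.volume_Ioc, sub_zero,
      ENNReal.toReal_ofReal hN.le, smul_eq_mul, integral_div,
      integral_add (hP.comp_add_left x).integrableOn (hP.comp_sub_left x).integrableOn] at e3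
    linarith
  by_contra hc
  push Not at hc
  have hI : 0 ≤ ∫ y, P y := integral_nonneg h0
  have h2 := h1 ((∫ y, P y) / P x + 1) (by positivity)
  rw [add_mul, div_mul_cancel₀ _ hc.ne', one_mul] at h2
  linarith

/-- A square integrable distributional solution of `ψ'' = 2 V ψ`, `V ≥ 0`, vanishes: `|ψ|²` is
convex and integrable. -/
theorem ae_eq_zero_of_integral_deriv_deriv_mul {V : ℝ → ℝ} (hV : Continuous V) (hV0 : ∀ x, 0 ≤ V x)
    (hT : LocallyIntegrable T) (hT2 : Integrable fun x => T x ^ 2)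
    (h : ∀ φ, IsTestFunction φ → ∫ x, deriv (deriv φ) x * T x = ∫ x, φ x * (2 * V x * T x)) :
    T =ᵐ[volume] 0 := by
  have hA : LocallyIntegrable fun x => 2 * V x * T x :=
    hT.continuous_smul (continuous_const.mul hV)
  obtain ⟨k, c, hkc⟩ := ae_eq_of_integral_deriv_deriv_mul hT hA h
  set g : ℝ → ℝ := fun s => ∫ t in 0..s, 2 * V t * T t
  have hgc : Continuous g := intervalIntegral.continuous_primitive
    (fun a b => (hA.integrableOn_isCompact isCompact_uIcc).intervalIntegrable) 0
  set p : ℝ → ℝ := fun x => (∫ s in 0..x, (g s + k)) + c with hp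
  have hpd : ∀ x, HasDerivAt p (g x + k) x := fun x =>
    ((hgc.add continuous_const).integral_hasStrictDerivAt 0 x).hasDerivAt.add_const c
  have hpc : Continuous p := continuous_iff_continuousAt.2 fun x => (hpd x).continuousAt
  have hg' : g = fun s => ∫ t in 0..s, 2 * V t * p t := by
    funext s
    refine intervalIntegral.integral_congr_ae ?_
    filter_upwards [hkc] with t ht _
    rw [ht]
  have hgd : ∀ x, HasDerivAt g (2 * V x * p x) x := fun x => by
    rw [hg']
    exact ((by fun_prop : Continuous fun t => 2 * V t * p t).integral_hasStrictDerivAt 0 x).hasDerivAt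
  have hP : Integrable fun x => p x ^ 2 := by
    refine hT2.congr ?_
    filter_upwards [hkc] with x hx
    rw [hx]
  have hP1 : ∀ x, HasDerivAt (fun x => p x ^ 2) (2 * p x * (g x + k)) x := fun x => by
    have h1 := (hpd x).mul (hpd x)
    simp only [sq]
    exact h1.congr_deriv (by ring)
  have hP2 : ∀ x, HasDerivAt (fun x => 2 * p x * (g x + k))
      (2 * (g x + k) * (g x + k) + 2 * p x * (2 * V x * p x)) x := fun x =>
    ((hpd x).const_mul 2).mul ((hgd x).add_const k)
  have hd1 : deriv (fun x => p x ^ 2) = fun x => 2 * p x * (g x + k) :=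
    funext fun x => (hP1 x).deriv
  have hconv : ConvexOn ℝ Set.univ fun x => p x ^ 2 := by
    refine convexOn_univ_of_deriv2_nonneg (fun x => (hP1 x).differentiableAt) ?_ fun x => ?_
    · rw [hd1]
      exact fun x => (hP2 x).differentiableAt
    · rw [Function.iterate_succ, Function.iterate_one, Function.comp_apply, hd1, (hP2 x).deriv]
      nlinarith [sq_nonneg (g x + k), mul_nonneg (hV0 x) (sq_nonneg (p x))]
  have hzero := eq_zero_of_midpoint_le hP (fun x => sq_nonneg _) (fun x t => by
    have h1 := hconv.2 (Set.mem_univ (x + t)) (Set.mem_univ (x - t))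
      (by norm_num : (0 : ℝ) ≤ 1 / 2) (by norm_num : (0 : ℝ) ≤ 1 / 2) (by norm_num)
    simp only [smul_eq_mul] at h1
    rw [show 1 / 2 * (x + t) + 1 / 2 * (x - t) = x by ring] at h1
    linarith)
  filter_upwards [hkc] with x hx
  rw [hx]
  exact pow_eq_zero_iff two_ne_zero |>.1 (hzero x)

end DuBoisReymond

end RHF

end

noncomputable section

namespace RHF

/-! ### The resolvent of the Hamiltonian -/

section Resolvent

variable {Φ : ℝ → ℝ} {M : ℝ}

/-- The operator `-½ Δ₁ + Φ + M` on test functions. -/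
def shiftT (hΦ : Continuous Φ) (M : ℝ) : testSpace →ₗ[ℂ] L2R :=
  hamT hΦ + (M : ℂ) • toL2

theorem shiftT_apply (hΦ : Continuous Φ) (M : ℝ) (u : testSpace) :
    shiftT hΦ M u = hamT hΦ u + (M : ℂ) • toL2 u := rfl

/-- The Hamiltonian on its maximal domain is the adjoint of its restriction to the test functions. -/
theorem isSchrodingerPair_iff_shiftT (hΦ : Continuous Φ) (M : ℝ) (ψ w : L2R) :
    IsSchrodingerPair Φ ψ w ↔ ∀ u, ⟪shiftT hΦ M u, ψ⟫_ℂ = ⟪toL2 u, w + (M : ℂ) • ψ⟫_ℂ := by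
  rw [isSchrodingerPair_iff hΦ]
  refine forall_congr' fun u => ?_
  rw [shiftT_apply, inner_add_left, inner_add_right, inner_smul_left, inner_smul_right,
    Complex.conj_ofReal, add_left_inj]

/-- A component of an `L²` solution of `-½ ψ'' + (Φ + M) ψ = 0` vanishes. -/
theorem ae_comp_eq_zero (hΦ : Continuous Φ) (hM : ∀ x, 0 ≤ Φ x + M) {ψ : L2R}
    (h : IsSchrodingerPair Φ ψ (-((M : ℂ) • ψ))) (L : ℂ →L[ℝ] ℝ) :
    (fun x => L (ψ x)) =ᵐ[volume] 0 := by
  have hT : MemLp (fun x => L (ψ x)) 2 := L.comp_memLp' (Lp.memLp ψ)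
  refine ae_eq_zero_of_integral_deriv_deriv_mul (V := fun x => Φ x + M) (by fun_prop) hM
    (hT.locallyIntegrable (by norm_num)) hT.integrable_sq fun φ hφ => ?_
  have hψ := locallyIntegrable_L2R ψ
  have i1 := integrable_iteratedDeriv_smul hφ ψ
  have i2 := integrable_test_smul hφ.1.continuous hφ.2 h.1
  have i3 := integrable_test_smul hφ.1.continuous hφ.2 hψ
  have e0 := h.2 φ hφ
  have e3 : ∫ x, φ x • (-((M : ℂ) • ψ) : L2R) x = -(M * ∫ x, φ x • ψ x) := by
    rw [← integral_const_mul, ← integral_neg]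
    refine integral_congr_ae ?_
    filter_upwards [Lp.coeFn_neg ((M : ℂ) • ψ), Lp.coeFn_smul (M : ℂ) ψ] with x h1 h2
    rw [h1, Pi.neg_apply, h2, Pi.smul_apply, Complex.real_smul, Complex.real_smul, smul_eq_mul]
    ring
  rw [e3] at e0
  have e1 : ∫ x, iteratedDeriv 2 φ x • ψ x
      = (2 : ℝ) • ((∫ x, φ x • (Φ x • ψ x)) + M • ∫ x, φ x • ψ x) := by
    simp only [Complex.real_smul]
    push_cast
    linear_combination (-2 : ℂ) * e0
  have e2 := congrArg L e1
  rw [map_smul, map_add, map_smul, ← L.integral_comp_comm i1, ← L.integral_comp_comm i2,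
    ← L.integral_comp_comm i3] at e2
  simp only [map_smul, smul_eq_mul, iteratedDeriv_succ, iteratedDeriv_zero] at e2
  have j2 : Integrable fun x => φ x * (Φ x * L (ψ x)) := by
    simpa only [map_smul, smul_eq_mul] using L.integrable_comp i2
  have j3 : Integrable fun x => φ x * L (ψ x) := by
    simpa only [map_smul, smul_eq_mul] using L.integrable_comp i3
  rw [e2, ← integral_const_mul, ← integral_add j2 (j3.const_mul M), ← integral_const_mul]
  refine integral_congr_ae (ae_of_all _ fun x => ?_)
  simp only
  ring

theorem eq_zero_of_isSchrodingerPair (hΦ : Continuous Φ) (hM : ∀ x, 0 ≤ Φ x + M) {ψ : L2R}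
    (h : IsSchrodingerPair Φ ψ (-((M : ℂ) • ψ))) : ψ = 0 := by
  rw [Lp.eq_zero_iff_ae_eq_zero]
  filter_upwards [ae_comp_eq_zero hΦ hM h Complex.reCLM, ae_comp_eq_zero hΦ hM h Complex.imCLM]
    with x h1 h2
  exact Complex.ext h1 h2

/-- Essential self-adjointness of the Hamiltonian on test functions, expressed through the range of
`-½ Δ₁ + Φ + M`. -/
theorem denseRange_shiftT (hΦ : Continuous Φ) (hM : ∀ x, 0 ≤ Φ x + M) :
    DenseRange (shiftT hΦ M) := by
  have h : (LinearMap.range (shiftT hΦ M)).topologicalClosure = ⊤ := by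
    rw [Submodule.topologicalClosure_eq_top_iff, Submodule.eq_bot_iff]
    intro ψ hψ
    refine eq_zero_of_isSchrodingerPair hΦ hM ((isSchrodingerPair_iff_shiftT hΦ M _ _).2 fun u => ?_)
    rw [neg_add_cancel, inner_zero_right]
    exact (Submodule.mem_orthogonal _ _).1 hψ _ (LinearMap.mem_range_self _ u)
  have := Submodule.dense_iff_topologicalClosure_eq_top.2 h
  rwa [LinearMap.coe_range] at this

theorem normSq_toL2_le_re_inner_shiftT (hΦ : Continuous Φ) (hM : ∀ x, 1 ≤ Φ x + M)
    (u : testSpace) : ‖toL2 u‖ ^ 2 ≤ (⟪shiftT hΦ M u, toL2 u⟫_ℂ).re := by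
  have hi : Integrable fun x => ‖(u : ℝ → ℂ) x‖ ^ 2 := by
    have hc : HasCompactSupport fun x => ‖(u : ℝ → ℂ) x‖ ^ 2 :=
      (test_hasCompactSupport u).mono fun x hx h => hx (by simp [h])
    exact ((test_continuous u).norm.pow 2).integrable_of_hasCompactSupport hc
  have h1 : (1 - M) * ‖toL2 u‖ ^ 2 ≤ ∫ x, Φ x * ‖(u : ℝ → ℂ) x‖ ^ 2 := by
    rw [norm_toL2_sq, ← integral_const_mul]
    refine integral_mono (hi.const_mul _) (integrable_mul_normSq hΦ u) fun x => ?_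
    have := hM x
    exact mul_le_mul_of_nonneg_right (by linarith) (by positivity)
  have h2 : (⟪toL2 u, toL2 u⟫_ℂ).re = ‖toL2 u‖ ^ 2 := by
    exact (norm_sq_eq_re_inner (𝕜 := ℂ) (toL2 u)).symm
  rw [shiftT_apply, inner_add_left, inner_smul_left, Complex.conj_ofReal, Complex.add_re,
    re_inner_hamT_self, Complex.re_ofReal_mul, h2]
  nlinarith [sq_nonneg ‖toL2 (derivT u)‖]

/-- `R` is the resolvent `(-½ Δ₁ + Φ + M)⁻¹`, characterised by its values on the dense range of
the restriction of `-½ Δ₁ + Φ + M` to the test functions. -/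
def IsResolvent (hΦ : Continuous Φ) (M : ℝ) (R : L2R →L[ℂ] L2R) : Prop :=
  ∀ u, R (shiftT hΦ M u) = toL2 u

theorem exists_isResolvent (hΦ : Continuous Φ) (hM : ∀ x, 1 ≤ Φ x + M) :
    ∃ R, IsResolvent hΦ M R := by
  have hd := denseRange_shiftT hΦ (M := M) fun x => zero_le_one.trans (hM x)
  refine ⟨toL2.extendOfNorm (shiftT hΦ M), fun u =>
    LinearMap.extendOfNorm_eq (f := toL2) (e := shiftT hΦ M) hd ⟨1, fun v => ?_⟩ u⟩
  have h1 := normSq_toL2_le_re_inner_shiftT hΦ hM v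
  have h2 := (Complex.re_le_norm _).trans (norm_inner_le_norm (𝕜 := ℂ) (shiftT hΦ M v) (toL2 v))
  rw [one_mul]
  rcases (norm_nonneg (toL2 v)).eq_or_lt with h | h
  · rw [← h]
    exact norm_nonneg _
  · nlinarith

namespace IsResolvent

variable {R : L2R →L[ℂ] L2R} {hΦ : Continuous Φ}

theorem ext_on_shiftT (hM : ∀ x, 1 ≤ Φ x + M) {A B : L2R →L[ℂ] L2R}
    (h : ∀ u, A (shiftT hΦ M u) = B (shiftT hΦ M u)) : A = B := by
  have hd := denseRange_shiftT hΦ (M := M) fun x => zero_le_one.trans (hM x)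
  have := hd.equalizer A.continuous B.continuous (funext h)
  exact DFunLike.coe_injective this

theorem inner_shiftT_toL2 (hΦ : Continuous Φ) (M : ℝ) (u v : testSpace) :
    ⟪shiftT hΦ M u, toL2 v⟫_ℂ = ⟪toL2 u, shiftT hΦ M v⟫_ℂ :=
  (isSchrodingerPair_iff_shiftT hΦ M _ _).1 (isSchrodingerPair_hamT hΦ v) u

theorem inner_apply (hR : IsResolvent hΦ M R) (hM : ∀ x, 1 ≤ Φ x + M) (f g : L2R) :
    ⟪R f, g⟫_ℂ = ⟪f, R g⟫_ℂ := by
  have hd := denseRange_shiftT hΦ (M := M) fun x => zero_le_one.trans (hM x)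
  refine hd.induction_on₂ (p := fun f g => ⟪R f, g⟫_ℂ = ⟪f, R g⟫_ℂ) ?_ (fun u v => ?_) f g
  · exact isClosed_eq (by fun_prop) (by fun_prop)
  · rw [hR u, hR v, inner_shiftT_toL2]

theorem isSelfAdjoint (hR : IsResolvent hΦ M R) (hM : ∀ x, 1 ≤ Φ x + M) : IsSelfAdjoint R :=
  ContinuousLinearMap.isSelfAdjoint_iff_isSymmetric.2 (hR.inner_apply hM)

theorem normSq_le_re_inner (hR : IsResolvent hΦ M R) (hM : ∀ x, 1 ≤ Φ x + M) (f : L2R) :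
    ‖R f‖ ^ 2 ≤ (⟪f, R f⟫_ℂ).re := by
  have hd := denseRange_shiftT hΦ (M := M) fun x => zero_le_one.trans (hM x)
  refine hd.induction_on (p := fun f => ‖R f‖ ^ 2 ≤ (⟪f, R f⟫_ℂ).re) f ?_ fun u => ?_
  · exact isClosed_le (by fun_prop) (by fun_prop)
  · rw [hR u]
    exact normSq_toL2_le_re_inner_shiftT hΦ hM u

/-- The graph of the Hamiltonian in terms of the resolvent. -/
theorem isSchrodingerPair_iff (hR : IsResolvent hΦ M R) (hM : ∀ x, 1 ≤ Φ x + M) (ψ w : L2R) :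
    IsSchrodingerPair Φ ψ w ↔ ψ = R (w + (M : ℂ) • ψ) := by
  have hd := denseRange_shiftT hΦ (M := M) fun x => zero_le_one.trans (hM x)
  rw [isSchrodingerPair_iff_shiftT hΦ M]
  have e : ∀ u, ⟪shiftT hΦ M u, R (w + (M : ℂ) • ψ)⟫_ℂ = ⟪toL2 u, w + (M : ℂ) • ψ⟫_ℂ := fun u => by
    rw [← hR.inner_apply hM, hR u]
  constructor
  · intro h
    refine ext_inner_left ℂ fun v => ?_
    refine hd.induction_on (p := fun v => ⟪v, ψ⟫_ℂ = ⟪v, R (w + (M : ℂ) • ψ)⟫_ℂ) v ?_ fun u => ?_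
    · exact isClosed_eq (by fun_prop) (by fun_prop)
    · rw [h u, e u]
  · intro h u
    rw [← e u, ← h]

theorem apply_isSchrodingerPair (hR : IsResolvent hΦ M R) (hM : ∀ x, 1 ≤ Φ x + M) (f : L2R) :
    IsSchrodingerPair Φ (R f) (f - (M : ℂ) • R f) := by
  rw [hR.isSchrodingerPair_iff hM, sub_add_cancel]

theorem eq_zero_of_apply (hR : IsResolvent hΦ M R) (hM : ∀ x, 1 ≤ Φ x + M) {f : L2R}
    (h : R f = 0) : f = 0 := by
  have h1 := hR.apply_isSchrodingerPair hM f
  rw [h, smul_zero, sub_zero] at h1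
  exact schrodingerGraph_single_valued Φ (0, f) h1 rfl

/-- The test functions form a core of the Hamiltonian. -/
theorem exists_seq_test (hR : IsResolvent hΦ M R) (hM : ∀ x, 1 ≤ Φ x + M) {ψ w : L2R}
    (h : IsSchrodingerPair Φ ψ w) :
    ∃ u : ℕ → testSpace, Tendsto (fun n => toL2 (u n)) atTop (𝓝 ψ) ∧
      Tendsto (fun n => hamT hΦ (u n)) atTop (𝓝 w) := by
  have hd := denseRange_shiftT hΦ (M := M) fun x => zero_le_one.trans (hM x)
  obtain ⟨s, hs, hlim⟩ := mem_closure_iff_seq_limit.1 (hd (w + (M : ℂ) • ψ))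
  choose u hu using hs
  have h1 : Tendsto (fun n => toL2 (u n)) atTop (𝓝 ψ) := by
    rw [(hR.isSchrodingerPair_iff hM ψ w).1 h]
    refine ((R.continuous.tendsto _).comp hlim).congr fun n => ?_
    rw [Function.comp_apply, ← hu, hR]
  refine ⟨u, h1, ?_⟩
  have h2 := hlim.sub (h1.const_smul (M : ℂ))
  rw [add_sub_cancel_right] at h2
  refine h2.congr fun n => ?_
  rw [← hu, shiftT_apply, add_sub_cancel_right]

theorem commute (hR : IsResolvent hΦ M R) (hM : ∀ x, 1 ≤ Φ x + M) {G : L2R →L[ℂ] L2R}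
    (hG : ∀ u, IsSchrodingerPair Φ (G (toL2 u)) (G (hamT hΦ u))) : Commute G R := by
  refine ext_on_shiftT hM (hΦ := hΦ) fun u => ?_
  change G (R _) = R (G _)
  rw [hR u, shiftT_apply, map_add, map_smul]
  exact (hR.isSchrodingerPair_iff hM _ _).1 (hG u)

theorem commutes_schrodinger (hR : IsResolvent hΦ M R) (hM : ∀ x, 1 ≤ Φ x + M)
    {G : L2R →L[ℂ] L2R} (hG : Commute G R) : Commutes G (schrodinger Φ) := by
  intro ψ
  have h1 : ((ψ : L2R), schrodinger Φ ψ) ∈ (schrodinger Φ).graph :=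
    (schrodinger Φ).mem_graph ψ
  rw [schrodinger_graph] at h1
  have h2 : (G ψ, G (schrodinger Φ ψ)) ∈ schrodingerGraph Φ := by
    refine (hR.isSchrodingerPair_iff hM _ _).2 ?_
    have h3 := (hR.isSchrodingerPair_iff hM _ _).1 h1
    have h4 : ∀ f, G (R f) = R (G f) := fun f => congrArg (fun A => A f) hG.eq
    rw [← map_smul, ← map_add, ← h4]
    exact congrArg G h3
  rw [← schrodinger_graph, LinearPMap.mem_graph_iff] at h2
  obtain ⟨y, hy, hy'⟩ := h2
  replace hy : (y : L2R) = G ψ := hy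
  replace hy' : schrodinger Φ y = G (schrodinger Φ ψ) := hy'
  have hm : G ψ ∈ (schrodinger Φ).domain := by
    rw [← hy]
    exact y.2
  refine ⟨hm, ?_⟩
  rw [← hy']
  congr 1
  exact Subtype.ext hy.symm

end IsResolvent

end Resolvent

end RHF

end

noncomputable section

namespace RHF

/-! ### Borel functional calculus of a bounded self-adjoint operator -/

section BorelCalculus

variable {R : L2R →L[ℂ] L2R}

instance : CompactSpace (spectrum ℝ R) :=
  isCompact_iff_compactSpace.1 (spectrum.isCompact R)

theorem inner_cfcHom_apply (hR : IsSelfAdjoint R) (f : C(spectrum ℝ R, ℝ)) (x y : L2R) :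
    ⟪cfcHom hR f x, y⟫_ℂ = ⟪x, cfcHom hR f y⟫_ℂ := by
  have h : IsSelfAdjoint (cfcHom hR f) := by
    rw [IsSelfAdjoint, ← map_star, star_trivial]
  exact h.isSymmetric x y

theorem re_inner_cfcHom_mul (hR : IsSelfAdjoint R) (f g : C(spectrum ℝ R, ℝ)) (ψ : L2R) :
    (⟪ψ, cfcHom hR (f * g) ψ⟫_ℂ).re = (⟪cfcHom hR f ψ, cfcHom hR g ψ⟫_ℂ).re := by
  rw [map_mul, inner_cfcHom_apply]
  rfl

theorem re_inner_cfcHom_sq (hR : IsSelfAdjoint R) (f : C(spectrum ℝ R, ℝ)) (ψ : L2R) :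
    (⟪ψ, cfcHom hR (f * f) ψ⟫_ℂ).re = ‖cfcHom hR f ψ‖ ^ 2 := by
  rw [re_inner_cfcHom_mul]
  exact (norm_sq_eq_re_inner (𝕜 := ℂ) _).symm

/-- The positive functional `f ↦ ⟨ψ, f(R) ψ⟩`. -/
def specFunctional (hR : IsSelfAdjoint R) (ψ : L2R) :
    CompactlySupportedContinuousMap (spectrum ℝ R) ℝ →ₚ[ℝ] ℝ :=
  PositiveLinearMap.mk₀
    { toFun := fun f => (⟪ψ, cfcHom hR (f : C(spectrum ℝ R, ℝ)) ψ⟫_ℂ).re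
      map_add' := fun f g => by
        have : ((f + g : CompactlySupportedContinuousMap (spectrum ℝ R) ℝ) : C(spectrum ℝ R, ℝ))
            = f + g := rfl
        rw [this, map_add, add_apply, inner_add_right, Complex.add_re]
      map_smul' := fun c f => by
        have : ((c • f : CompactlySupportedContinuousMap (spectrum ℝ R) ℝ) : C(spectrum ℝ R, ℝ))
            = c • (f : C(spectrum ℝ R, ℝ)) := rfl
        rw [this, map_smul, real_smul_apply, inner_smul_right, Complex.re_ofReal_mul]
        rfl }
    (fun f hf => by
      have hs : (f : C(spectrum ℝ R, ℝ)) = ⟨fun x => √(f x), by fun_prop⟩ * ⟨fun x => √(f x), by fun_prop⟩ := by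
        ext x
        exact (Real.mul_self_sqrt (hf x)).symm
      change 0 ≤ (⟪ψ, cfcHom hR (f : C(spectrum ℝ R, ℝ)) ψ⟫_ℂ).re
      rw [hs, re_inner_cfcHom_sq]
      positivity)

/-- The spectral measure of `R` in the state `ψ`. -/
def specMeasure (hR : IsSelfAdjoint R) (ψ : L2R) : Measure (spectrum ℝ R) :=
  RealRMK.rieszMeasure (specFunctional hR ψ)

instance (hR : IsSelfAdjoint R) (ψ : L2R) : (specMeasure hR ψ).Regular := by
  unfold specMeasure
  infer_instance

instance (hR : IsSelfAdjoint R) (ψ : L2R) : IsFiniteMeasure (specMeasure hR ψ) := inferInstance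

theorem integral_specMeasure (hR : IsSelfAdjoint R) (ψ : L2R) (f : C(spectrum ℝ R, ℝ)) :
    ∫ x, f x ∂specMeasure hR ψ = (⟪ψ, cfcHom hR f ψ⟫_ℂ).re :=
  RealRMK.integral_rieszMeasure (specFunctional hR ψ) ⟨f, HasCompactSupport.of_compactSpace _⟩

theorem integrable_continuousMap (hR : IsSelfAdjoint R) (ψ : L2R) (f : C(spectrum ℝ R, ℝ)) :
    Integrable f (specMeasure hR ψ) :=
  f.continuous.integrable_of_hasCompactSupport (HasCompactSupport.of_compactSpace _)

/-- The vectors `f(R) ψ`, `f` continuous. -/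
def cfcVec (hR : IsSelfAdjoint R) (ψ : L2R) : C(spectrum ℝ R, ℝ) →ₗ[ℝ] L2R where
  toFun f := cfcHom hR f ψ
  map_add' f g := by rw [map_add, add_apply]
  map_smul' c f := by rw [map_smul]; rfl

theorem norm_cfcHom_apply (hR : IsSelfAdjoint R) (ψ : L2R) (f : C(spectrum ℝ R, ℝ)) :
    ‖cfcHom hR f ψ‖ = ‖ContinuousMap.toLp 2 (specMeasure hR ψ) ℝ f‖ := by
  have h : ‖ContinuousMap.toLp 2 (specMeasure hR ψ) ℝ f‖ ^ 2 = ‖cfcHom hR f ψ‖ ^ 2 := by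
    rw [← re_inner_cfcHom_sq, ← integral_specMeasure, ← real_inner_self_eq_norm_sq, L2.inner_def]
    refine integral_congr_ae ?_
    filter_upwards [ContinuousMap.coeFn_toLp (specMeasure hR ψ) (𝕜 := ℝ) (p := 2) f] with x hx
    rw [hx]
    rfl
  exact ((sq_eq_sq₀ (norm_nonneg _) (norm_nonneg _)).1 h).symm

theorem denseRange_toLp (hR : IsSelfAdjoint R) (ψ : L2R) :
    DenseRange (ContinuousMap.toLp (E := ℝ) 2 (specMeasure hR ψ) ℝ) :=
  ContinuousMap.toLp_denseRange ℝ (specMeasure hR ψ) ℝ (by norm_num)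

/-- The isometry `k ↦ k(R) ψ` of `L²` of the spectral measure of `ψ` onto the cyclic subspace
generated by `ψ`. -/
def cyclic (hR : IsSelfAdjoint R) (ψ : L2R) : Lp ℝ 2 (specMeasure hR ψ) →L[ℝ] L2R :=
  (cfcVec hR ψ).extendOfNorm (ContinuousMap.toLp (E := ℝ) 2 (specMeasure hR ψ) ℝ).toLinearMap

theorem cyclic_toLp (hR : IsSelfAdjoint R) (ψ : L2R) (f : C(spectrum ℝ R, ℝ)) :
    cyclic hR ψ (ContinuousMap.toLp 2 (specMeasure hR ψ) ℝ f) = cfcHom hR f ψ :=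
  LinearMap.extendOfNorm_eq (f := cfcVec hR ψ)
    (e := (ContinuousMap.toLp (E := ℝ) 2 (specMeasure hR ψ) ℝ).toLinearMap) (denseRange_toLp hR ψ)
    ⟨1, fun f => by rw [one_mul]; exact (norm_cfcHom_apply hR ψ f).le⟩ f

theorem norm_cyclic (hR : IsSelfAdjoint R) (ψ : L2R) (κ : Lp ℝ 2 (specMeasure hR ψ)) :
    ‖cyclic hR ψ κ‖ = ‖κ‖ := by
  refine (denseRange_toLp hR ψ).induction_on (p := fun κ => ‖cyclic hR ψ κ‖ = ‖κ‖) κ ?_ fun f => ?_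
  · exact isClosed_eq (by fun_prop) (by fun_prop)
  · rw [cyclic_toLp, norm_cfcHom_apply]

theorem re_inner_cyclic (hR : IsSelfAdjoint R) (ψ : L2R) (κ κ' : Lp ℝ 2 (specMeasure hR ψ)) :
    (⟪cyclic hR ψ κ, cyclic hR ψ κ'⟫_ℂ).re = ⟪κ, κ'⟫_ℝ := by
  have h1 := norm_add_sq (𝕜 := ℂ) (cyclic hR ψ κ) (cyclic hR ψ κ')
  have h2 := norm_add_sq_real κ κ'
  rw [← map_add, norm_cyclic, norm_cyclic, norm_cyclic, h2] at h1
  have h3 : RCLike.re ⟪cyclic hR ψ κ, cyclic hR ψ κ'⟫_ℂ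
    = (⟪cyclic hR ψ κ, cyclic hR ψ κ'⟫_ℂ).re := rfl
  rw [h3] at h1
  linarith

variable {k k' : spectrum ℝ R → ℝ}

/-- The vector `k(R) ψ` for `k` square integrable with respect to the spectral measure of `ψ`. -/
def funVec (hR : IsSelfAdjoint R) (ψ : L2R) (hk : MemLp k 2 (specMeasure hR ψ)) : L2R :=
  cyclic hR ψ (hk.toLp k)

theorem memLp_continuousMap (hR : IsSelfAdjoint R) (ψ : L2R) (f : C(spectrum ℝ R, ℝ)) :
    MemLp f 2 (specMeasure hR ψ) :=
  f.continuous.memLp_of_hasCompactSupport (HasCompactSupport.of_compactSpace _)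

theorem funVec_continuousMap (hR : IsSelfAdjoint R) (ψ : L2R) (f : C(spectrum ℝ R, ℝ)) :
    funVec hR ψ (memLp_continuousMap hR ψ f) = cfcHom hR f ψ := by
  rw [← cyclic_toLp]
  rfl

theorem funVec_congr (hR : IsSelfAdjoint R) (ψ : L2R) (hk : MemLp k 2 (specMeasure hR ψ))
    (hk' : MemLp k' 2 (specMeasure hR ψ)) (h : k =ᵐ[specMeasure hR ψ] k') :
    funVec hR ψ hk = funVec hR ψ hk' :=
  congrArg _ (MemLp.toLp_congr hk hk' h)

theorem re_inner_funVec (hR : IsSelfAdjoint R) (ψ : L2R) (hk : MemLp k 2 (specMeasure hR ψ))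
    (hk' : MemLp k' 2 (specMeasure hR ψ)) :
    (⟪funVec hR ψ hk, funVec hR ψ hk'⟫_ℂ).re = ∫ x, k x * k' x ∂specMeasure hR ψ := by
  rw [funVec, funVec, re_inner_cyclic, L2.inner_def]
  refine integral_congr_ae ?_
  filter_upwards [hk.coeFn_toLp, hk'.coeFn_toLp] with x h1 h2
  rw [h1, h2, real_inner_eq_re_inner, RCLike.inner_apply]
  exact mul_comm _ _

theorem norm_funVec (hR : IsSelfAdjoint R) (ψ : L2R) (hk : MemLp k 2 (specMeasure hR ψ)) :
    ‖funVec hR ψ hk‖ = (eLpNorm k 2 (specMeasure hR ψ)).toReal := by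
  rw [funVec, norm_cyclic, Lp.norm_toLp]

theorem normSq_funVec (hR : IsSelfAdjoint R) (ψ : L2R) (hk : MemLp k 2 (specMeasure hR ψ)) :
    ‖funVec hR ψ hk‖ ^ 2 = ∫ x, k x ^ 2 ∂specMeasure hR ψ := by
  have h := re_inner_funVec hR ψ hk hk
  simp only [← sq] at h
  rw [← h]
  exact norm_sq_eq_re_inner (𝕜 := ℂ) _

theorem memLp_one (hR : IsSelfAdjoint R) (ψ : L2R) :
    MemLp (fun _ => (1 : ℝ)) 2 (specMeasure hR ψ) := memLp_const 1

theorem funVec_one (hR : IsSelfAdjoint R) (ψ : L2R) : funVec hR ψ (memLp_one hR ψ) = ψ := by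
  have h := funVec_continuousMap hR ψ 1
  rw [map_one] at h
  exact h

theorem specMeasure_real_univ (hR : IsSelfAdjoint R) (ψ : L2R) :
    (specMeasure hR ψ).real Set.univ = ‖ψ‖ ^ 2 := by
  have h := normSq_funVec hR ψ (memLp_one hR ψ)
  rw [funVec_one] at h
  rw [h]
  simp

theorem funVec_sub (hR : IsSelfAdjoint R) (ψ : L2R) (hk : MemLp k 2 (specMeasure hR ψ))
    (hk' : MemLp k' 2 (specMeasure hR ψ)) :
    funVec hR ψ (hk.sub hk') = funVec hR ψ hk - funVec hR ψ hk' := by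
  rw [funVec, MemLp.toLp_sub, map_sub]
  rfl

theorem funVec_const_smul (hR : IsSelfAdjoint R) (ψ : L2R) (hk : MemLp k 2 (specMeasure hR ψ))
    (c : ℝ) : funVec hR ψ (hk.const_smul c) = c • funVec hR ψ hk := by
  rw [funVec, MemLp.toLp_const_smul, map_smul]
  rfl

/-- Continuous functions approximate: `‖k(R) ψ - f(R) ψ‖` is the `L²` distance of `k` and `f`. -/
theorem norm_funVec_sub_cfcHom (hR : IsSelfAdjoint R) (ψ : L2R)
    (hk : MemLp k 2 (specMeasure hR ψ)) (f : C(spectrum ℝ R, ℝ)) :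
    ‖funVec hR ψ hk - cfcHom hR f ψ‖ = (eLpNorm (k - ⇑f) 2 (specMeasure hR ψ)).toReal := by
  rw [← funVec_continuousMap, ← funVec_sub, norm_funVec]

theorem exists_norm_funVec_sub_lt (hR : IsSelfAdjoint R) (ψ : L2R)
    (hk : MemLp k 2 (specMeasure hR ψ)) {ε : ℝ} (hε : 0 < ε) :
    ∃ f : C(spectrum ℝ R, ℝ), ‖funVec hR ψ hk - cfcHom hR f ψ‖ < ε := by
  obtain ⟨f, hf⟩ := (denseRange_toLp hR ψ).exists_dist_lt (hk.toLp k) hε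
  refine ⟨f, ?_⟩
  rw [← cyclic_toLp, funVec, ← map_sub, norm_cyclic, ← dist_eq_norm]
  exact hf

theorem apply_funVec_eq_zero (hR : IsSelfAdjoint R) {ψ : L2R} {G : L2R →L[ℂ] L2R}
    (hG : Commute R G) (hψ : G ψ = 0) (hk : MemLp k 2 (specMeasure hR ψ)) :
    G (funVec hR ψ hk) = 0 := by
  refine (denseRange_toLp hR ψ).induction_on (p := fun κ => G (cyclic hR ψ κ) = 0) _ ?_ fun f => ?_
  · exact isClosed_eq (by fun_prop) (by fun_prop)
  · rw [cyclic_toLp]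
    have h := congrArg (fun A => A ψ) (hR.commute_cfcHom hR hG f).eq
    change cfcHom hR f (G ψ) = G (cfcHom hR f ψ) at h
    rw [← h, hψ, map_zero]

theorem abs_le_norm_of_mem_spectrum (x : spectrum ℝ R) : |(x : ℝ)| ≤ ‖R‖ := by
  have h := spectrum.norm_le_norm_mul_of_mem x.2
  rw [Real.norm_eq_abs] at h
  refine h.trans (mul_le_of_le_one_right (norm_nonneg _) ?_)
  exact ContinuousLinearMap.norm_id_le

theorem memLp_id_mul (hR : IsSelfAdjoint R) (ψ : L2R) (hk : MemLp k 2 (specMeasure hR ψ)) :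
    MemLp (fun x : spectrum ℝ R => (x : ℝ) * k x) 2 (specMeasure hR ψ) := by
  refine (hk.const_mul ‖R‖).mono
    (measurable_subtype_coe.aestronglyMeasurable.mul hk.aestronglyMeasurable)
    (ae_of_all _ fun x => ?_)
  rw [norm_mul, norm_mul, norm_norm, Real.norm_eq_abs]
  exact mul_le_mul_of_nonneg_right (abs_le_norm_of_mem_spectrum x) (norm_nonneg _)

theorem cfcHom_id_mul (hR : IsSelfAdjoint R) (f : C(spectrum ℝ R, ℝ)) (ψ : L2R) :
    cfcHom hR ((ContinuousMap.id ℝ).restrict (spectrum ℝ R) * f) ψ = R (cfcHom hR f ψ) := by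
  rw [map_mul, cfcHom_id]
  rfl

theorem funVec_id_mul (hR : IsSelfAdjoint R) (ψ : L2R) (hk : MemLp k 2 (specMeasure hR ψ)) :
    funVec hR ψ (memLp_id_mul hR ψ hk) = R (funVec hR ψ hk) := by
  refine eq_of_forall_dist_le fun ε hε => ?_
  obtain ⟨f, hf⟩ := exists_norm_funVec_sub_lt hR ψ hk (ε := ε / (2 * (‖R‖ + 1))) (by positivity)
  have hb : ‖R‖ * ‖funVec hR ψ hk - cfcHom hR f ψ‖ ≤ ε / 2 := by
    have h1 : ‖R‖ * ‖funVec hR ψ hk - cfcHom hR f ψ‖ ≤ (‖R‖ + 1) * (ε / (2 * (‖R‖ + 1))) := by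
      gcongr
      linarith
    refine h1.trans (le_of_eq ?_)
    field_simp
  have h1 : ‖funVec hR ψ (memLp_id_mul hR ψ hk)
      - cfcHom hR ((ContinuousMap.id ℝ).restrict (spectrum ℝ R) * f) ψ‖
      ≤ ‖R‖ * ‖funVec hR ψ hk - cfcHom hR f ψ‖ := by
    have hkf := hk.sub (memLp_continuousMap hR ψ f)
    rw [norm_funVec_sub_cfcHom, norm_funVec_sub_cfcHom,
      ← ENNReal.toReal_ofReal (norm_nonneg R), ← ENNReal.toReal_mul]
    refine ENNReal.toReal_mono (ENNReal.mul_ne_top ENNReal.ofReal_ne_top hkf.eLpNorm_ne_top) ?_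
    refine eLpNorm_le_mul_eLpNorm_of_ae_le_mul (ae_of_all _ fun x => ?_) 2
    have e : ((fun x : spectrum ℝ R => (x : ℝ) * k x) - ⇑((ContinuousMap.id ℝ).restrict (spectrum ℝ R) * f)) x
        = x * (k - ⇑f) x := (mul_sub _ _ _).symm
    rw [e, norm_mul, Real.norm_eq_abs]
    exact mul_le_mul_of_nonneg_right (abs_le_norm_of_mem_spectrum x) (norm_nonneg _)
  have h2 : ‖R (cfcHom hR f ψ) - R (funVec hR ψ hk)‖
      ≤ ‖R‖ * ‖funVec hR ψ hk - cfcHom hR f ψ‖ := by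
    rw [← map_sub, norm_sub_rev (funVec hR ψ hk)]
    exact R.le_opNorm _
  rw [cfcHom_id_mul] at h1
  rw [dist_eq_norm]
  refine (norm_sub_le_norm_sub_add_norm_sub _ (R (cfcHom hR f ψ)) _).trans ?_
  linarith

/-- The spectral measure of an eigenvector is concentrated in the eigenvalue. -/
theorem funVec_eigenvector (hR : IsSelfAdjoint R) {e : L2R} {r : ℝ} (he : R e = (r : ℂ) • e)
    (hk : MemLp k 2 (specMeasure hR e)) {c : ℝ} (hc : ∀ x : spectrum ℝ R, (x : ℝ) = r → k x = c) :
    funVec hR e hk = (c : ℂ) • e := by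
  set f : C(spectrum ℝ R, ℝ) :=
    (ContinuousMap.id ℝ).restrict (spectrum ℝ R) - algebraMap ℝ _ r with hf
  have h0 : ∫ x, f x ^ 2 ∂specMeasure hR e = 0 := by
    rw [← normSq_funVec hR e (memLp_continuousMap hR e f), funVec_continuousMap, hf, map_sub,
      cfcHom_id, AlgHomClass.commutes, sub_apply, he,
      ContinuousLinearMap.algebraMap_apply, show (r : ℂ) • e = r • e from Complex.coe_smul r e, sub_self, norm_zero, sq, zero_mul]
  have h1 := (integral_eq_zero_iff_of_nonneg (fun x => sq_nonneg (f x))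
    (memLp_continuousMap hR e f).integrable_sq).1 h0
  have h2 : k =ᵐ[specMeasure hR e] fun _ => c := by
    filter_upwards [h1] with x hx
    refine hc x (sub_eq_zero.1 ?_)
    exact pow_eq_zero_iff two_ne_zero |>.1 hx
  have h3 := funVec_const_smul hR e (memLp_one hR e) c
  rw [funVec_one] at h3
  rw [funVec_congr hR e hk ((memLp_one hR e).const_smul c) ?_, h3]
  · rfl
  · filter_upwards [h2] with x hx
    rw [hx]
    exact (mul_one c).symm

/-- Bounded Borel functions on the spectrum. -/
structure IsBddMeasurable (k : spectrum ℝ R → ℝ) : Prop where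
  measurable : Measurable k
  bdd : ∃ C, ∀ x, |k x| ≤ C

theorem IsBddMeasurable.memLp_measure (hk : IsBddMeasurable k) (σ : Measure (spectrum ℝ R))
    [IsFiniteMeasure σ] : MemLp k 2 σ := by
  obtain ⟨C, hC⟩ := hk.bdd
  exact MemLp.of_bound hk.measurable.aestronglyMeasurable C (ae_of_all _ hC)

theorem IsBddMeasurable.memLp (hk : IsBddMeasurable k) (hR : IsSelfAdjoint R) (ψ : L2R) :
    MemLp k 2 (specMeasure hR ψ) := hk.memLp_measure _

/-- Simultaneous approximation of `k(R)` by continuous functions of `R` on three vectors. -/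
theorem exists_tendsto_funVec (hR : IsSelfAdjoint R) (hk : IsBddMeasurable k) (ψ φ χ : L2R) :
    ∃ f : ℕ → C(spectrum ℝ R, ℝ),
      Tendsto (fun n => cfcHom hR (f n) ψ) atTop (𝓝 (funVec hR ψ (hk.memLp hR ψ))) ∧
      Tendsto (fun n => cfcHom hR (f n) φ) atTop (𝓝 (funVec hR φ (hk.memLp hR φ))) ∧
      Tendsto (fun n => cfcHom hR (f n) χ) atTop (𝓝 (funVec hR χ (hk.memLp hR χ))) := by
  -- approximation in `L²` of the sum of the three spectral measures
  set σ := specMeasure hR ψ + specMeasure hR φ + specMeasure hR χ with hσ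
  have hε : ∀ n : ℕ, ENNReal.ofReal (1 / ((n : ℝ) + 1)) ≠ 0 := fun n => by
    rw [Ne, ENNReal.ofReal_eq_zero, not_le]
    positivity
  choose f hf using fun n => MemLp.exists_boundedContinuous_eLpNorm_sub_le (by norm_num)
    (hk.memLp_measure σ) (hε n)
  have key : ∀ θ : L2R, specMeasure hR θ ≤ σ →
      Tendsto (fun n => cfcHom hR (f n : C(spectrum ℝ R, ℝ)) θ) atTop
        (𝓝 (funVec hR θ (hk.memLp hR θ))) := by
    intro θ hθ
    rw [tendsto_iff_norm_sub_tendsto_zero]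
    refine squeeze_zero (fun _ => norm_nonneg _) (fun n => ?_) tendsto_one_div_add_atTop_nhds_zero_nat
    rw [norm_sub_rev, norm_funVec_sub_cfcHom]
    refine ENNReal.toReal_le_of_le_ofReal (by positivity) ?_
    exact (eLpNorm_mono_measure _ hθ).trans (hf n).1
  refine ⟨fun n => f n, key ψ ?_, key φ ?_, key χ ?_⟩
  · exact (Measure.le_add_right le_rfl).trans (Measure.le_add_right le_rfl)
  · exact (Measure.le_add_left le_rfl).trans (Measure.le_add_right le_rfl)
  · exact Measure.le_add_left le_rfl

/-- The bounded operator `k(R)` for a bounded Borel function `k`. -/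
def borelFun (hR : IsSelfAdjoint R) (hk : IsBddMeasurable k) : L2R →L[ℂ] L2R :=
  LinearMap.mkContinuous
    { toFun := fun ψ => funVec hR ψ (hk.memLp hR ψ)
      map_add' := fun ψ φ => by
        obtain ⟨f, h1, h2, h3⟩ := exists_tendsto_funVec hR hk ψ φ (ψ + φ)
        refine tendsto_nhds_unique h3 ((h1.add h2).congr fun n => ?_)
        rw [map_add]
      map_smul' := fun c ψ => by
        obtain ⟨f, h1, h2, -⟩ := exists_tendsto_funVec hR hk ψ (c • ψ) 0
        refine tendsto_nhds_unique h2 ((h1.const_smul c).congr fun n => ?_)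
        rw [map_smul] }
    |hk.bdd.choose| (fun ψ => by
      have hC := hk.bdd.choose_spec
      change ‖funVec hR ψ (hk.memLp hR ψ)‖ ≤ _
      refine abs_le_of_sq_le_sq' ?_ (by positivity) |>.2
      rw [normSq_funVec, mul_pow, sq_abs, ← specMeasure_real_univ hR ψ, mul_comm, ← smul_eq_mul,
        ← integral_const]
      refine integral_mono (hk.memLp hR ψ).integrable_sq (integrable_const _) fun x => ?_
      exact sq_le_sq' (abs_le.1 (hC x)).1 (abs_le.1 (hC x)).2)

theorem borelFun_apply (hR : IsSelfAdjoint R) (hk : IsBddMeasurable k) (ψ : L2R) :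
    borelFun hR hk ψ = funVec hR ψ (hk.memLp hR ψ) := rfl

theorem inner_funVec_im (hR : IsSelfAdjoint R) (ψ : L2R) (hk : MemLp k 2 (specMeasure hR ψ)) :
    (⟪ψ, funVec hR ψ hk⟫_ℂ).im = 0 := by
  refine (denseRange_toLp hR ψ).induction_on
    (p := fun κ => (⟪ψ, cyclic hR ψ κ⟫_ℂ).im = 0) _ ?_ fun f => ?_
  · exact isClosed_eq (by fun_prop) (by fun_prop)
  · rw [cyclic_toLp, ← Complex.conj_eq_iff_im, inner_conj_symm, inner_cfcHom_apply]

theorem inner_funVec (hR : IsSelfAdjoint R) (ψ : L2R) (hk : MemLp k 2 (specMeasure hR ψ)) :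
    ⟪ψ, funVec hR ψ hk⟫_ℂ = ((∫ x, k x ∂specMeasure hR ψ : ℝ) : ℂ) := by
  have h := re_inner_funVec hR ψ (memLp_one hR ψ) hk
  rw [funVec_one] at h
  simp only [one_mul] at h
  refine Complex.ext ?_ ?_
  · rw [h, Complex.ofReal_re]
  · rw [inner_funVec_im, Complex.ofReal_im]

theorem inner_borelFun (hR : IsSelfAdjoint R) (hk : IsBddMeasurable k) (ψ : L2R) :
    ⟪ψ, borelFun hR hk ψ⟫_ℂ = ((∫ x, k x ∂specMeasure hR ψ : ℝ) : ℂ) :=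
  inner_funVec hR ψ _

theorem isSelfAdjoint_borelFun (hR : IsSelfAdjoint R) (hk : IsBddMeasurable k) :
    IsSelfAdjoint (borelFun hR hk) := by
  rw [ContinuousLinearMap.isSelfAdjoint_iff_isSymmetric,
    LinearMap.isSymmetric_iff_inner_map_self_real]
  intro ψ
  change starRingEnd ℂ ⟪borelFun hR hk ψ, ψ⟫_ℂ = ⟪borelFun hR hk ψ, ψ⟫_ℂ
  rw [← inner_conj_symm, inner_borelFun, Complex.conj_ofReal, Complex.conj_ofReal]

theorem isPositive_borelFun (hR : IsSelfAdjoint R) (hk : IsBddMeasurable k) (h0 : ∀ x, 0 ≤ k x) :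
    (borelFun hR hk).IsPositive := by
  refine isPositive_of_re_inner (isSelfAdjoint_borelFun hR hk) fun ψ => ?_
  rw [inner_borelFun, Complex.ofReal_re]
  exact integral_nonneg h0

theorem isBddMeasurable_indicator {B : Set (spectrum ℝ R)} (hB : MeasurableSet B) :
    IsBddMeasurable (B.indicator fun _ => (1 : ℝ)) where
  measurable := measurable_const.indicator hB
  bdd := ⟨1, fun x => by
    by_cases hx : x ∈ B <;> simp [hx]⟩

/-- The spectral projection of a Borel set. -/
def specProj (hR : IsSelfAdjoint R) {B : Set (spectrum ℝ R)} (hB : MeasurableSet B) :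
    L2R →L[ℂ] L2R :=
  borelFun hR (isBddMeasurable_indicator hB)

theorem inner_specProj (hR : IsSelfAdjoint R) {B : Set (spectrum ℝ R)} (hB : MeasurableSet B)
    (ψ : L2R) : ⟪ψ, specProj hR hB ψ⟫_ℂ = (((specMeasure hR ψ).real B : ℝ) : ℂ) := by
  rw [specProj, inner_borelFun, integral_indicator_const _ hB, smul_eq_mul, mul_one]

theorem normSq_specProj (hR : IsSelfAdjoint R) {B : Set (spectrum ℝ R)} (hB : MeasurableSet B)
    (ψ : L2R) : ‖specProj hR hB ψ‖ ^ 2 = (specMeasure hR ψ).real B := by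
  rw [specProj, borelFun_apply, normSq_funVec]
  have e : ∀ x, (B.indicator (fun _ => (1 : ℝ)) x) ^ 2 = B.indicator (fun _ => (1 : ℝ)) x :=
    fun x => by by_cases hx : x ∈ B <;> simp [hx]
  simp only [e]
  rw [integral_indicator_const _ hB, smul_eq_mul, mul_one]

theorem isStarProjection_specProj (hR : IsSelfAdjoint R) {B : Set (spectrum ℝ R)}
    (hB : MeasurableSet B) : IsStarProjection (specProj hR hB) := by
  have hs : IsSelfAdjoint (specProj hR hB) := isSelfAdjoint_borelFun hR _
  refine ⟨?_, hs⟩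
  refine ContinuousLinearMap.coe_inj.1 ((ext_inner_map _ _).1 fun ψ => ?_)
  change ⟪specProj hR hB (specProj hR hB ψ), ψ⟫_ℂ = ⟪specProj hR hB ψ, ψ⟫_ℂ
  have h1 : ⟪specProj hR hB (specProj hR hB ψ), ψ⟫_ℂ
      = ⟪specProj hR hB ψ, specProj hR hB ψ⟫_ℂ := hs.isSymmetric _ _
  rw [h1, inner_self_eq_norm_sq_to_K, ← inner_conj_symm, inner_specProj, Complex.conj_ofReal,
    ← normSq_specProj hR hB]
  push_cast
  rfl

theorem specProj_sub (hR : IsSelfAdjoint R) {A B : Set (spectrum ℝ R)} (hA : MeasurableSet A)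
    (hB : MeasurableSet B) (hAB : A ⊆ B) (ψ : L2R) :
    specProj hR hB ψ - specProj hR hA ψ = specProj hR (hB.diff hA) ψ := by
  rw [specProj, specProj, specProj, borelFun_apply, borelFun_apply, borelFun_apply, ← funVec_sub]
  refine funVec_congr hR ψ _ _ (ae_of_all _ fun x => ?_)
  rw [Pi.sub_apply]
  by_cases h1 : x ∈ A
  · simp [h1, hAB h1]
  · by_cases h2 : x ∈ B <;> simp [h1, h2]

theorem specProj_congr (hR : IsSelfAdjoint R) {A B : Set (spectrum ℝ R)} (hA : MeasurableSet A)
    (hB : MeasurableSet B) (h : A = B) : specProj hR hA = specProj hR hB := by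
  subst h
  rfl

theorem specProj_empty (hR : IsSelfAdjoint R) (ψ : L2R) :
    specProj hR MeasurableSet.empty ψ = 0 := by
  rw [← norm_eq_zero, ← pow_eq_zero_iff two_ne_zero, normSq_specProj, measureReal_empty]

theorem sum_specProj (hR : IsSelfAdjoint R) {B : ℕ → Set (spectrum ℝ R)}
    (hB : ∀ n, MeasurableSet (B n)) (hd : Pairwise (Function.onFun Disjoint B)) (ψ : L2R)
    (s : Finset ℕ) : ∑ n ∈ s, specProj hR (hB n) ψ
      = specProj hR (s.measurableSet_biUnion fun n _ => hB n) ψ := by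
  classical
  induction s using Finset.induction_on with
  | empty =>
    rw [Finset.sum_empty, ← specProj_empty hR ψ]
    exact congrArg (fun A => A ψ) (specProj_congr hR _ _
      (show (∅ : Set (spectrum ℝ R)) = ⋃ n ∈ (∅ : Finset ℕ), B n by simp))
  | insert a s ha ih =>
    have hsub : B a ⊆ ⋃ n ∈ insert a s, B n :=
      Set.subset_biUnion_of_mem (u := B) (Finset.mem_insert_self a s)
    rw [Finset.sum_insert ha, ih, eq_comm, ← sub_eq_iff_eq_add', specProj_sub hR _ _ hsub]
    refine congrArg (fun A => A ψ) (specProj_congr hR _ _ ?_)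
    rw [Finset.set_biUnion_insert, Set.union_sdiff_left, sdiff_eq_left, Set.disjoint_iUnion₂_left]
    exact fun n hn => hd fun h => ha (h ▸ hn)

theorem hasSum_specProj (hR : IsSelfAdjoint R) {B : ℕ → Set (spectrum ℝ R)}
    (hB : ∀ n, MeasurableSet (B n)) (hd : Pairwise (Function.onFun Disjoint B)) (ψ : L2R) :
    HasSum (fun n => specProj hR (hB n) ψ) (specProj hR (MeasurableSet.iUnion hB) ψ) := by
  set m := specMeasure hR ψ with hm
  have hU : HasSum (fun n => m (B n)) (m (⋃ n, B n)) := by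
    rw [measure_iUnion hd hB]
    exact ENNReal.summable.hasSum
  have hU' : Tendsto (fun s : Finset ℕ => m.real (⋃ n, B n) - m.real (⋃ n ∈ s, B n)) atTop
      (𝓝 0) := by
    have h1 := (ENNReal.tendsto_toReal (measure_ne_top m (⋃ n, B n))).comp hU
    have h2 := h1.const_sub (m.real (⋃ n, B n))
    rw [← measureReal_def, sub_self] at h2
    refine h2.congr fun s => ?_
    rw [measureReal_def (s := ⋃ n ∈ s, B n), measure_biUnion_finset (fun i _ j _ h => hd h)
      fun n _ => hB n]
    rfl
  rw [HasSum, SummationFilter.unconditional_filter, tendsto_iff_norm_sub_tendsto_zero]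
  have h3 := hU'.sqrt
  rw [Real.sqrt_zero] at h3
  refine h3.congr fun s => ?_
  have hsub : ⋃ n ∈ s, B n ⊆ ⋃ n, B n := Set.iUnion₂_subset_iUnion _ _
  rw [sum_specProj hR hB hd, norm_sub_rev, specProj_sub hR _ _ hsub,
    ← Real.sqrt_sq (norm_nonneg (specProj hR _ ψ)), normSq_specProj,
    measureReal_sdiff hsub (s.measurableSet_biUnion fun n _ => hB n)]

/-- The projection-valued measure of the operator `τ(R)`. -/
def spectralFamily (hR : IsSelfAdjoint R) {τ : spectrum ℝ R → ℝ} (hτ : Measurable τ) :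
    ProjectionMeasure where
  proj B := by
    classical
    exact if hB : MeasurableSet B then specProj hR (hτ hB) else 0
  isStarProjection B hB := by
    rw [dif_pos hB]
    exact isStarProjection_specProj hR _
  proj_univ := by
    rw [dif_pos MeasurableSet.univ]
    ext1 ψ
    rw [specProj, borelFun_apply, one_apply_eq_self]
    refine (funVec_congr hR ψ _ (memLp_one hR ψ) (ae_of_all _ fun x => ?_)).trans
      (funVec_one hR ψ)
    simp
  hasSum_iUnion B hB hd ψ := by
    rw [dif_pos (MeasurableSet.iUnion hB)]
    have h := hasSum_specProj hR (fun n => hτ (hB n))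
      (fun i j hij => (hd hij).preimage τ) ψ
    have e : specProj hR (hτ (MeasurableSet.iUnion hB))
        = specProj hR (MeasurableSet.iUnion fun n => hτ (hB n)) :=
      specProj_congr hR _ _ Set.preimage_iUnion
    rw [e]
    convert h using 2 with n
    rw [dif_pos (hB n)]

theorem spectralFamily_measure (hR : IsSelfAdjoint R) {τ : spectrum ℝ R → ℝ} (hτ : Measurable τ)
    (ψ : L2R) : (spectralFamily hR hτ).measure ψ = (specMeasure hR ψ).map τ := by
  ext B hB
  rw [ProjectionMeasure.measure, Measure.ofMeasurable_apply B hB, Measure.map_apply hτ hB]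
  have e : (spectralFamily hR hτ).proj B = specProj hR (hτ hB) := dif_pos hB
  rw [e, inner_specProj, Complex.ofReal_re, ofReal_measureReal]

end BorelCalculus

end RHF

end

noncomputable section

namespace RHF

/-! ### The spectral resolution of the Hamiltonian -/

section SpectralResolution

open IsResolvent

variable {R : L2R →L[ℂ] L2R} {Φ : ℝ → ℝ} {M : ℝ} {hΦ : Continuous Φ}

/-- The spectral parameter `1 / r - M` of the Hamiltonian in terms of that of its resolvent. At the
point `r = 0`, which carries no spectral measure, its value is `-M`. -/
def resToHam (M : ℝ) (x : spectrum ℝ R) : ℝ := (x : ℝ)⁻¹ - M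

theorem measurable_resToHam (M : ℝ) : Measurable (resToHam M : spectrum ℝ R → ℝ) :=
  measurable_subtype_coe.inv.sub_const M

theorem IsResolvent.nonneg_of_mem_spectrum (hR : IsResolvent hΦ M R) (hM : ∀ x, 1 ≤ Φ x + M)
    (x : spectrum ℝ R) : 0 ≤ (x : ℝ) := by
  have h : R.IsPositive := isPositive_of_re_inner (hR.isSelfAdjoint hM) fun y =>
    (sq_nonneg _).trans (hR.normSq_le_re_inner hM y)
  exact spectrum_nonneg_of_nonneg ((ContinuousLinearMap.nonneg_iff_isPositive _).2 h) x.2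

theorem IsResolvent.neg_le_resToHam (hR : IsResolvent hΦ M R) (hM : ∀ x, 1 ≤ Φ x + M)
    (x : spectrum ℝ R) : -M ≤ resToHam M x := by
  have := inv_nonneg.2 (hR.nonneg_of_mem_spectrum hM x)
  rw [resToHam]
  linarith

/-- The resolvent is injective, so that `0` carries no spectral measure. -/
theorem IsResolvent.ae_ne_zero (hR : IsResolvent hΦ M R) (hM : ∀ x, 1 ≤ Φ x + M) (ψ : L2R) :
    ∀ᵐ x : spectrum ℝ R ∂specMeasure (hR.isSelfAdjoint hM) ψ, (x : ℝ) ≠ 0 := by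
  set hs := hR.isSelfAdjoint hM
  have hB : MeasurableSet {x : spectrum ℝ R | (x : ℝ) = 0} :=
    measurable_subtype_coe (measurableSet_singleton (0 : ℝ))
  have h1 : R (specProj hs hB ψ) = 0 := by
    rw [specProj, borelFun_apply, ← funVec_id_mul, ← norm_eq_zero, ← pow_eq_zero_iff two_ne_zero,
      normSq_funVec]
    refine integral_eq_zero_of_ae (ae_of_all _ fun x => ?_)
    by_cases hx : (x : ℝ) = 0 <;> simp [hx]
  have h2 := normSq_specProj hs hB ψ
  rw [hR.eq_zero_of_apply hM h1, norm_zero, sq, zero_mul, eq_comm, measureReal_eq_zero_iff] at h2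
  exact measure_eq_zero_iff_ae_notMem.1 h2

/-- The spectral measure of `R φ` is `x²` times that of `φ`. -/
theorem specMeasure_apply (hs : IsSelfAdjoint R) (φ : L2R) :
    specMeasure hs (R φ) = (specMeasure hs φ).withDensity fun x => ENNReal.ofReal ((x : ℝ) ^ 2) := by
  set i : C(spectrum ℝ R, ℝ) := (ContinuousMap.id ℝ).restrict (spectrum ℝ R) with hi
  have hmeas : Measurable fun x : spectrum ℝ R => ENNReal.ofReal ((x : ℝ) ^ 2) :=
    (measurable_subtype_coe.pow_const 2).ennreal_ofReal
  have hfin : IsFiniteMeasure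
      ((specMeasure hs φ).withDensity fun x => ENNReal.ofReal ((x : ℝ) ^ 2)) := by
    refine isFiniteMeasure_withDensity_ofReal ?_
    exact (integrable_continuousMap hs φ (i ^ 2)).2
  refine ext_of_forall_integral_eq_of_IsFiniteMeasure fun f => ?_
  rw [integral_withDensity_eq_integral_toReal_smul hmeas (ae_of_all _ fun _ => ENNReal.ofReal_lt_top)]
  have h1 := integral_specMeasure hs (R φ) (f : C(spectrum ℝ R, ℝ))
  have h2 := integral_specMeasure hs φ (i * ((f : C(spectrum ℝ R, ℝ)) * i))
  have h3 : (⟪φ, cfcHom hs (i * ((f : C(spectrum ℝ R, ℝ)) * i)) φ⟫_ℂ).re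
      = (⟪R φ, cfcHom hs (f : C(spectrum ℝ R, ℝ)) (R φ)⟫_ℂ).re := by
    rw [map_mul, map_mul, hi, cfcHom_id]
    exact congrArg Complex.re (hs.isSymmetric φ _).symm
  rw [h3, ← h1] at h2
  refine h2.symm.trans (integral_congr_ae (ae_of_all _ fun x => ?_))
  change (x : ℝ) * (f x * x) = _
  simp only [smul_eq_mul, ENNReal.toReal_ofReal (sq_nonneg (x : ℝ))]
  ring

theorem memLp_inv (hs : IsSelfAdjoint R) (φ : L2R) :
    MemLp (fun x : spectrum ℝ R => (x : ℝ)⁻¹) 2 (specMeasure hs (R φ)) := by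
  have hm : Measurable fun x : spectrum ℝ R => (x : ℝ)⁻¹ := measurable_subtype_coe.inv
  have hmeas : Measurable fun x : spectrum ℝ R => ENNReal.ofReal ((x : ℝ) ^ 2) :=
    (measurable_subtype_coe.pow_const 2).ennreal_ofReal
  rw [memLp_two_iff_integrable_sq hm.aestronglyMeasurable, specMeasure_apply,
    integrable_withDensity_iff hmeas (ae_of_all _ fun _ => ENNReal.ofReal_lt_top)]
  refine Integrable.of_bound ((hm.pow_const 2).mul hmeas.ennreal_toReal).aestronglyMeasurable 1
    (ae_of_all _ fun x => ?_)
  rw [ENNReal.toReal_ofReal (sq_nonneg _), ← mul_pow, norm_pow]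
  by_cases hx : (x : ℝ) = 0
  · simp [hx]
  · rw [inv_mul_cancel₀ hx, norm_one, one_pow]

theorem IsResolvent.apply_funVec_inv (hR : IsResolvent hΦ M R) (hM : ∀ x, 1 ≤ Φ x + M) {ψ : L2R}
    (h : MemLp (fun x : spectrum ℝ R => (x : ℝ)⁻¹) 2 (specMeasure (hR.isSelfAdjoint hM) ψ)) :
    R (funVec (hR.isSelfAdjoint hM) ψ h) = ψ := by
  rw [← funVec_id_mul]
  refine (funVec_congr _ ψ _ (memLp_one _ ψ) ?_).trans (funVec_one _ ψ)
  filter_upwards [hR.ae_ne_zero hM ψ] with x hx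
  exact mul_inv_cancel₀ hx

theorem integrable_sq_map_iff (hs : IsSelfAdjoint R) (M : ℝ) (ψ : L2R) :
    Integrable (fun x : ℝ => x ^ 2) ((specMeasure hs ψ).map (resToHam M))
      ↔ MemLp (fun x : spectrum ℝ R => (x : ℝ)⁻¹) 2 (specMeasure hs ψ) := by
  have hc : MemLp (fun _ : spectrum ℝ R => M) 2 (specMeasure hs ψ) := memLp_const M
  rw [integrable_map_measure (by fun_prop) (measurable_resToHam M).aemeasurable]
  change Integrable (fun x => resToHam M x ^ 2) _ ↔ _
  rw [← memLp_two_iff_integrable_sq (measurable_resToHam M).aestronglyMeasurable]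
  refine ⟨fun h => ?_, fun h => h.sub hc⟩
  refine (h.add hc).ae_eq (ae_of_all _ fun x => ?_)
  simp [resToHam]

theorem mem_domain_schrodinger_iff (Φ : ℝ → ℝ) (ψ : L2R) :
    ψ ∈ (schrodinger Φ).domain ↔ ∃ w, IsSchrodingerPair Φ ψ w := by
  rw [LinearPMap.mem_domain_iff, schrodinger_graph]
  rfl

theorem isSchrodingerPair_schrodinger (Φ : ℝ → ℝ) (ψ : (schrodinger Φ).domain) :
    IsSchrodingerPair Φ ψ (schrodinger Φ ψ) := by
  have h1 : ((ψ : L2R), schrodinger Φ ψ) ∈ (schrodinger Φ).graph :=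
    (schrodinger Φ).mem_graph ψ
  rwa [schrodinger_graph] at h1

/-- The spectral resolution of the Hamiltonian is the image of that of its resolvent `R`. A vector `ψ`
is in the range of `R`, the domain of the Hamiltonian, if and only if `1 / x` is square integrable
with respect to its spectral measure. -/
theorem IsResolvent.isSpectralResolution (hR : IsResolvent hΦ M R) (hM : ∀ x, 1 ≤ Φ x + M) :
    IsSpectralResolution
      (spectralFamily (hR.isSelfAdjoint hM) (measurable_resToHam M)) (schrodinger Φ) := by
  set hs := hR.isSelfAdjoint hM
  refine ⟨fun ψ => ?_, fun ψ => ?_⟩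
  · rw [spectralFamily_measure, integrable_sq_map_iff, mem_domain_schrodinger_iff]
    constructor
    · rintro ⟨w, hw⟩
      rw [(hR.isSchrodingerPair_iff hM ψ w).1 hw]
      exact memLp_inv hs _
    · intro h
      have h1 := hR.apply_isSchrodingerPair hM (funVec hs ψ h)
      rw [hR.apply_funVec_inv hM h] at h1
      exact ⟨_, h1⟩
  · have hp := isSchrodingerPair_schrodinger Φ ψ
    have hψ := (hR.isSchrodingerPair_iff hM _ _).1 hp
    have hm : MemLp (fun x : spectrum ℝ R => (x : ℝ)⁻¹) 2 (specMeasure hs ψ) := by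
      rw [hψ]
      exact memLp_inv hs _
    have hw : schrodinger Φ ψ = funVec hs ψ hm - (M : ℂ) • (ψ : L2R) := by
      rw [eq_sub_iff_add_eq, ← sub_eq_zero]
      refine hR.eq_zero_of_apply hM ?_
      rw [map_sub, hR.apply_funVec_inv hM, sub_eq_zero]
      exact hψ.symm
    have hc : MemLp (fun _ : spectrum ℝ R => M) 2 (specMeasure hs ψ) := memLp_const M
    have e1 : funVec hs ψ hm - (M : ℂ) • (ψ : L2R) = funVec hs ψ (hm.sub hc) := by
      rw [funVec_sub hs _ hm hc]
      congr 1
      have h3 := funVec_const_smul hs (ψ : L2R) (memLp_one hs ψ) M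
      rw [funVec_one] at h3
      refine (Complex.coe_smul M (ψ : L2R)).trans (h3.symm.trans ?_)
      exact funVec_congr hs _ _ _ (ae_of_all _ fun x => mul_one M)
    rw [hw, e1, inner_funVec, spectralFamily_measure,
      integral_map (measurable_resToHam M).aemeasurable (by fun_prop)]
    rfl

theorem IsResolvent.isFunctionOf (hR : IsResolvent hΦ M R) (hM : ∀ x, 1 ≤ Φ x + M) {f : ℝ → ℝ}
    (hf : Measurable f) (hk : IsBddMeasurable fun x : spectrum ℝ R => f (resToHam M x)) :
    IsFunctionOf (schrodinger Φ) f (borelFun (hR.isSelfAdjoint hM) hk) := by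
  refine ⟨hf, _, hR.isSpectralResolution hM, fun ψ => ?_⟩
  rw [spectralFamily_measure, integrable_map_measure hf.aestronglyMeasurable
    (measurable_resToHam M).aemeasurable, inner_borelFun,
    integral_map (measurable_resToHam M).aemeasurable hf.aestronglyMeasurable]
  exact ⟨(hk.memLp _ ψ).integrable (by norm_num), rfl⟩

theorem borelFun_eigenvector (hs : IsSelfAdjoint R) {f : ℝ → ℝ}
    (hk : IsBddMeasurable fun x : spectrum ℝ R => f (resToHam M x)) {e : L2R} {r : ℝ}
    (he : R e = (r : ℂ) • e) : borelFun hs hk e = (f (r⁻¹ - M) : ℂ) • e := by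
  rw [borelFun_apply]
  refine funVec_eigenvector hs he _ fun x hx => ?_
  rw [resToHam, hx]

/-- If the quadratic form of the Hamiltonian is at least `c` on the kernel of an operator which
commutes with it, then the spectral measures of the vectors in that kernel live in `[c, ∞)`. -/
theorem IsResolvent.ae_le_resToHam (hR : IsResolvent hΦ M R) (hM : ∀ x, 1 ≤ Φ x + M)
    {G : L2R →L[ℂ] L2R} (hG : Commute R G) {c : ℝ}
    (hc : ∀ ψ w, IsSchrodingerPair Φ ψ w → G ψ = 0 → c * ‖ψ‖ ^ 2 ≤ (⟪ψ, w⟫_ℂ).re) {φ : L2R}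
    (hφ : G φ = 0) : ∀ᵐ x ∂specMeasure (hR.isSelfAdjoint hM) φ, c ≤ resToHam M x := by
  set hs := hR.isSelfAdjoint hM
  have hB : MeasurableSet {x : spectrum ℝ R | resToHam M x < c} :=
    measurable_resToHam M measurableSet_Iio
  set B := {x : spectrum ℝ R | resToHam M x < c} with hBdef
  set k : spectrum ℝ R → ℝ := B.indicator fun _ => 1 with hkdef
  have hk : MemLp k 2 (specMeasure hs φ) := (isBddMeasurable_indicator hB).memLp hs φ
  have hk' := memLp_id_mul hs φ hk
  set χ := funVec hs φ hk with hχ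
  have hGχ : G χ = 0 := apply_funVec_eq_zero hs hG hφ hk
  have hRχ : funVec hs φ hk' = R χ := funVec_id_mul hs φ hk
  have hGR : G (R χ) = 0 := by
    have h4 : R (G χ) = G (R χ) := congrArg (fun A => A χ) hG.eq
    rw [← h4, hGχ, map_zero]
  have h1 := hc _ _ (hR.apply_isSchrodingerPair hM χ) hGR
  have h2 : (⟪R χ, χ - (M : ℂ) • R χ⟫_ℂ).re
      = (∫ x, (x * k x) * k x ∂specMeasure hs φ) - M * ‖R χ‖ ^ 2 := by
    rw [inner_sub_right, inner_smul_right, Complex.sub_re, Complex.re_ofReal_mul, ← hRχ, hχ,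
      re_inner_funVec]
    congr 2
    exact (norm_sq_eq_re_inner (𝕜 := ℂ) _).symm
  have h3 : ‖R χ‖ ^ 2 = ∫ x, (x * k x) ^ 2 ∂specMeasure hs φ := by
    rw [← hRχ, normSq_funVec]
  have i1 : Integrable (fun x => (x * k x) * k x) (specMeasure hs φ) := hk'.integrable_mul hk
  have i2 : Integrable (fun x => (M + c) * (x * k x) ^ 2) (specMeasure hs φ) :=
    hk'.integrable_sq.const_mul _
  have h5 : ∫ x, ((M + c) * (x * k x) ^ 2 - (x * k x) * k x) ∂specMeasure hs φ ≤ 0 := by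
    rw [integral_sub i2 i1, integral_const_mul, ← h3]
    rw [h2] at h1
    linarith
  have hpos : ∀ x ∈ B, (x : ℝ) ≠ 0 → 0 < (M + c) * (x : ℝ) ^ 2 - x := by
    intro x hx hx0
    have hx1 : 0 < (x : ℝ) := (hR.nonneg_of_mem_spectrum hM x).lt_of_ne' hx0
    have hx2 : (x : ℝ)⁻¹ < M + c := by
      have : (x : ℝ)⁻¹ - M < c := hx
      linarith
    have hx3 : 1 < (M + c) * x := by
      have := mul_lt_mul_of_pos_right hx2 hx1
      rwa [inv_mul_cancel₀ hx0] at this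
    nlinarith
  have h6 : 0 ≤ᵐ[specMeasure hs φ] fun x => (M + c) * (x * k x) ^ 2 - (x * k x) * k x := by
    filter_upwards [hR.ae_ne_zero hM φ] with x hx0
    rw [Pi.zero_apply]
    by_cases hx : x ∈ B
    · simpa [hkdef, hx] using (hpos x hx hx0).le
    · simp [hkdef, hx]
  have h7 := (integral_eq_zero_iff_of_nonneg_ae h6 (i2.sub i1)).1
    (le_antisymm h5 (integral_nonneg_of_ae h6))
  filter_upwards [h7, hR.ae_ne_zero hM φ] with x h8 hx0
  by_contra hx
  have hxB : x ∈ B := not_le.1 hx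
  have h9 := hpos x hxB hx0
  simp only [hkdef, Set.indicator_of_mem hxB, mul_one, Pi.zero_apply] at h8
  linarith

end SpectralResolution

end RHF

end

noncomputable section

namespace RHF

/-! ### The first order condition on eigenvectors -/

section FirstOrder

variable {b : ℝ} {μ : ℝ → ℝ} {G R : L2R →L[ℂ] L2R}

/-- Convexity on the left of `g`; the quadratic term makes the secant bound valid also beyond `s`. -/
theorem F_sub_le_left (hb : b ≠ 0) {g s x : ℝ} (hs : 0 < s) (hsg : s ≤ g) (hx : 0 ≤ x)
    (hxg : x ≤ g) : F b (g - x) - F b g ≤ -((F b g - F b (g - s)) / s) * x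
      + (F b g - F b (g - s)) / s * (x ^ 2 / s) := by
  set α := (F b g - F b (g - s)) / s with hα
  have hα0 : 0 ≤ α := div_nonneg (sub_nonneg.2 (F_mono hb (by linarith) (by linarith))) hs.le
  have hαs : α * s = F b g - F b (g - s) := div_mul_cancel₀ _ hs.ne'
  rcases le_total x s with h | h
  · have h1 := (convexOn_F hb).2 (Set.mem_univ g) (Set.mem_univ (g - s))
      (sub_nonneg.2 ((div_le_one hs).2 h)) (div_nonneg hx hs.le) (sub_add_cancel 1 (x / s))
    simp only [smul_eq_mul] at h1
    have h2 : (1 - x / s) * g + x / s * (g - s) = g - x := by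
      field_simp
      ring
    have h3 : (1 - x / s) * F b g + x / s * F b (g - s) = F b g - α * x := by
      rw [hα]
      field_simp
      ring
    rw [h2, h3] at h1
    have h4 : 0 ≤ α * (x ^ 2 / s) := by positivity
    linarith
  · have h1 := F_mono hb (sub_nonneg.2 hxg) (sub_le_self g hx)
    have h2 : x ≤ x ^ 2 / s := by
      rw [le_div_iff₀ hs]
      nlinarith
    nlinarith

theorem F_sub_le_right (hb : b ≠ 0) {g m s x : ℝ} (hg : 0 ≤ g) (hs : 0 < s) (hx : 0 ≤ x)
    (hxm : x ≤ m) : F b (g + x) - F b g ≤ (F b (g + s) - F b g) / s * x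
      + (2 * Real.pi * (g + m) + |b|) * (x ^ 2 / s) := by
  have hm : 0 ≤ m := hx.trans hxm
  have hβ0 : 0 ≤ (F b (g + s) - F b g) / s :=
    div_nonneg (sub_nonneg.2 (F_mono hb hg (by linarith))) hs.le
  have hC : 0 ≤ 2 * Real.pi * (g + m) + |b| := by positivity
  rcases le_total x s with h | h
  · have h1 := (convexOn_F hb).2 (Set.mem_univ g) (Set.mem_univ (g + s))
      (sub_nonneg.2 ((div_le_one hs).2 h)) (div_nonneg hx hs.le) (sub_add_cancel 1 (x / s))
    simp only [smul_eq_mul] at h1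
    have h2 : (1 - x / s) * g + x / s * (g + s) = g + x := by
      field_simp
      ring
    have h3 : (1 - x / s) * F b g + x / s * F b (g + s)
        = F b g + (F b (g + s) - F b g) / s * x := by
      field_simp
      ring
    rw [h2, h3] at h1
    have h4 : 0 ≤ (2 * Real.pi * (g + m) + |b|) * (x ^ 2 / s) := by positivity
    linarith
  · have h1 := F_sub_le hb (x := g) (y := g + x) (m := g + m) (by linarith) (by linarith)
    have h2 : x ≤ x ^ 2 / s := by
      rw [le_div_iff₀ hs]
      nlinarith
    have h3 := mul_le_mul_of_nonneg_left h2 hC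
    have h4 : 0 ≤ (F b (g + s) - F b g) / s * x := by positivity
    rw [add_sub_cancel_left] at h1
    linarith

theorem deform_eigenvector (hG : G.IsPositive) {e : L2R} (he : ‖e‖ = 1) {g : ℝ}
    (hGe : G e = (g : ℂ) • e) (t : ℝ) :
    deform G e ((-t : ℝ) : ℂ) = G + (-((2 * t - t ^ 2) * g)) • ketbra e := by
  have hee : ⟪e, e⟫_ℂ = 1 := by rw [inner_self_eq_norm_sq_to_K, he]; simp
  have h : ∀ x, deform G e ((-t : ℝ) : ℂ) x = G x
      + (starRingEnd ℂ ((-t : ℝ) : ℂ) * ⟪e, x⟫_ℂ) • G e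
      + (((-t : ℝ) : ℂ) * (⟪G e, x⟫_ℂ + starRingEnd ℂ ((-t : ℝ) : ℂ) * ⟪e, x⟫_ℂ * ⟪e, G e⟫_ℂ)) • e :=
    deform_apply hG.isSelfAdjoint e _
  ext1 x
  rw [h, add_apply, real_smul_apply, InnerProductSpace.rankOne_apply, hGe,
    inner_smul_left, inner_smul_right, hee, Complex.conj_ofReal, Complex.conj_ofReal, add_assoc,
    smul_smul, smul_smul, ← add_smul]
  congr 2
  push_cast
  ring

/-- Both eigenvalues enter the trace of `F(b, ·)` separately. -/
theorem trace_transfer (hb : b ≠ 0) (hG : G.IsPositive) (ht : trace G ≠ ⊤) {e f : L2R}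
    (he : ‖e‖ = 1) (hf : ‖f‖ = 1) (hef : ⟪e, f⟫_ℂ = 0) {g g' : ℝ} (hGe : G e = (g : ℂ) • e)
    (hGf : G f = (g' : ℂ) • f) {t y : ℝ} (hx : 0 ≤ (2 * t - t ^ 2) * g)
    (hy : 0 ≤ y) :
    trace (deform G e ((-t : ℝ) : ℂ) + ketbra (((Real.sqrt y : ℝ) : ℂ) • f))
        ≤ ENNReal.ofReal ((trace G).toReal + y) ∧
      (trace (cfc (F b) (deform G e ((-t : ℝ) : ℂ)
        + ketbra (((Real.sqrt y : ℝ) : ℂ) • f)))).toReal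
        = (trace (cfc (F b) G)).toReal + (F b (g - (2 * t - t ^ 2) * g) - F b g)
          + (F b (g' + y) - F b g') := by
  set x := (2 * t - t ^ 2) * g with hxdef
  have hA : (deform G e ((-t : ℝ) : ℂ)).IsPositive := deform_isPositive hG e _
  have heq := deform_eigenvector hG he hGe t
  rw [← hxdef] at heq
  set A := deform G e ((-t : ℝ) : ℂ) with hAdef
  have hAf : A f = (g' : ℂ) • f := by
    rw [heq, add_apply, real_smul_apply, InnerProductSpace.rankOne_apply, hef, zero_smul, smul_zero,
      add_zero, hGf]
  have hGA : G = A + x • ketbra e := by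
    rw [heq, neg_smul, neg_add_cancel_right]
  have hAG : trace A ≤ trace G := by
    rw [hGA, trace_add hA (smul_ketbra_isPositive hx e)]
    exact le_self_add
  have hAt : trace A ≠ ⊤ := ne_top_of_le_ne_top ht hAG
  rw [← smul_ketbra hy]
  have hT : (A + y • ketbra f).IsPositive := hA.add (smul_ketbra_isPositive hy f)
  have hTt : trace (A + y • ketbra f) = trace A + ENNReal.ofReal y := by
    rw [trace_add hA (smul_ketbra_isPositive hy f), trace_smul_ketbra hy, hf, one_pow, mul_one]
  constructor
  · rw [hTt, ENNReal.ofReal_add ENNReal.toReal_nonneg hy, ENNReal.ofReal_toReal ht]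
    exact add_le_add_left hAG _
  · have h1 := congrArg ENNReal.toReal (trace_cfc_F_add_smul_ketbra hb hG he hGe (-x))
    have h2 := congrArg ENNReal.toReal (trace_cfc_F_add_smul_ketbra hb hA hf hAf y)
    rw [← heq, ENNReal.toReal_add (trace_cfc_F_ne_top hb hA hAt) ENNReal.ofReal_ne_top,
      ENNReal.toReal_add (trace_cfc_F_ne_top hb hG ht) ENNReal.ofReal_ne_top,
      ENNReal.toReal_ofReal (F_nonneg _ _), ENNReal.toReal_ofReal (F_nonneg _ _),
      ← sub_eq_add_neg] at h1
    have hTt' : trace (A + y • ketbra f) ≠ ⊤ := by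
      rw [hTt]
      exact ENNReal.add_ne_top.2 ⟨hAt, ENNReal.ofReal_ne_top⟩
    rw [ENNReal.toReal_add (trace_cfc_F_ne_top hb hT hTt') ENNReal.ofReal_ne_top,
      ENNReal.toReal_add (trace_cfc_F_ne_top hb hA hAt) ENNReal.ofReal_ne_top,
      ENNReal.toReal_ofReal (F_nonneg _ _), ENNReal.toReal_ofReal (F_nonneg _ _)] at h2
    linarith

/-- The bounds on the transfer of particles from `e` to `f`, with the secant slopes of `F(b, ·)` as
the coefficients to first order. -/
theorem trace_transfer_le (hb : b ≠ 0) (hG : G.IsPositive) (htr : trace G ≠ ⊤) {e f : L2R}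
    (he : ‖e‖ = 1) (hf : ‖f‖ = 1) (hef : ⟪e, f⟫_ℂ = 0) {g g' : ℝ} (hg : 0 < g) (hg' : 0 ≤ g')
    (hGe : G e = (g : ℂ) • e) (hGf : G f = (g' : ℂ) • f) {s s' : ℝ} (hs : 0 < s) (hs' : 0 < s')
    (hs'g : s' ≤ g) {m t y : ℝ} (hm : 0 ≤ m) (ht : 0 ≤ t) (ht1 : t ≤ 1)
    (hy : y = (2 * t - t ^ 2) * m) :
    trace (deform G e ((-t : ℝ) : ℂ) + ketbra (((Real.sqrt y : ℝ) : ℂ) • f))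
        ≤ ENNReal.ofReal ((trace G).toReal + m) ∧
      (trace (cfc (F b) (deform G e ((-t : ℝ) : ℂ)
        + ketbra (((Real.sqrt y : ℝ) : ℂ) • f)))).toReal
        ≤ (trace (cfc (F b) G)).toReal
          + t * (2 * ((F b (g' + s) - F b g') / s) * m - 2 * ((F b g - F b (g - s')) / s') * g)
          + t ^ 2 * ((F b g - F b (g - s')) / s' * g + (F b g - F b (g - s')) / s' * (4 * g ^ 2 / s')
            + (2 * Real.pi * (g' + m) + |b|) * (4 * m ^ 2 / s)) := by
  have hτ0 : 0 ≤ 2 * t - t ^ 2 := by nlinarith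
  have hτ1 : 2 * t - t ^ 2 ≤ 1 := by nlinarith [sq_nonneg (1 - t)]
  have hτ2 : (2 * t - t ^ 2) ^ 2 ≤ 4 * t ^ 2 := by
    have : 2 * t - t ^ 2 ≤ 2 * t := by nlinarith
    nlinarith
  have hy0 : 0 ≤ y := hy ▸ mul_nonneg hτ0 hm
  have hym : y ≤ m := hy ▸ mul_le_of_le_one_left hm hτ1
  have hx0 := mul_nonneg hτ0 hg.le
  have hxg : (2 * t - t ^ 2) * g ≤ g := mul_le_of_le_one_left hg.le hτ1
  obtain ⟨h1, h2⟩ := trace_transfer hb hG htr he hf hef hGe hGf hx0 hy0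
  refine ⟨h1.trans (ENNReal.ofReal_le_ofReal (by linarith)), ?_⟩
  rw [h2]
  have h3 := F_sub_le_left hb hs' hs'g hx0 hxg
  have h4 := F_sub_le_right hb hg' hs hy0 hym
  have hα0 : 0 ≤ (F b g - F b (g - s')) / s' :=
    div_nonneg (sub_nonneg.2 (F_mono hb (by linarith) (by linarith))) hs'.le
  have hβ0 : 0 ≤ (F b (g' + s) - F b g') / s :=
    div_nonneg (sub_nonneg.2 (F_mono hb hg' (by linarith))) hs.le
  generalize (F b g - F b (g - s')) / s' = α at *
  generalize (F b (g' + s) - F b g') / s = β at *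
  have h5 : ((2 * t - t ^ 2) * g) ^ 2 / s' ≤ t ^ 2 * (4 * g ^ 2 / s') := by
    rw [mul_pow, ← mul_div_assoc]
    refine div_le_div_of_nonneg_right ?_ hs'.le
    have := mul_le_mul_of_nonneg_right hτ2 (sq_nonneg g)
    linarith
  have h6 : y ^ 2 / s ≤ t ^ 2 * (4 * m ^ 2 / s) := by
    rw [hy, mul_pow, ← mul_div_assoc]
    refine div_le_div_of_nonneg_right ?_ hs.le
    have := mul_le_mul_of_nonneg_right hτ2 (sq_nonneg m)
    linarith
  have h7 := mul_le_mul_of_nonneg_left h5 hα0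
  have h8 := mul_le_mul_of_nonneg_left h6
    (show 0 ≤ 2 * Real.pi * (g' + m) + |b| by positivity)
  have h9 : β * y ≤ β * (2 * t * m) := by
    refine mul_le_mul_of_nonneg_left ?_ hβ0
    rw [hy]
    have := mul_nonneg (sq_nonneg t) hm
    linarith
  linarith

/-- Normalised test functions approximate a unit vector of the domain in the graph norm. -/
theorem IsResolvent.exists_seq_unit_test {Φ : ℝ → ℝ} {M : ℝ} {hΦ : Continuous Φ}
    (hR : IsResolvent hΦ M R) (hM : ∀ x, 1 ≤ Φ x + M) {ψ w : L2R} (h : IsSchrodingerPair Φ ψ w)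
    (hψ : ‖ψ‖ = 1) :
    ∃ u : ℕ → testSpace, (∀ n, ‖toL2 (u n)‖ = 1) ∧ Tendsto (fun n => toL2 (u n)) atTop (𝓝 ψ) ∧
      Tendsto (fun n => hamT hΦ (u n)) atTop (𝓝 w) := by
  obtain ⟨u, h1, h2⟩ := hR.exists_seq_test hM h
  have h3 : Tendsto (fun n => ‖toL2 (u n)‖) atTop (𝓝 1) := hψ ▸ h1.norm
  obtain ⟨N, hN⟩ := eventually_atTop.1 (h3.eventually (lt_mem_nhds zero_lt_one))
  have h4 : Tendsto (fun n => ((‖toL2 (u n)‖⁻¹ : ℝ) : ℂ)) atTop (𝓝 ((1⁻¹ : ℝ) : ℂ)) :=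
    (Complex.continuous_ofReal.tendsto _).comp (h3.inv₀ one_ne_zero)
  rw [inv_one, Complex.ofReal_one] at h4
  have h5 := h4.smul h1
  have h6 := h4.smul h2
  rw [one_smul] at h5 h6
  refine ⟨fun n => ((‖toL2 (u (n + N))‖⁻¹ : ℝ) : ℂ) • u (n + N), fun n => ?_, ?_, ?_⟩
  · rw [map_smul, norm_smul, Complex.norm_real, norm_inv, norm_norm]
    exact inv_mul_cancel₀ (hN _ (Nat.le_add_left N n)).ne'
  · simp only [map_smul]
    exact (tendsto_add_atTop_iff_nat N).2 h5
  · simp only [map_smul]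
    exact (tendsto_add_atTop_iff_nat N).2 h6

/-- The first order condition: moving particles from the eigenvector `e` to the eigenvector `f`
does not lower the energy. -/
theorem IsMinimizer.slope_le (hG : IsMinimizer b μ G) (hb : b ≠ 0) (hμ : Integrable μ)
    (hμ0 : ∀ᵐ x, 0 ≤ μ x) {hΦ : Continuous (statePot G μ)} {M : ℝ} (hR : IsResolvent hΦ M R)
    (hM : ∀ x, 1 ≤ statePot G μ x + M) {e we f wf : L2R} (he : ‖e‖ = 1) (hf : ‖f‖ = 1)
    (hef : ⟪e, f⟫_ℂ = 0) {g g' : ℝ} (hg : 0 < g) (hg' : 0 ≤ g') (hGe : G e = (g : ℂ) • e)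
    (hGf : G f = (g' : ℂ) • f) (hpe : IsSchrodingerPair (statePot G μ) e we)
    (hpf : IsSchrodingerPair (statePot G μ) f wf) {s s' : ℝ} (hs : 0 < s) (hs' : 0 < s')
    (hs'g : s' ≤ g) :
    (⟪we, e⟫_ℂ).re + (F b g - F b (g - s')) / s'
      ≤ (⟪wf, f⟫_ℂ).re + (F b (g' + s) - F b g') / s := by
  set α := (F b g - F b (g - s')) / s' with hα
  set β := (F b (g' + s) - F b g') / s with hβ
  have hα0 : 0 ≤ α := div_nonneg (sub_nonneg.2 (F_mono hb (by linarith) (by linarith))) hs'.le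
  have hβ0 : 0 ≤ β := div_nonneg (sub_nonneg.2 (F_mono hb hg' (by linarith))) hs.le
  have hGp := hG.isPositive
  have htr := hG.trace_ne_top
  obtain ⟨u, hu1, hu, hHu⟩ := hR.exists_seq_unit_test hM hpe he
  obtain ⟨φ, hφ1, hφ, hHφ⟩ := hR.exists_seq_unit_test hM hpf hf
  set K₀ := (trace G).toReal with hK₀
  have hK₀0 : 0 ≤ K₀ := ENNReal.toReal_nonneg
  set m : ℕ → ℝ := fun n => (⟪toL2 (u n), G (toL2 (u n))⟫_ℂ).re with hm
  have hm0 : ∀ n, 0 ≤ m n := fun n => hGp.re_inner_nonneg_right _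
  have hGu : Tendsto (fun n => G (toL2 (u n))) atTop (𝓝 ((g : ℂ) • e)) := by
    rw [← hGe]
    exact (G.continuous.tendsto e).comp hu
  have hree : (⟪e, e⟫_ℂ).re = 1 := by
    rw [inner_self_eq_norm_sq_to_K, he]
    simp
  have hmg : Tendsto m atTop (𝓝 g) := by
    have h1 := (Complex.continuous_re.tendsto _).comp (hu.inner (𝕜 := ℂ) hGu)
    rw [inner_smul_right, Complex.re_ofReal_mul, hree, mul_one] at h1
    exact h1
  -- the error of replacing the test functions by `e` and `f`, with the parameter `η`
  set D : ℝ → ℕ → ℝ := fun η n => ‖toL2 (u n) - e‖ ^ 2 / η + η * ‖G (toL2 (u n))‖ ^ 2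
      + η * ‖e‖ ^ 2 + ‖G (toL2 (u n) - e)‖ ^ 2 / η
      + m n * (‖toL2 (φ n) - f‖ ^ 2 / η + η * ‖toL2 (φ n) + f‖ ^ 2) with hD
  have hfirst : ∀ η > 0, ∀ n, 2 * (⟪hamT hΦ (u n), G (toL2 (u n))⟫_ℂ).re
      ≤ 2 * m n * (⟪hamT hΦ (φ n), toL2 (φ n)⟫_ℂ).re + (2 * β * m n - 2 * α * g)
        + (2 * Real.pi * ((K₀ + m n) + (D η n + m n)) + |b|) * D η n := by
    intro η hη n
    have hmn := hm0 n
    refine hG.first_variation hb hμ hμ0 hΦ (hu1 n) (hφ1 n) rfl e f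
      (γ₂ := α * g + α * (4 * g ^ 2 / s')
        + (2 * Real.pi * (g' + m n) + |b|) * (4 * m n ^ 2 / s)) ?_ hη (by positivity) le_rfl
    rintro t y ht ht1 hy
    exact trace_transfer_le hb hGp htr he hf hef hg hg' hGe hGf hs hs' hs'g hmn ht.le ht1 hy
  -- the limit of the test functions, at a fixed `η`
  have hlim : ∀ η > 0, 2 * (g * (⟪we, e⟫_ℂ).re)
      ≤ 2 * g * (⟪wf, f⟫_ℂ).re + (2 * β * g - 2 * α * g)
        + (2 * Real.pi * ((K₀ + g) + (η * (g ^ 2 + 1 + 4 * g) + g)) + |b|)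
          * (η * (g ^ 2 + 1 + 4 * g)) := by
    intro η hη
    have hX := (Complex.continuous_re.tendsto _).comp (hHu.inner (𝕜 := ℂ) hGu)
    rw [inner_smul_right, Complex.re_ofReal_mul] at hX
    have hP := (Complex.continuous_re.tendsto _).comp (hHφ.inner (𝕜 := ℂ) hφ)
    have d1 : Tendsto (fun n => ‖toL2 (u n) - e‖ ^ 2 / η) atTop (𝓝 0) := by
      have := (((hu.sub_const e).norm).pow 2).div_const η
      simpa using this
    have d2 : Tendsto (fun n => η * ‖G (toL2 (u n))‖ ^ 2) atTop (𝓝 (η * g ^ 2)) := by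
      have := (hGu.norm.pow 2).const_mul η
      rwa [norm_smul, he, mul_one, Complex.norm_real, Real.norm_eq_abs, sq_abs] at this
    have d4 : Tendsto (fun n => ‖G (toL2 (u n) - e)‖ ^ 2 / η) atTop (𝓝 0) := by
      have h1 := (G.continuous.tendsto _).comp (hu.sub_const e)
      have := ((h1.norm).pow 2).div_const η
      simpa using this
    have d5 : Tendsto (fun n => ‖toL2 (φ n) - f‖ ^ 2 / η) atTop (𝓝 0) := by
      have := (((hφ.sub_const f).norm).pow 2).div_const η
      simpa using this
    have d6 : Tendsto (fun n => η * ‖toL2 (φ n) + f‖ ^ 2) atTop (𝓝 (η * 4)) := by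
      have := (((hφ.add_const f).norm).pow 2).const_mul η
      have e2 : ‖f + f‖ = 2 := by
        rw [← two_smul ℝ f, norm_smul, hf, mul_one]
        norm_num
      rw [e2] at this
      norm_num at this
      exact this
    have hDl : Tendsto (D η) atTop (𝓝 (η * (g ^ 2 + 1 + 4 * g))) := by
      have := (((d1.add d2).add_const (η * ‖e‖ ^ 2)).add d4).add (hmg.mul (d5.add d6))
      refine this.congr' (EventuallyEq.refl _ _) |>.trans (le_of_eq ?_)
      rw [he]
      congr 1
      ring
    refine le_of_tendsto_of_tendsto' (hX.const_mul 2) ?_ (hfirst η hη)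
    exact (((hmg.const_mul 2).mul hP).add ((hmg.const_mul (2 * β)).sub_const _)).add
      ((((((hmg.const_add K₀).add (hDl.add hmg)).const_mul (2 * Real.pi))).add_const |b|).mul hDl)
  have hη : Tendsto (fun η : ℝ => 2 * g * (⟪wf, f⟫_ℂ).re + (2 * β * g - 2 * α * g)
        + (2 * Real.pi * ((K₀ + g) + (η * (g ^ 2 + 1 + 4 * g) + g)) + |b|)
          * (η * (g ^ 2 + 1 + 4 * g))) (𝓝[>] 0)
      (𝓝 (2 * g * (⟪wf, f⟫_ℂ).re + (2 * β * g - 2 * α * g))) := by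
    have hc : Continuous fun η : ℝ => 2 * g * (⟪wf, f⟫_ℂ).re + (2 * β * g - 2 * α * g)
        + (2 * Real.pi * ((K₀ + g) + (η * (g ^ 2 + 1 + 4 * g) + g)) + |b|)
          * (η * (g ^ 2 + 1 + 4 * g)) := by fun_prop
    have := (hc.tendsto 0).mono_left (nhdsWithin_le_nhds (s := Set.Ioi 0))
    simpa using this
  have hfin := ge_of_tendsto hη (eventually_nhdsWithin_of_forall hlim)
  have : g * ((⟪we, e⟫_ℂ).re + α) ≤ g * ((⟪wf, f⟫_ℂ).re + β) := by linarith
  exact le_of_mul_le_mul_left this hg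

end FirstOrder

end RHF

end

noncomputable section

namespace RHF

/-! ### The Euler-Lagrange equation -/

section EulerLagrange

variable {b : ℝ} {μ : ℝ → ℝ} {G R : L2R →L[ℂ] L2R}

theorem norm_sq_inner_sqrt_eigenvector {A : L2R →L[ℂ] L2R} (hA : A.IsPositive) {e : L2R} {a : ℝ}
    (ha : 0 ≤ a) (h : A e = (a : ℂ) • e) (ψ : L2R) :
    ‖⟪e, CFC.sqrt A ψ⟫_ℂ‖ ^ 2 = a * ‖⟪e, ψ⟫_ℂ‖ ^ 2 := by
  have h1 : CFC.sqrt A e = ((√a : ℝ) : ℂ) • e := by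
    rw [CFC.sqrt_eq_real_sqrt A ((ContinuousLinearMap.nonneg_iff_isPositive _).2 hA),
      cfcₙ_eq_cfc]
    exact cfc_apply_eigenvector_L2R hA.isSelfAdjoint h Real.continuous_sqrt
  rw [← inner_sqrt_left, h1, inner_smul_left, norm_mul, mul_pow, RCLike.norm_conj,
    Complex.norm_real, Real.norm_eq_abs, sq_abs, Real.sq_sqrt ha]

/-- Comparison of positive operators, of which only the smaller one has to be diagonal: the values
of the larger one are compared on the range of the smaller one. -/
theorem le_of_eigenbasis {A B : L2R →L[ℂ] L2R} (hA : A.IsPositive) (hB : B.IsPositive) {ι : Type}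
    (e : HilbertBasis ι ℂ L2R) (h : ∀ i, B (e i) = 0 ∨ ∃ a b' : ℝ, A (e i) = (a : ℂ) • e i ∧
      B (e i) = (b' : ℂ) • e i ∧ 0 ≤ b' ∧ b' ≤ a) : B ≤ A := by
  have hsum : ∀ (T : L2R →L[ℂ] L2R), T.IsPositive → ∀ ψ,
      HasSum (fun i => ‖⟪e i, CFC.sqrt T ψ⟫_ℂ‖ ^ 2) (⟪ψ, T ψ⟫_ℂ).re := fun T hT ψ => by
    have h1 := Complex.hasSum_re (e.hasSum_inner_mul_inner (CFC.sqrt T ψ) (CFC.sqrt T ψ))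
    have h2 : (⟪CFC.sqrt T ψ, CFC.sqrt T ψ⟫_ℂ).re = (⟪ψ, T ψ⟫_ℂ).re := by
      rw [inner_sqrt_left, sqrt_sqrt_apply hT]
    rw [h2] at h1
    have h3 : ∀ i, ‖⟪e i, CFC.sqrt T ψ⟫_ℂ‖ ^ 2
        = (⟪CFC.sqrt T ψ, e i⟫_ℂ * ⟪e i, CFC.sqrt T ψ⟫_ℂ).re := fun i => by
      rw [← inner_conj_symm (CFC.sqrt T ψ) (e i), ← Complex.normSq_eq_conj_mul_self,
        Complex.ofReal_re, Complex.normSq_eq_norm_sq]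
    simp only [h3]
    exact h1
  refine le_of_re_inner hB.isSelfAdjoint hA.isSelfAdjoint fun ψ => ?_
  refine hasSum_le (fun i => ?_) (hsum B hB ψ) (hsum A hA ψ)
  rcases h i with h0 | ⟨a, b', h1, h2, h3, h4⟩
  · have h5 : B (e i) = ((0 : ℝ) : ℂ) • e i := by rw [h0, Complex.ofReal_zero, zero_smul]
    rw [norm_sq_inner_sqrt_eigenvector hB le_rfl h5, zero_mul]
    positivity
  · rw [norm_sq_inner_sqrt_eigenvector hA (h3.trans h4) h1,
      norm_sq_inner_sqrt_eigenvector hB h3 h2]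
    exact mul_le_mul_of_nonneg_right h4 (sq_nonneg _)

/-- An eigenvector of the resolvent is an eigenvector of the Hamiltonian. -/
theorem IsResolvent.isSchrodingerPair_eigenvector {Φ : ℝ → ℝ} {hΦ : Continuous Φ} {M : ℝ}
    (hR : IsResolvent hΦ M R) (hM : ∀ x, 1 ≤ Φ x + M) {e : L2R} (he : ‖e‖ = 1) {r : ℝ}
    (h : R e = (r : ℂ) • e) : IsSchrodingerPair Φ e (((r⁻¹ - M : ℝ) : ℂ) • e) := by
  have hr : (r : ℂ) ≠ 0 := by
    intro h0
    rw [h0, zero_smul] at h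
    rw [hR.eq_zero_of_apply hM h, norm_zero] at he
    exact zero_ne_one he
  rw [hR.isSchrodingerPair_iff hM, ← add_smul, map_smul, h, smul_smul]
  push_cast
  rw [sub_add_cancel, inv_mul_cancel₀ hr, one_smul]

/-- The Euler-Lagrange equation in terms of the joint eigenvectors of `G` and of the Hamiltonian:
the multiplier `l` separates the slopes of the energy in the directions which remove particles
from those which add particles. -/
theorem IsMinimizer.exists_multiplier (hG : IsMinimizer b μ G) (hb : b ≠ 0) (hμ : Integrable μ)
    (hμ0 : ∀ᵐ x, 0 ≤ μ x) {hΦ : Continuous (statePot G μ)} {M : ℝ} (hR : IsResolvent hΦ M R)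
    (hM : ∀ x, 1 ≤ statePot G μ x + M) {ι : Type} {e : HilbertBasis ι ℂ L2R} {g r : ι → ℝ}
    (hGe : ∀ i, G (e i) = (g i : ℂ) • e i) (hg : ∀ i, 0 ≤ g i)
    (hRe : ∀ i, g i ≠ 0 → R (e i) = (r i : ℂ) • e i) :
    ∃ l : ℝ, (∀ i, g i ≠ 0 → g i ∈ h b (l - ((r i)⁻¹ - M))) ∧
      ∀ ψ w, IsSchrodingerPair (statePot G μ) ψ w → G ψ = 0 →
        (l - |b| / 2) * ‖ψ‖ ^ 2 ≤ (⟪ψ, w⟫_ℂ).re := by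
  have hpair : ∀ i, g i ≠ 0 →
      IsSchrodingerPair (statePot G μ) (e i) ((((r i)⁻¹ - M : ℝ) : ℂ) • e i) := fun i hi =>
    hR.isSchrodingerPair_eigenvector hM (e.orthonormal.1 i) (hRe i hi)
  have hval : ∀ i, (⟪(((r i)⁻¹ - M : ℝ) : ℂ) • e i, e i⟫_ℂ).re = (r i)⁻¹ - M := fun i => by
    rw [inner_smul_left, Complex.conj_ofReal, Complex.re_ofReal_mul, inner_self_eq_norm_sq_to_K,
      e.orthonormal.1 i]
    simp
  have hpos : ∀ i, g i ≠ 0 → 0 < g i := fun i hi => (hg i).lt_of_ne' hi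
  -- removing from `i` and adding to `j`
  have hij : ∀ i j, g i ≠ 0 → g j ≠ 0 → ∀ s s' : ℝ, 0 < s → 0 < s' → s' ≤ g i →
      (r i)⁻¹ - M + (F b (g i) - F b (g i - s')) / s'
        ≤ (r j)⁻¹ - M + (F b (g j + s) - F b (g j)) / s := by
    intro i j hi hj s s' hs hs' hsg
    by_cases hne : i = j
    · subst hne
      have h1 := F_add_slope_le hb (g i) (g i + s)
      have h2 := F_add_slope_le hb (g i) (g i - s')
      have h3 : (F b (g i) - F b (g i - s')) / s' ≤ slopeF b (g i) := by
        rw [div_le_iff₀ hs']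
        linarith
      have h4 : slopeF b (g i) ≤ (F b (g i + s) - F b (g i)) / s := by
        rw [le_div_iff₀ hs]
        linarith
      linarith
    · have h1 := hG.slope_le hb hμ hμ0 hR hM (e.orthonormal.1 i) (e.orthonormal.1 j)
        (e.orthonormal.2 hne) (hpos i hi) (hg j) (hGe i) (hGe j) (hpair i hi) (hpair j hj) hs hs' hsg
      rwa [hval, hval] at h1
  -- removing from `i` and adding to a unit vector in the kernel of `G`
  have hif : ∀ i f w, g i ≠ 0 → ‖f‖ = 1 → G f = 0 → IsSchrodingerPair (statePot G μ) f w →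
      ∀ s' : ℝ, 0 < s' → s' ≤ g i →
      (r i)⁻¹ - M + (F b (g i) - F b (g i - s')) / s' ≤ (⟪f, w⟫_ℂ).re + |b| / 2 := by
    intro i f w hi hf hGf hp s' hs' hsg
    have horth : ⟪e i, f⟫_ℂ = 0 := by
      have h1 : ⟪G (e i), f⟫_ℂ = ⟪e i, G f⟫_ℂ := hG.isPositive.isSelfAdjoint.isSymmetric _ _
      rw [hGe, hGf, inner_zero_right, inner_smul_left, Complex.conj_ofReal] at h1
      exact (mul_eq_zero.1 h1).resolve_left (Complex.ofReal_ne_zero.2 hi)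
    have hs : 0 < |b| / (2 * Real.pi) := by positivity
    have h1 := hG.slope_le hb hμ hμ0 hR hM (e.orthonormal.1 i) hf horth (hpos i hi) le_rfl (hGe i)
      (by rw [hGf, Complex.ofReal_zero, zero_smul]) (hpair i hi) hp hs hs' hsg
    rw [hval, zero_add, F_zero, sub_zero, F_kink hb, mul_div_cancel_right₀ _ hs.ne'] at h1
    have h2 : (⟪w, f⟫_ℂ).re = (⟪f, w⟫_ℂ).re := inner_re_symm (𝕜 := ℂ) w f
    rwa [h2] at h1
  have hscale : ∀ c : ℝ, (∀ f w, ‖f‖ = 1 → G f = 0 → IsSchrodingerPair (statePot G μ) f w →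
      c ≤ (⟪f, w⟫_ℂ).re) → ∀ ψ w, IsSchrodingerPair (statePot G μ) ψ w → G ψ = 0 →
      c * ‖ψ‖ ^ 2 ≤ (⟪ψ, w⟫_ℂ).re := by
    intro c hc ψ w hp hGψ
    rcases eq_or_ne ψ 0 with rfl | hψ
    · simp
    · have hn : 0 < ‖ψ‖ := norm_pos_iff.2 hψ
      have h1 := hc (((‖ψ‖⁻¹ : ℝ) : ℂ) • ψ) (((‖ψ‖⁻¹ : ℝ) : ℂ) • w) (by
        rw [norm_smul, Complex.norm_real, norm_inv, norm_norm, inv_mul_cancel₀ hn.ne'])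
        (by rw [map_smul, hGψ, smul_zero]) (hp.smul _)
      rw [inner_smul_left, inner_smul_right, Complex.conj_ofReal, Complex.re_ofReal_mul,
        Complex.re_ofReal_mul, ← mul_assoc, ← mul_inv, ← sq] at h1
      rwa [inv_mul_eq_div, le_div_iff₀ (by positivity)] at h1
  by_cases hJ : ∃ j, g j ≠ 0
  · obtain ⟨j, hj⟩ := hJ
    -- `S` consists of the slopes in the directions which remove particles
    set S : Set ℝ := {a | ∃ i s', g i ≠ 0 ∧ 0 < s' ∧ s' ≤ g i ∧
      a = (r i)⁻¹ - M + (F b (g i) - F b (g i - s')) / s'} with hS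
    have hSne : S.Nonempty := ⟨_, j, g j, hj, hpos j hj, le_rfl, rfl⟩
    have hSbd : BddAbove S := by
      refine ⟨(r j)⁻¹ - M + (F b (g j + 1) - F b (g j)) / 1, ?_⟩
      rintro a ⟨i, s', hi, hs', hsg, rfl⟩
      exact hij i j hi hj 1 s' one_pos hs' hsg
    refine ⟨sSup S, fun i hi => ?_, hscale _ fun f w hf hGf hp => ?_⟩
    · refine mem_h_of_slopes (hpos i hi) (fun s hs => ?_) fun s hs hsg => ?_
      · have h1 : sSup S ≤ (r i)⁻¹ - M + (F b (g i + s) - F b (g i)) / s := by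
          refine csSup_le hSne ?_
          rintro a ⟨k, s', hk, hs', hsg, rfl⟩
          exact hij k i hk hi s s' hs hs' hsg
        have h2 : sSup S - ((r i)⁻¹ - M) ≤ (F b (g i + s) - F b (g i)) / s := by linarith
        rw [le_div_iff₀ hs] at h2
        linarith
      · have h1 := le_csSup hSbd ⟨i, s, hi, hs, hsg, rfl⟩
        have h2 : (F b (g i) - F b (g i - s)) / s ≤ sSup S - ((r i)⁻¹ - M) := by linarith
        rw [div_le_iff₀ hs] at h2
        linarith
    · have h1 : sSup S ≤ (⟪f, w⟫_ℂ).re + |b| / 2 := by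
        refine csSup_le hSne ?_
        rintro a ⟨k, s', hk, hs', hsg, rfl⟩
        exact hif k f w hk hf hGf hp s' hs' hsg
      linarith
  · push Not at hJ
    -- without particles any multiplier below the spectrum will do
    refine ⟨|b| / 2 - M, fun i hi => absurd (hJ i) hi, fun ψ w hp _ => ?_⟩
    have h1 := (hR.isSchrodingerPair_iff hM ψ w).1 hp
    have h2 := (sq_nonneg _).trans (hR.normSq_le_re_inner hM (w + (M : ℂ) • ψ))
    rw [← h1, inner_add_left, inner_smul_left, Complex.conj_ofReal, Complex.add_re,
      Complex.re_ofReal_mul] at h2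
    have h3 : (⟪ψ, ψ⟫_ℂ).re = ‖ψ‖ ^ 2 := (norm_sq_eq_re_inner (𝕜 := ℂ) ψ).symm
    have h4 : (⟪w, ψ⟫_ℂ).re = (⟪ψ, w⟫_ℂ).re := inner_re_symm (𝕜 := ℂ) w ψ
    rw [h3, h4] at h2
    linarith

/-- The functions `h⁻` and `h⁺` of `l - H` are bounded, since the Hamiltonian is bounded below. -/
theorem IsResolvent.isBddMeasurable_comp {Φ : ℝ → ℝ} {hΦ : Continuous Φ} {M : ℝ}
    (hR : IsResolvent hΦ M R) (hM : ∀ x, 1 ≤ Φ x + M) {k : ℝ → ℝ} (hk : Monotone k)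
    (hk0 : ∀ y, 0 ≤ k y) (l : ℝ) :
    IsBddMeasurable fun x : spectrum ℝ R => k (l - resToHam M x) where
  measurable := hk.measurable.comp (measurable_const.sub (measurable_resToHam M))
  bdd := ⟨k (l + M), fun x => by
    have := hR.neg_le_resToHam hM x
    rw [abs_of_nonneg (hk0 _)]
    exact hk (by linarith)⟩

/-- The bounds `h⁻(l - H) ≤ G ≤ h⁺(l - H)`: in the joint eigenbasis they reduce to the condition on the
multiplier `l`, and on the kernel of `G` only the lower bound says something. -/
theorem IsMinimizer.eulerLagrange (hG : IsMinimizer b μ G) (hb : b ≠ 0) (hμ : Integrable μ)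
    (hμ0 : ∀ᵐ x, 0 ≤ μ x) {hΦ : Continuous (statePot G μ)} {M : ℝ} (hR : IsResolvent hΦ M R)
    (hM : ∀ x, 1 ≤ statePot G μ x + M) (hGR : Commute G R) :
    ∃ (l : ℝ) (Aminus Aplus : L2R →L[ℂ] L2R),
      IsFunctionOf (schrodinger (statePot G μ)) (fun x => hMinus b (l - x)) Aminus ∧
      IsFunctionOf (schrodinger (statePot G μ)) (fun x => hPlus b (l - x)) Aplus ∧
      Aminus ≤ G ∧ G ≤ Aplus := by
  have hs := hR.isSelfAdjoint hM
  obtain ⟨ι, e, g, r, hGe, hg, hRe⟩ := exists_eigenbasis hG.isPositive hG.trace_ne_top hs hGR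
  obtain ⟨l, hl, hker⟩ := hG.exists_multiplier hb hμ hμ0 hR hM hGe hg hRe
  have hkm := hR.isBddMeasurable_comp hM (monotone_hMinus hb) (hMinus_nonneg b) l
  have hkp := hR.isBddMeasurable_comp hM (monotone_hPlus hb) (hPlus_nonneg b) l
  have hm : Measurable fun x => hMinus b (l - x) :=
    (monotone_hMinus hb).measurable.comp (measurable_const.sub measurable_id)
  have hp : Measurable fun x => hPlus b (l - x) :=
    (monotone_hPlus hb).measurable.comp (measurable_const.sub measurable_id)
  refine ⟨l, borelFun hs hkm, borelFun hs hkp, hR.isFunctionOf hM hm hkm,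
    hR.isFunctionOf hM hp hkp, ?_, ?_⟩
  · refine le_of_eigenbasis hG.isPositive (isPositive_borelFun hs hkm fun x => hMinus_nonneg _ _) e
      fun i => ?_
    by_cases hi : g i = 0
    · -- on the kernel of `G` the Hamiltonian is at least `l - |b| / 2`, where `h⁻(l - ·)` vanishes
      left
      have hGi : G (e i) = 0 := by rw [hGe, hi, Complex.ofReal_zero, zero_smul]
      have hae := hR.ae_le_resToHam hM hGR.symm hker hGi
      rw [borelFun_apply, ← norm_eq_zero, ← pow_eq_zero_iff two_ne_zero, normSq_funVec]
      refine integral_eq_zero_of_ae ?_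
      filter_upwards [hae] with x hx
      rw [hMinus_eq_zero hb (by linarith), sq, zero_mul]
      rfl
    · exact Or.inr ⟨g i, _, hGe i,
        borelFun_eigenvector (f := fun x => hMinus b (l - x)) hs hkm (hRe i hi),
        hMinus_nonneg _ _, hMinus_le (hl i hi)⟩
  · refine le_of_eigenbasis (isPositive_borelFun hs hkp fun x => hPlus_nonneg _ _) hG.isPositive e
      fun i => ?_
    by_cases hi : g i = 0
    · left
      rw [hGe, hi, Complex.ofReal_zero, zero_smul]
    · exact Or.inr ⟨_, g i,
        borelFun_eigenvector (f := fun x => hPlus b (l - x)) hs hkp (hRe i hi), hGe i, hg i,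
        le_hPlus (hl i hi)⟩

end EulerLagrange

end RHF

end

theorem mainTheorem4 (b : ℝ) (hb : b ≠ 0) (μ : ℝ → ℝ) (hμ : MeasureTheory.Integrable μ)
    (hμ0 : ∀ᵐ x, 0 ≤ μ x) (G : RHF.L2R →L[ℂ] RHF.L2R) (hG : RHF.IsMinimizer b μ G) :
    ∃ Φ : ℝ → ℝ,
      RHF.IsMeanFieldPotential (fun x => RHF.density G x - μ x) Φ ∧
      (∀ Ψ : ℝ → ℝ, RHF.IsMeanFieldPotential (fun x => RHF.density G x - μ x) Ψ → Ψ = Φ) ∧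
      (∃ (l : ℝ) (Aminus Aplus : RHF.L2R →L[ℂ] RHF.L2R),
        RHF.IsFunctionOf (RHF.schrodinger Φ) (fun x => RHF.hMinus b (l - x)) Aminus ∧
        RHF.IsFunctionOf (RHF.schrodinger Φ) (fun x => RHF.hPlus b (l - x)) Aplus ∧
        Aminus ≤ G ∧ G ≤ Aplus) ∧
      RHF.Commutes G (RHF.schrodinger Φ) := by
  have hpot := RHF.isMeanFieldPotential_meanField (hG.hartree_ne_top hb hμ hμ0)
  have hΦ := hG.continuous_statePot hμ
  obtain ⟨c, hc⟩ := hG.exists_le_statePot hb hμ hμ0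
  have hM : ∀ x, 1 ≤ RHF.statePot G μ x + (1 - c) := fun x => by linarith [hc x]
  obtain ⟨R, hR⟩ := RHF.exists_isResolvent hΦ hM
  have hGR := hR.commute hM fun u => hG.isSchrodingerPair_apply hb hμ hμ0 hΦ u
  exact ⟨RHF.statePot G μ, hpot, fun Ψ hΨ => hpot.unique hΨ,
    hG.eulerLagrange hb hμ hμ0 hR hM hGR, hR.commutes_schrodinger hM hGR⟩
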